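/- For $d\ge 1$ and $r>0$ let $\mathbb{B}^d_{r/2}(z)=\{x\in\mathbb{R}^d:\|x-z\|\le r/2\}$, and let \[ K_{d,r}(x,y)=\frac{1}{\mathrm{vol}(\mathbb{B}^d_{r/2}(0))}\int_{\mathbb{R}^d}\delta_x\big(\mathbb{B}^d_{r/2}(z)\big)\,\delta_y\big(\mathbb{B}^d_{r/2}(z)\big)\,\mathrm{d}z,\qquad x,y\in\mathbb{R}^d, \] where $\delta_x$ is the Dirac measure at $x$. This is a positive semidefinite kernel; let $\mathcal{H}$ denote the reproducing kernel Hilbert space of complex-valued functions on $\mathbb{R}^3$ with kernel $K_{3,r}$. Let $\mathbb{H}^2(\mathbb{R}^3)$ be the Sobolev space of all $u\in L_2(\mathbb{R}^3)$ with $\|u\|_{\mathbb{H}^2}:=\|(1+\|\xi\|^2)\,\hat u(\xi)\|_{L_2(\mathbb{R}^3)}<\infty$. For every $m\ge 0$ let $(Y^m_l)_l$ be an orthonormal basis, in $L_2(\mathbb{S}^2)$ with respect to the normalized surface measure, of the (finite-dimensional) space of spherical harmonics of degree $m$, that is, of the restrictions to $\mathbb{S}^2$ of the homogeneous harmonic polynomials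 of degree $m$. The Sobolev space $\mathbb{H}^{3/2}(\mathbb{S}^2)$ is the reproducing kernel Hilbert space with the kernel \[ (x,y)\mapsto\sum_{m=0}^\infty (1+m(m+1))^{-3/2}\sum_{l}Y^m_l(x)\overline{Y^m_l(y)},\qquad x,y\in\mathbb{S}^2 . \] Let $r\ge 1$. Then: 1. $\mathcal{H}$ is continuously embedded into $\mathbb{H}^2(\mathbb{R}^3)$: there is an injective bounded linear map $J:\mathcal{H}\to\mathbb{H}^2(\mathbb{R}^3)$ such that $Jf=f$ almost everywhere for all $f\in\mathcal{H}$. 2. The reverse embedding does not hold: there is $u\in\mathbb{H}^2(\mathbb{R}^3)$ that does not coincide almost everywhere with any element of $\mathcal{H}$. 3. The restriction of $K_{3,r}$ to $\mathbb{S}^2\times\mathbb{S}^2$ reproduces $\mathbb{H}^{3/2}(\mathbb{S}^2)$ with an equivalent norm: the series above converges for all $x,y\in\mathbb{S}^2$ and defines a positive semidefinite kernel, and the reproducing kernel Hilbert space of $K_{3,r}|_{\mathbb{S}^2\times\mathbb{S}^2}$ and $\mathbb{H}^{3/2}(\mathbb{S}^2)$ consist of the same functions $\mathbb{S}^2\to\mathbb{C}$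 and have equivalent norms. -/

import Mathlib

open MeasureTheory Metric

open scoped SchwartzMap ComplexConjugate

noncomputable section

namespace BallDiscrepancy

/-! ### Scalar kernels and their reproducing kernel Hilbert spaces -/

/-- A scalar kernel `k`, read as an operator-valued kernel `X × X → (ℂ →L[ℂ] ℂ)`; this is the
format in which `RKHS.OfKernel` takes its kernels. -/
def kernelMatrix {X : Type*} (k : X → X → ℂ) : Matrix X X (ℂ →L[ℂ] ℂ) :=
  Matrix.of fun x y => k x y • ContinuousLinearMap.id ℂ ℂ

/-! ### The ball-discrepancy kernel -/

/-- The ball-discrepancy kernel on `ℝ^d`: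
`K_{d,r}(x,y) = vol(B_{r/2})⁻¹ ∫ δ_x(B_{r/2}(z)) δ_y(B_{r/2}(z)) dz`. -/
def ballKernel (d : ℕ) (r : ℝ) (x y : EuclideanSpace ℝ (Fin d)) : ℝ :=
  (volume.real (closedBall (0 : EuclideanSpace ℝ (Fin d)) (r / 2)))⁻¹ *
    ∫ z : EuclideanSpace ℝ (Fin d),
      (Measure.dirac x).real (closedBall z (r / 2)) * (Measure.dirac y).real (closedBall z (r / 2))

/-- `K_{d,r}` as a kernel for complex-valued functions on `ℝ^d`. -/
def ballMatrix (d : ℕ) (r : ℝ) :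
    Matrix (EuclideanSpace ℝ (Fin d)) (EuclideanSpace ℝ (Fin d)) (ℂ →L[ℂ] ℂ) :=
  kernelMatrix fun x y => (ballKernel d r x y : ℂ)

/-- The restriction of `K_{d,r}` to `S^{d-1} × S^{d-1}`. -/
def ballMatrixSphere (d : ℕ) (r : ℝ) :
    Matrix (sphere (0 : EuclideanSpace ℝ (Fin d)) 1) (sphere (0 : EuclideanSpace ℝ (Fin d)) 1)
      (ℂ →L[ℂ] ℂ) :=
  kernelMatrix fun x y => (ballKernel d r x y : ℂ)

theorem integrable_dirac_mul_dirac (d : ℕ) (s : ℝ) (x y : EuclideanSpace ℝ (Fin d)) :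
    Integrable fun z : EuclideanSpace ℝ (Fin d) =>
      (Measure.dirac x).real (closedBall z s) * (Measure.dirac y).real (closedBall z s) := by
  have h : ∀ w z : EuclideanSpace ℝ (Fin d),
      (Measure.dirac w).real (closedBall z s) = (closedBall w s).indicator (fun _ => (1 : ℝ)) z := by
    intro w z
    rw [measureReal_def, Measure.dirac_apply' _ measurableSet_closedBall]
    by_cases hw : dist w z ≤ s
    · have hw' : dist z w ≤ s := by rwa [dist_comm]
      simp [Set.indicator, mem_closedBall, hw, hw']
    · have hw' : ¬ dist z w ≤ s := by rwa [dist_comm]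
      simp [Set.indicator, mem_closedBall, hw, hw']
  simp_rw [h]
  have h2 : (fun z => (closedBall x s).indicator (fun _ => (1 : ℝ)) z *
      (closedBall y s).indicator (fun _ => (1 : ℝ)) z) =
      (closedBall x s ∩ closedBall y s).indicator (fun _ => (1 : ℝ)) := by
    ext z
    by_cases h1 : z ∈ closedBall x s <;> by_cases h2 : z ∈ closedBall y s <;>
      simp [Set.indicator, h1, h2]
  rw [h2]
  refine IntegrableOn.integrable_indicator ?_
    (measurableSet_closedBall.inter measurableSet_closedBall)
  refine integrableOn_const ?_
  exact (lt_of_le_of_lt (measure_mono Set.inter_subset_left) measure_closedBall_lt_top).ne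

/-- The kernel `K_{d,r}` is positive semidefinite, so that it has a reproducing kernel Hilbert
space `RKHS.OfKernel (ballMatrix d r)`. -/
theorem posSemidef_ballMatrix (d : ℕ) (r : ℝ) : (ballMatrix d r).PosSemidef := by
  have tfae := (RKHS.posSemidef_tfae (K := ballMatrix d r)).out 0 2
  refine tfae.mpr ⟨?_, fun vv => ?_⟩
  · have hid : star (ContinuousLinearMap.id ℂ ℂ) = ContinuousLinearMap.id ℂ ℂ :=
      star_one (ℂ →L[ℂ] ℂ)
    ext x y
    simp [hid, ballMatrix, kernelMatrix, Matrix.conjTranspose_apply, ballKernel, mul_comm]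
  · set φ : EuclideanSpace ℝ (Fin d) → EuclideanSpace ℝ (Fin d) → ℝ :=
      fun x z => (Measure.dirac x).real (closedBall z (r / 2)) with hφ
    set c : ℝ := (volume.real (closedBall (0 : EuclideanSpace ℝ (Fin d)) (r / 2)))⁻¹ with hc
    have hint : ∀ x y, Integrable fun z => φ x z * φ y z :=
      fun x y => integrable_dirac_mul_dirac d (r / 2) x y
    have key : RCLike.re (vv.sum fun x w => vv.sum fun x' w' =>
        inner ℂ (ballMatrix d r x' x w) w') =
        c * ∫ z, ((∑ x ∈ vv.support, φ x z * (vv x).re) ^ 2 +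
          (∑ x ∈ vv.support, φ x z * (vv x).im) ^ 2) := by
      have e : ∀ z, ((∑ x ∈ vv.support, φ x z * (vv x).re) ^ 2 +
          (∑ x ∈ vv.support, φ x z * (vv x).im) ^ 2) =
          ∑ x ∈ vv.support, ∑ x' ∈ vv.support, (φ x' z * φ x z) *
            ((vv x).re * (vv x').re + (vv x).im * (vv x').im) := by
        intro z
        rw [sq, sq, Finset.sum_mul_sum, Finset.sum_mul_sum, ← Finset.sum_add_distrib]
        refine Finset.sum_congr rfl fun x _ => ?_
        rw [← Finset.sum_add_distrib]
        exact Finset.sum_congr rfl fun x' _ => by ring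
      simp_rw [e]
      rw [integral_finsetSum _ fun x _ => integrable_finsetSum _ fun x' _ =>
        (hint x' x).mul_const _, Finset.mul_sum]
      simp only [Finsupp.sum, map_sum]
      refine Finset.sum_congr rfl fun x _ => ?_
      rw [integral_finsetSum _ fun x' _ => (hint x' x).mul_const _, Finset.mul_sum]
      refine Finset.sum_congr rfl fun x' _ => ?_
      rw [integral_mul_const, ← mul_assoc]
      have : c * ∫ z, φ x' z * φ x z = ballKernel d r x' x := rfl
      rw [this]
      simp [ballMatrix, kernelMatrix]
      ring
    rw [key]
    refine mul_nonneg (inv_nonneg.mpr measureReal_nonneg) (integral_nonneg fun z => ?_)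
    positivity

instance (d : ℕ) (r : ℝ) : Fact (ballMatrix d r).PosSemidef := ⟨posSemidef_ballMatrix d r⟩

instance (d : ℕ) (r : ℝ) : Fact (ballMatrixSphere d r).PosSemidef :=
  ⟨(posSemidef_ballMatrix d r).submatrix Subtype.val⟩

/-! ### The Sobolev space `H^s(ℝ^d)` for `s ≥ 0`, as a normed space -/

/-- The square integrable functions on `ℝ^d` which lie in the Sobolev space `H^s`. -/
def sobolevSubmodule (d : ℕ) (s : ℝ) :
    Submodule ℂ (Lp ℂ 2 (volume : Measure (EuclideanSpace ℝ (Fin d)))) where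
  carrier := {u | TemperedDistribution.MemSobolev s 2 (u : 𝓢'(EuclideanSpace ℝ (Fin d), ℂ))}
  zero_mem' := by
    have h : ((0 : Lp ℂ 2 (volume : Measure (EuclideanSpace ℝ (Fin d)))) :
        𝓢'(EuclideanSpace ℝ (Fin d), ℂ)) = 0 := by
      rw [← Lp.toTemperedDistributionCLM_apply, map_zero]
    simp only [Set.mem_ofPred_eq, h]
    exact TemperedDistribution.memSobolev_fun_zero _ _ s 2
  add_mem' {u v} hu hv := by
    have h : ((u + v : Lp ℂ 2 (volume : Measure (EuclideanSpace ℝ (Fin d)))) :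
        𝓢'(EuclideanSpace ℝ (Fin d), ℂ)) = u + v := by
      simp only [← Lp.toTemperedDistributionCLM_apply, map_add]
    simp only [Set.mem_ofPred_eq, h]
    exact hu.add hv
  smul_mem' c u hu := by
    have h : ((c • u : Lp ℂ 2 (volume : Measure (EuclideanSpace ℝ (Fin d)))) :
        𝓢'(EuclideanSpace ℝ (Fin d), ℂ)) = c • (u : 𝓢'(EuclideanSpace ℝ (Fin d), ℂ)) := by
      simp only [← Lp.toTemperedDistributionCLM_apply, map_smul]
    simp only [Set.mem_ofPred_eq, h]
    exact hu.smul c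

/-- The Sobolev space `H^s(ℝ^d)`, `s ≥ 0`, of complex-valued functions. Its norm is
`‖u‖_{H^s} = ‖𝓕⁻ ((1 + |ξ|²)^{s/2} 𝓕 u)‖_{L²}`. -/
def SobolevSpace (d : ℕ) (s : ℝ) : Type := sobolevSubmodule d s

namespace SobolevSpace

variable {d : ℕ} {s : ℝ}

instance : AddCommGroup (SobolevSpace d s) := inferInstanceAs (AddCommGroup (sobolevSubmodule d s))

instance : Module ℂ (SobolevSpace d s) := inferInstanceAs (Module ℂ (sobolevSubmodule d s))

/-- The underlying square integrable function. -/
def toL2 : SobolevSpace d s →ₗ[ℂ] Lp ℂ 2 (volume : Measure (EuclideanSpace ℝ (Fin d))) :=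
  (sobolevSubmodule d s).subtype

theorem toTemperedDistribution_injective : Function.Injective
    (Lp.toTemperedDistributionCLM ℂ (volume : Measure (EuclideanSpace ℝ (Fin d))) 2) :=
  LinearMap.ker_eq_bot.mp Lp.ker_toTemperedDistributionCLM_eq_bot

theorem exists_bessel (u : SobolevSpace d s) :
    ∃ v : Lp ℂ 2 (volume : Measure (EuclideanSpace ℝ (Fin d))),
      TemperedDistribution.besselPotential _ ℂ s
        (toL2 u : 𝓢'(EuclideanSpace ℝ (Fin d), ℂ)) = v :=
  u.2

/-- The square integrable function `𝓕⁻ ((1 + |ξ|²)^{s/2} 𝓕 u)`, for `u` in `H^s(ℝ^d)`. -/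
def besselFun (u : SobolevSpace d s) : Lp ℂ 2 (volume : Measure (EuclideanSpace ℝ (Fin d))) :=
  (exists_bessel u).choose

theorem besselFun_spec (u : SobolevSpace d s) :
    Lp.toTemperedDistributionCLM ℂ volume 2 (besselFun u) =
      TemperedDistribution.besselPotential _ ℂ s
        (Lp.toTemperedDistributionCLM ℂ volume 2 (toL2 u)) :=
  (exists_bessel u).choose_spec.symm

/-- `besselFun` as a linear map. -/
def bessel : SobolevSpace d s →ₗ[ℂ] Lp ℂ 2 (volume : Measure (EuclideanSpace ℝ (Fin d))) where
  toFun := besselFun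
  map_add' u v := by
    apply toTemperedDistribution_injective
    rw [map_add, besselFun_spec, besselFun_spec, besselFun_spec, map_add, map_add, map_add]
  map_smul' c u := by
    apply toTemperedDistribution_injective
    rw [RingHom.id_apply, map_smul, besselFun_spec, besselFun_spec, map_smul, map_smul, map_smul]

theorem bessel_spec (u : SobolevSpace d s) :
    TemperedDistribution.besselPotential _ ℂ s (toL2 u : 𝓢'(EuclideanSpace ℝ (Fin d), ℂ)) =
      bessel u :=
  (exists_bessel u).choose_spec

theorem bessel_injective : Function.Injective (bessel : SobolevSpace d s →ₗ[ℂ] _) := by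
  intro u v h
  have h1 := bessel_spec u
  rw [h, ← bessel_spec v] at h1
  have h2 := congrArg (TemperedDistribution.besselPotential _ ℂ (-s)) h1
  simp only [TemperedDistribution.besselPotential_besselPotential_apply, add_neg_cancel,
    TemperedDistribution.besselPotential_zero, ContinuousLinearMap.id_apply] at h2
  exact Subtype.ext (toTemperedDistribution_injective h2)

instance : NormedAddCommGroup (SobolevSpace d s) :=
  NormedAddCommGroup.induced _ _ bessel bessel_injective

instance : NormedSpace ℂ (SobolevSpace d s) := NormedSpace.induced ℂ _ _ bessel

theorem norm_def (u : SobolevSpace d s) : ‖u‖ = ‖bessel u‖ := rfl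

end SobolevSpace

/-! ### Spherical harmonics and the Sobolev space `H^τ(S^{d-1})` -/

/-- The normalized surface measure on `S^{d-1}`. -/
def sphereMeasure (d : ℕ) : Measure (sphere (0 : EuclideanSpace ℝ (Fin d)) 1) :=
  (Measure.toSphere (volume : Measure (EuclideanSpace ℝ (Fin d))) Set.univ)⁻¹ •
    Measure.toSphere (volume : Measure (EuclideanSpace ℝ (Fin d)))

/-- The Laplacian on polynomials in `d` variables. -/
def polyLaplacian (d : ℕ) : MvPolynomial (Fin d) ℂ →ₗ[ℂ] MvPolynomial (Fin d) ℂ :=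
  ∑ i, (MvPolynomial.pderiv i).toLinearMap ∘ₗ (MvPolynomial.pderiv i).toLinearMap

/-- The restriction of a polynomial to the unit sphere. -/
def restrictSphere (d : ℕ) :
    MvPolynomial (Fin d) ℂ →ₗ[ℂ] (sphere (0 : EuclideanSpace ℝ (Fin d)) 1 → ℂ) where
  toFun p x := MvPolynomial.eval (fun i => ((x : EuclideanSpace ℝ (Fin d)) i : ℂ)) p
  map_add' p q := by ext x; simp
  map_smul' c p := by ext x; simp [MvPolynomial.smul_eval]

/-- The spherical harmonics of degree `m` on `S^{d-1}`: the restrictions to the sphere of the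
homogeneous harmonic polynomials of degree `m`. -/
def sphericalHarmonics (d m : ℕ) :
    Submodule ℂ (sphere (0 : EuclideanSpace ℝ (Fin d)) 1 → ℂ) :=
  (MvPolynomial.homogeneousSubmodule (Fin d) ℂ m ⊓ LinearMap.ker (polyLaplacian d)).map
    (restrictSphere d)

/-- `Y` is an orthonormal basis of the spherical harmonics of degree `m`, with respect to the inner
product of `L²(S^{d-1})` for the normalized surface measure. -/
structure IsSphericalHarmonicBasis (d m : ℕ) {ι : Type*}
    (Y : ι → sphere (0 : EuclideanSpace ℝ (Fin d)) 1 → ℂ) : Prop where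
  span_eq : Submodule.span ℂ (Set.range Y) = sphericalHarmonics d m
  integral_self : ∀ l, ∫ x, Y l x * conj (Y l x) ∂(sphereMeasure d) = 1
  integral_ne : ∀ l l', l ≠ l' → ∫ x, Y l x * conj (Y l' x) ∂(sphereMeasure d) = 0

/-- The `m`-th term `(1 + m(m+d-2))^{-τ} ∑_l Y^m_l(x) conj (Y^m_l(y))` of the kernel of
`H^τ(S^{d-1})`. -/
def sphereSobolevTerm (d : ℕ) (τ : ℝ) {ι : ℕ → Type*} [∀ m, Fintype (ι m)]
    (Y : ∀ m, ι m → sphere (0 : EuclideanSpace ℝ (Fin d)) 1 → ℂ)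
    (x y : sphere (0 : EuclideanSpace ℝ (Fin d)) 1) (m : ℕ) : ℂ :=
  (((1 + (m : ℝ) * ((m : ℝ) + (d : ℝ) - 2)) ^ (-τ) : ℝ) : ℂ) *
    ∑ l, Y m l x * conj (Y m l y)

/-- The kernel whose reproducing kernel Hilbert space is the Sobolev space `H^τ(S^{d-1})`,
for `τ > (d-1)/2`. -/
def sphereSobolevMatrix (d : ℕ) (τ : ℝ) {ι : ℕ → Type*} [∀ m, Fintype (ι m)]
    (Y : ∀ m, ι m → sphere (0 : EuclideanSpace ℝ (Fin d)) 1 → ℂ) :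
    Matrix (sphere (0 : EuclideanSpace ℝ (Fin d)) 1) (sphere (0 : EuclideanSpace ℝ (Fin d)) 1)
      (ℂ →L[ℂ] ℂ) :=
  kernelMatrix fun x y => ∑' m, sphereSobolevTerm d τ Y x y m

end BallDiscrepancy

end

/-!
The kernel `K_{3,r}(x, y)` is the inner product of the normalized indicator functions of the balls
of radius `R = r / 2` around `x` and `y`, so the functions in `𝓗` are the convolutions of square
integrable functions with the ball indicator. Its Fourier transform is, up to constants,
`(sin t - t cos t) / t ^ 3` with `t = 2πR|ξ|`. It decays like `|ξ|⁻²`, so that `𝓗` embeds into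
`H²`; but it vanishes on a sphere `|ξ| = ρ`, so that dividing the indicator of a larger ball by it
does not give a square integrable function, and the embedding is strict.

On the sphere, the ball of radius `R` around `x` meets the sphere of radius `ρ` around the origin in
a cap, so `K_{3,r}(x, y)` is an average over `ρ` of overlaps of two congruent caps. By Archimedes'
theorem and the addition theorem, the overlap is a series of Legendre polynomials in `⟪x, y⟫` whose
coefficients are squares of the cap coefficients, which are themselves integrals of Legendre
polynomials. Energy estimates for the Legendre equation show that the average of these squares is
comparable to `(m + 1)⁻³`, that is, to the coefficient `(1 + m (m + 1)) ^ (-3 / 2)` of the Sobolev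
kernel. Two kernels with comparable nonnegative coefficients reproduce the same functions with
equivalent norms.
-/

noncomputable section

namespace BallDiscrepancy

section Legendre

open Polynomial

/-- The Legendre polynomials `P_n`, defined by Bonnet's recurrence. -/
def legendre : ℕ → ℝ[X]
  | 0 => 1
  | 1 => X
  | n + 2 => C ((n + 2 : ℝ)⁻¹) *
      ((2 * (n : ℝ[X]) + 3) * X * legendre (n + 1) - ((n : ℝ[X]) + 1) * legendre n)

theorem legendre_zero : legendre 0 = 1 := by rw [legendre]

theorem legendre_one : legendre 1 = X := by rw [legendre]

theorem legendre_add_two (n : ℕ) : ((n : ℝ[X]) + 2) * legendre (n + 2) =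
    (2 * (n : ℝ[X]) + 3) * X * legendre (n + 1) - ((n : ℝ[X]) + 1) * legendre n := by
  have hC : (n : ℝ[X]) + 2 = C (n + 2 : ℝ) := by simp [C_ofNat]
  rw [legendre, ← mul_assoc, hC, ← C_mul, mul_inv_cancel₀ (by positivity), C_1, one_mul]

theorem eval_legendre_add_two (n : ℕ) (s : ℝ) : (n + 2) * (legendre (n + 2)).eval s =
    (2 * n + 3) * s * (legendre (n + 1)).eval s - (n + 1) * (legendre n).eval s := by
  simpa using congrArg (eval s) (legendre_add_two n)

theorem derivative_legendre_add_one_and (n : ℕ) :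
    derivative (legendre (n + 1)) = X * derivative (legendre n) + ((n : ℝ[X]) + 1) * legendre n ∧
    X * derivative (legendre (n + 1)) - derivative (legendre n) =
      ((n : ℝ[X]) + 1) * legendre (n + 1) := by
  induction n with
  | zero => simp [legendre_zero, legendre_one]
  | succ n ih =>
    obtain ⟨hsucc, hpred⟩ := ih
    have hrec := legendre_add_two n
    have hrec' := congrArg derivative hrec
    simp only [derivative_mul, derivative_add, derivative_sub, derivative_natCast,
      derivative_ofNat, derivative_X, derivative_one] at hrec'
    have hn : ((n : ℝ[X]) + 2) ≠ 0 := by exact_mod_cast (n + 1).succ_ne_zero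
    have hsucc' : derivative (legendre (n + 1 + 1)) =
        X * derivative (legendre (n + 1)) + (((n + 1 : ℕ) : ℝ[X]) + 1) * legendre (n + 1) := by
      apply mul_left_cancel₀ hn
      push_cast
      linear_combination hrec' + ((n : ℝ[X]) + 1) * hpred
    refine ⟨hsucc', ?_⟩
    rw [hsucc']
    push_cast
    linear_combination X * hpred - hsucc - hrec

theorem derivative_legendre_add_one (n : ℕ) :
    derivative (legendre (n + 1)) = X * derivative (legendre n) + ((n : ℝ[X]) + 1) * legendre n :=
  (derivative_legendre_add_one_and n).1

theorem X_mul_derivative_legendre_add_one (n : ℕ) :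
    X * derivative (legendre (n + 1)) =
      derivative (legendre n) + ((n : ℝ[X]) + 1) * legendre (n + 1) := by
  linear_combination (derivative_legendre_add_one_and n).2

/-- `(1 - X²) P_n'`, which is `n (n + 1)` times the antiderivative of `-P_n` that vanishes at
`±1`. -/
def legendrePrimitive (n : ℕ) : ℝ[X] := (1 - X ^ 2) * derivative (legendre n)

theorem eval_legendrePrimitive (n : ℕ) (s : ℝ) :
    (legendrePrimitive n).eval s = (1 - s ^ 2) * (derivative (legendre n)).eval s := by
  simp [legendrePrimitive]

theorem derivative_legendrePrimitive (n : ℕ) :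
    derivative (legendrePrimitive n) = -((n : ℝ[X]) * (n + 1)) * legendre n := by
  cases n with
  | zero => simp [legendrePrimitive, legendre_zero]
  | succ n =>
    have hX := X_mul_derivative_legendre_add_one n
    have hprim : legendrePrimitive (n + 1) =
        ((n : ℝ[X]) + 1) * (legendre n - X * legendre (n + 1)) := by
      rw [legendrePrimitive]
      linear_combination derivative_legendre_add_one n - X * hX
    rw [hprim]
    simp only [derivative_mul, derivative_add, derivative_sub, derivative_natCast,
      derivative_X, derivative_one]
    push_cast
    linear_combination (-(n : ℝ[X]) - 1) * hX

theorem eval_one_legendre (n : ℕ) : (legendre n).eval 1 = 1 := by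
  induction n using Nat.twoStepInduction with
  | zero => simp [legendre_zero]
  | one => simp [legendre_one]
  | more n h0 h1 =>
    have hrec := eval_legendre_add_two n 1
    rw [h0, h1] at hrec
    apply mul_left_cancel₀ (show (n + 2 : ℝ) ≠ 0 by positivity)
    linear_combination hrec

theorem eval_neg_one_legendre (n : ℕ) : (legendre n).eval (-1) = (-1) ^ n := by
  induction n using Nat.twoStepInduction with
  | zero => simp [legendre_zero]
  | one => simp [legendre_one]
  | more n h0 h1 =>
    have hrec := eval_legendre_add_two n (-1)
    rw [h0, h1] at hrec
    apply mul_left_cancel₀ (show (n + 2 : ℝ) ≠ 0 by positivity)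
    linear_combination hrec

theorem natDegree_legendre_le (n : ℕ) : (legendre n).natDegree ≤ n := by
  induction n using Nat.twoStepInduction with
  | zero => simp [legendre_zero]
  | one => simp [legendre_one]
  | more n h0 h1 =>
    rw [legendre]
    compute_degree
    all_goals omega

theorem coeff_self_legendre_pos (n : ℕ) : 0 < (legendre n).coeff n := by
  induction n using Nat.twoStepInduction with
  | zero => simp [legendre_zero]
  | one => simp [legendre_one]
  | more n _ h1 =>
    have hC : 2 * (n : ℝ[X]) + 3 = C (2 * n + 3 : ℝ) := by simp [C_ofNat]
    have hC' : (n : ℝ[X]) + 1 = C (n + 1 : ℝ) := by simp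
    rw [legendre, coeff_C_mul, coeff_sub, hC, hC', mul_assoc, coeff_C_mul, coeff_C_mul,
      coeff_X_mul, coeff_eq_zero_of_natDegree_lt ((natDegree_legendre_le n).trans_lt (by omega)),
      mul_zero, sub_zero]
    positivity

theorem span_range_legendre : Submodule.span ℝ (Set.range legendre) = ⊤ := by
  have hdeg (n : ℕ) : (legendre n).degree = n :=
    le_antisymm (natDegree_le_iff_degree_le.mp (natDegree_legendre_le n))
      (le_degree_of_ne_zero (coeff_self_legendre_pos n).ne')
  refine Sequence.span ⟨legendre, hdeg⟩ fun n => ?_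
  rw [isUnit_iff_ne_zero, leadingCoeff_ne_zero, ← degree_ne_bot]
  exact (hdeg n).trans_ne (by simp)

theorem integral_eval_derivative (p : ℝ[X]) (a b : ℝ) :
    ∫ s in a..b, (derivative p).eval s = p.eval b - p.eval a :=
  intervalIntegral.integral_eq_sub_of_hasDerivAt (fun s _ => p.hasDerivAt s)
    ((derivative p).continuous.intervalIntegrable _ _)

theorem integral_eval_legendre {n : ℕ} (hn : 1 ≤ n) (s : ℝ) :
    ∫ t in s..1, (legendre n).eval t = (legendrePrimitive n).eval s / (n * (n + 1)) := by
  have h := integral_eval_derivative (legendrePrimitive n) s 1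
  simp only [derivative_legendrePrimitive, eval_legendrePrimitive, eval_mul, eval_neg,
    eval_natCast, eval_add, eval_one, intervalIntegral.integral_const_mul] at h
  rw [eq_div_iff (by positivity), eval_legendrePrimitive]
  linear_combination -h

theorem integral_legendre_mul_legendre_of_ne {m n : ℕ} (hmn : m ≠ n) :
    ∫ s in (-1 : ℝ)..1, (legendre m).eval s * (legendre n).eval s = 0 := by
  set W : ℝ[X] := legendrePrimitive n * legendre m - legendrePrimitive m * legendre n
  have hderiv : derivative W =
      C ((m - n) * (m + n + 1) : ℝ) * (legendre m * legendre n) := by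
    rw [derivative_sub, derivative_mul, derivative_mul (g := legendre n),
      derivative_legendrePrimitive, derivative_legendrePrimitive]
    simp only [legendrePrimitive, C_sub, C_mul, C_add, C_1, map_natCast]
    ring
  have h_integral := integral_eval_derivative W (-1) 1
  have hboundary : W.eval 1 - W.eval (-1) = 0 := by simp [W, legendrePrimitive]
  rw [hderiv, hboundary] at h_integral
  simp only [eval_mul, eval_C, intervalIntegral.integral_const_mul] at h_integral
  refine (mul_eq_zero.mp h_integral).resolve_left ?_
  exact mul_ne_zero (sub_ne_zero.mpr (Nat.cast_injective.ne hmn)) (by positivity)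

theorem integral_legendre_sq_add_one (n : ℕ) :
    (2 * n + 3) * ∫ s in (-1 : ℝ)..1, (legendre (n + 1)).eval s ^ 2 =
      (2 * n + 1) * ∫ s in (-1 : ℝ)..1, (legendre n).eval s ^ 2 := by
  set G : ℝ[X] := X * (legendre (n + 1) ^ 2 + legendre n ^ 2) -
    2 * (legendre (n + 1) * legendre n) with hG
  have hderiv (s : ℝ) : (derivative G).eval s =
      (2 * n + 3) * (legendre (n + 1)).eval s ^ 2 - (2 * n + 1) * (legendre n).eval s ^ 2 := by
    have h1 := congrArg (eval s) (derivative_legendre_add_one n)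
    have h2 := congrArg (eval s) (X_mul_derivative_legendre_add_one n)
    simp only [eval_add, eval_mul, eval_X, eval_natCast, eval_one] at h1 h2
    simp only [hG, derivative_mul, derivative_sub, derivative_add, derivative_sq, derivative_X,
      derivative_ofNat, eval_add, eval_sub, eval_mul, eval_pow, eval_X, eval_C, eval_one,
      eval_zero, eval_ofNat]
    linear_combination 2 * (legendre (n + 1)).eval s * h2 - 2 * (legendre n).eval s * h1
  have hboundary : G.eval 1 - G.eval (-1) = 0 := by
    simp only [hG, eval_sub, eval_add, eval_mul, eval_pow, eval_X, eval_ofNat, eval_one_legendre,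
      eval_neg_one_legendre, pow_succ, one_pow]
    ring
  have h_integral := integral_eval_derivative G (-1) 1
  simp only [hderiv, hboundary] at h_integral
  rw [intervalIntegral.integral_sub (Continuous.intervalIntegrable (by fun_prop) _ _)
    (Continuous.intervalIntegrable (by fun_prop) _ _), intervalIntegral.integral_const_mul,
    intervalIntegral.integral_const_mul] at h_integral
  exact sub_eq_zero.mp h_integral

theorem integral_legendre_sq (n : ℕ) :
    ∫ s in (-1 : ℝ)..1, (legendre n).eval s ^ 2 = 2 / (2 * n + 1) := by
  induction n with
  | zero => norm_num [legendre_zero]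
  | succ n ih =>
    have h := integral_legendre_sq_add_one n
    rw [ih] at h
    rw [eq_div_iff (by positivity), mul_comm, Nat.cast_add_one]
    field_simp at h
    linear_combination h

end Legendre

section LegendreEnergy

open Polynomial Set

theorem monotoneOn_Ici_of_mul_deriv_nonneg {f : ℝ → ℝ} (hf : Differentiable ℝ f)
    (h : ∀ s, 0 ≤ s * deriv f s) : MonotoneOn f (Ici 0) := by
  refine monotoneOn_of_deriv_nonneg (convex_Ici 0) hf.continuous.continuousOn
    hf.differentiableOn fun s hs => ?_
  rw [interior_Ici] at hs
  exact nonneg_of_mul_nonneg_right (h s) hs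

theorem antitoneOn_Iic_of_mul_deriv_nonneg {f : ℝ → ℝ} (hf : Differentiable ℝ f)
    (h : ∀ s, 0 ≤ s * deriv f s) : AntitoneOn f (Iic 0) := by
  refine antitoneOn_of_deriv_nonpos (convex_Iic 0) hf.continuous.continuousOn
    hf.differentiableOn fun s hs => ?_
  rw [interior_Iic] at hs
  by_contra! hpos
  exact (mul_neg_of_neg_of_pos hs hpos).not_ge (h s)

theorem apply_zero_le_of_mul_deriv_nonneg {f : ℝ → ℝ} (hf : Differentiable ℝ f)
    (h : ∀ s, 0 ≤ s * deriv f s) (s : ℝ) : f 0 ≤ f s := by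
  rcases le_total 0 s with hs | hs
  · exact monotoneOn_Ici_of_mul_deriv_nonneg hf h self_mem_Ici hs hs
  · exact antitoneOn_Iic_of_mul_deriv_nonneg hf h hs self_mem_Iic hs

/-- The energy `(1 - X²) (P_n')² + n (n + 1) P_n²` of the oscillator given by Legendre's equation.
It increases, and its product with `1 - X²` decreases, away from the origin. -/
def legendreEnergy (n : ℕ) : ℝ[X] :=
  (1 - X ^ 2) * derivative (legendre n) ^ 2 + (n : ℝ[X]) * ((n : ℝ[X]) + 1) * legendre n ^ 2

theorem eval_legendreEnergy (n : ℕ) (s : ℝ) : (legendreEnergy n).eval s =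
    (1 - s ^ 2) * (derivative (legendre n)).eval s ^ 2 + n * (n + 1) * (legendre n).eval s ^ 2 := by
  simp [legendreEnergy]

theorem one_sub_X_sq_mul_legendreEnergy (n : ℕ) : (1 - X ^ 2) * legendreEnergy n =
    legendrePrimitive n ^ 2 + (n : ℝ[X]) * ((n : ℝ[X]) + 1) * ((1 - X ^ 2) * legendre n ^ 2) := by
  rw [legendreEnergy, legendrePrimitive]
  ring

theorem derivative_legendreEnergy (n : ℕ) :
    derivative (legendreEnergy n) = 2 * X * derivative (legendre n) ^ 2 := by
  have hode := derivative_legendrePrimitive n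
  simp only [legendreEnergy, legendrePrimitive, derivative_mul, derivative_sub, derivative_add,
    derivative_sq, derivative_one, derivative_X, derivative_natCast, map_ofNat] at hode ⊢
  linear_combination 2 * derivative (legendre n) * hode

theorem derivative_one_sub_X_sq_mul_legendreEnergy (n : ℕ) :
    derivative ((1 - X ^ 2) * legendreEnergy n) =
      -(2 * X * ((n : ℝ[X]) * ((n : ℝ[X]) + 1)) * legendre n ^ 2) := by
  simp only [derivative_mul, derivative_legendreEnergy, derivative_sub, derivative_one,
    derivative_sq, derivative_X, map_ofNat]
  rw [legendreEnergy]
  ring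

theorem mul_deriv_legendreEnergy_nonneg (n : ℕ) (s : ℝ) :
    0 ≤ s * deriv (fun t => (legendreEnergy n).eval t) s := by
  rw [Polynomial.deriv, derivative_legendreEnergy]
  calc 0 ≤ 2 * (s * (derivative (legendre n)).eval s) ^ 2 := by positivity
    _ = _ := by simp; ring

theorem eval_zero_legendreEnergy_le_eval (n : ℕ) (s : ℝ) :
    (legendreEnergy n).eval 0 ≤ (legendreEnergy n).eval s :=
  apply_zero_le_of_mul_deriv_nonneg (legendreEnergy n).differentiable
    (mul_deriv_legendreEnergy_nonneg n) s

theorem one_sub_sq_mul_eval_legendreEnergy_le (n : ℕ) (s : ℝ) :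
    (1 - s ^ 2) * (legendreEnergy n).eval s ≤ (legendreEnergy n).eval 0 := by
  have h := apply_zero_le_of_mul_deriv_nonneg (-((1 - X ^ 2) * legendreEnergy n)).differentiable
    (fun t => by
      rw [Polynomial.deriv, derivative_neg, derivative_one_sub_X_sq_mul_legendreEnergy]
      calc 0 ≤ 2 * (n * (n + 1)) * (t * (legendre n).eval t) ^ 2 := by positivity
        _ = _ := by simp; ring) s
  simpa using h

theorem eval_legendreEnergy_le (n : ℕ) {s : ℝ} (hs : s ∈ Icc (-1 : ℝ) 1) :
    (legendreEnergy n).eval s ≤ n * (n + 1) := by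
  have hdiff := (legendreEnergy n).differentiable
  have hderiv := mul_deriv_legendreEnergy_nonneg n
  rcases le_total 0 s with h0 | h0
  · refine (monotoneOn_Ici_of_mul_deriv_nonneg hdiff hderiv h0
      (zero_le_one : (0 : ℝ) ≤ 1) hs.2).trans_eq ?_
    simp [eval_legendreEnergy, eval_one_legendre]
  · refine (antitoneOn_Iic_of_mul_deriv_nonneg hdiff hderiv
      (neg_one_lt_zero.le : (-1 : ℝ) ≤ 0) h0 hs.1).trans_eq ?_
    simp [eval_legendreEnergy, eval_neg_one_legendre, ← pow_mul, mul_comm n 2]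

theorem abs_legendre_le_one (n : ℕ) {s : ℝ} (hs : s ∈ Icc (-1 : ℝ) 1) :
    |(legendre n).eval s| ≤ 1 := by
  rcases Nat.eq_zero_or_pos n with rfl | hn
  · simp [legendre_zero]
  have hE := eval_legendreEnergy_le n hs
  rw [eval_legendreEnergy] at hE
  have hs' : 0 ≤ 1 - s ^ 2 := by nlinarith [hs.1, hs.2]
  have hkin : 0 ≤ (1 - s ^ 2) * (derivative (legendre n)).eval s ^ 2 := by positivity
  have hn0 : (0 : ℝ) < n * (n + 1) := by positivity
  rw [← sq_le_one_iff_abs_le_one]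
  exact le_of_mul_le_mul_left (by linarith) hn0

theorem eval_zero_legendreEnergy (n : ℕ) : (legendreEnergy n).eval 0 =
    (n + 1) ^ 2 * (legendre (n + 1)).eval 0 ^ 2 + n * (n + 1) * (legendre n).eval 0 ^ 2 := by
  have h := congrArg (eval 0) (X_mul_derivative_legendre_add_one n)
  simp only [eval_mul, eval_X, eval_add, eval_natCast, eval_one, zero_mul] at h
  rw [eval_legendreEnergy]
  linear_combination ((n + 1) * (legendre (n + 1)).eval 0 - (derivative (legendre n)).eval 0) * h

theorem eval_zero_legendreEnergy_add_one (n : ℕ) : (legendreEnergy (n + 1)).eval 0 =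
    (n + 1) ^ 2 * (legendre n).eval 0 ^ 2 + (n + 1) * (n + 2) * (legendre (n + 1)).eval 0 ^ 2 := by
  rw [eval_legendreEnergy, derivative_legendre_add_one]
  simp only [eval_mul, eval_X, eval_add, eval_natCast, eval_one, zero_mul]
  push_cast
  ring

theorem eval_zero_legendreEnergy_le (n : ℕ) : (legendreEnergy n).eval 0 ≤ n := by
  rcases Nat.eq_zero_or_pos n with rfl | hn
  · simp [eval_legendreEnergy, legendre_zero]
  induction n, hn using Nat.le_induction with
  | base => simp [eval_legendreEnergy, legendre_one]
  | succ n hn ih =>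
    have hratio : n * (legendreEnergy (n + 1)).eval 0 ≤ (n + 1) * (legendreEnergy n).eval 0 := by
      rw [eval_zero_legendreEnergy n, eval_zero_legendreEnergy_add_one]
      nlinarith [sq_nonneg ((legendre (n + 1)).eval 0)]
    have hn0 : (0 : ℝ) < n := by exact_mod_cast hn
    push_cast
    nlinarith

theorem le_eval_zero_legendreEnergy {n : ℕ} (hn : 1 ≤ n) :
    (n + 1) / 2 ≤ (legendreEnergy n).eval 0 := by
  induction n, hn using Nat.le_induction with
  | base => simp [eval_legendreEnergy, legendre_one]
  | succ n _ ih =>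
    have hratio : (n + 2) * (legendreEnergy n).eval 0 ≤
        (n + 1) * (legendreEnergy (n + 1)).eval 0 := by
      rw [eval_zero_legendreEnergy n, eval_zero_legendreEnergy_add_one]
      nlinarith [sq_nonneg ((legendre n).eval 0)]
    push_cast
    nlinarith

theorem eval_legendrePrimitive_sq_le (n : ℕ) {s : ℝ} (hs : s ∈ Icc (-1 : ℝ) 1) :
    (legendrePrimitive n).eval s ^ 2 ≤ n := by
  have hs' : 0 ≤ 1 - s ^ 2 := by nlinarith [hs.1, hs.2]
  have heq := congrArg (eval s) (one_sub_X_sq_mul_legendreEnergy n)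
  simp only [eval_mul, eval_sub, eval_add, eval_pow, eval_X, eval_one, eval_natCast] at heq
  calc (legendrePrimitive n).eval s ^ 2
      ≤ (legendrePrimitive n).eval s ^ 2 + n * (n + 1) * ((1 - s ^ 2) * (legendre n).eval s ^ 2) :=
        le_add_of_nonneg_right (by positivity)
    _ = (1 - s ^ 2) * (legendreEnergy n).eval s := heq.symm
    _ ≤ (legendreEnergy n).eval 0 := one_sub_sq_mul_eval_legendreEnergy_le n s
    _ ≤ n := eval_zero_legendreEnergy_le n

/-- The boundary term in the equipartition of the energy on `[a, 1]`: for `F = (1 - X²) P_n'`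
and the weight `w = (X - a)² (1 - X²)`, it is `w F F' - w' F² / 2`. The weight vanishes at `1`, and
to second order at `a`. -/
def legendreVirial (n : ℕ) (a : ℝ) : ℝ[X] :=
  (X - C a) ^ 2 * (1 - X ^ 2) * (legendrePrimitive n * derivative (legendrePrimitive n)) -
    ((X - C a) * (1 - X ^ 2) - (X - C a) ^ 2 * X) * legendrePrimitive n ^ 2

theorem eval_one_legendreVirial (n : ℕ) (a : ℝ) : (legendreVirial n a).eval 1 = 0 := by
  simp [legendreVirial, legendrePrimitive]

theorem eval_left_legendreVirial (n : ℕ) (a : ℝ) : (legendreVirial n a).eval a = 0 := by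
  simp [legendreVirial]

theorem eval_derivative_legendreVirial (n : ℕ) (a s : ℝ) :
    (derivative (legendreVirial n a)).eval s =
      n * (n + 1) * ((s - a) ^ 2 * (1 - s ^ 2) * (legendreEnergy n).eval s) -
      (2 * (n * (n + 1)) * (s - a) ^ 2 + ((1 - s ^ 2) - 4 * s * (s - a) - (s - a) ^ 2)) *
        (legendrePrimitive n).eval s ^ 2 := by
  simp only [legendreVirial, derivative_legendrePrimitive, derivative_mul, derivative_sub,
    derivative_neg, derivative_add, derivative_sq, derivative_C, derivative_X, derivative_one,
    derivative_natCast, eval_mul, eval_sub, eval_neg, eval_add, eval_pow, eval_C, eval_X, eval_one,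
    eval_zero, eval_natCast, map_ofNat, eval_ofNat, eval_legendrePrimitive, eval_legendreEnergy]
  ring

theorem le_integral_sub_sq_mul_one_sub_sq {a : ℝ} (ha : 0 ≤ a) (ha1 : a < 1) :
    (1 - a) ^ 4 / 12 ≤ ∫ s in a..1, (s - a) ^ 2 * (1 - s ^ 2) := by
  set W : ℝ[X] := C (1 / 3 * (1 - a ^ 2)) * (X - C a) ^ 3 - C (a / 2) * (X - C a) ^ 4 -
    C (1 / 5) * (X - C a) ^ 5 with hW
  have hderiv (s : ℝ) : (derivative W).eval s = (s - a) ^ 2 * (1 - s ^ 2) := by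
    simp [hW, derivative_pow]
    ring
  have h_integral := integral_eval_derivative W a 1
  simp only [hderiv] at h_integral
  rw [h_integral]
  have hL : 0 ≤ (1 - a) ^ 4 := by positivity
  have hval : W.eval 1 - W.eval a = (1 - a) ^ 4 * (4 + a) / 30 := by
    simp [hW]
    ring
  rw [hval]
  nlinarith [mul_nonneg hL ha]

theorem le_integral_legendrePrimitive_sq {n : ℕ} (hn : 1 ≤ n) {a : ℝ} (ha : 0 ≤ a) (ha1 : a < 1) :
    (1 - a) ^ 4 / 60 * (n + 1) ≤ ∫ s in a..1, (legendrePrimitive n).eval s ^ 2 := by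
  set N : ℝ := n * (n + 1)
  have hn1 : (1 : ℝ) ≤ n := by exact_mod_cast hn
  have hN2 : 2 ≤ N := by nlinarith
  have hpointwise : ∀ s ∈ Icc a 1, N * ((n + 1) / 2) * ((s - a) ^ 2 * (1 - s ^ 2)) -
      (derivative (legendreVirial n a)).eval s ≤
        (2 * N + 1) * (legendrePrimitive n).eval s ^ 2 := by
    intro s ⟨has, hs1⟩
    have hs0 : 0 ≤ s := ha.trans has
    have hw : 0 ≤ (s - a) ^ 2 * (1 - s ^ 2) := mul_nonneg (sq_nonneg _) (by nlinarith)
    have henergy : (n + 1) / 2 ≤ (legendreEnergy n).eval s :=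
      (le_eval_zero_legendreEnergy hn).trans (eval_zero_legendreEnergy_le_eval n s)
    have hcoeff : 2 * N * (s - a) ^ 2 + ((1 - s ^ 2) - 4 * s * (s - a) - (s - a) ^ 2) ≤
        2 * N + 1 := by
      have hsq : (s - a) ^ 2 ≤ 1 := by nlinarith
      nlinarith [mul_nonneg hs0 (sub_nonneg.mpr has), mul_le_mul_of_nonneg_left hsq
        (by linarith : 0 ≤ 2 * N)]
    rw [eval_derivative_legendreVirial]
    nlinarith [mul_le_mul_of_nonneg_right hcoeff (sq_nonneg ((legendrePrimitive n).eval s)),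
      mul_le_mul_of_nonneg_left henergy (mul_nonneg (by linarith : 0 ≤ N) hw)]
  have h_integral := intervalIntegral.integral_mono_on (μ := volume) ha1.le
    (Continuous.intervalIntegrable (by fun_prop) a 1)
    (Continuous.intervalIntegrable (by fun_prop) a 1) hpointwise
  rw [intervalIntegral.integral_sub (Continuous.intervalIntegrable (by fun_prop) _ _)
      (Continuous.intervalIntegrable (by fun_prop) _ _), intervalIntegral.integral_const_mul,
    intervalIntegral.integral_const_mul, integral_eval_derivative, eval_one_legendreVirial,
    eval_left_legendreVirial, sub_zero, sub_zero] at h_integral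
  have hweight := mul_le_mul_of_nonneg_left (le_integral_sub_sq_mul_one_sub_sq ha ha1)
    (by positivity : 0 ≤ N * ((n + 1) / 2))
  have hκ : 0 ≤ (1 - a) ^ 4 * (n + 1) := by positivity
  refine le_of_mul_le_mul_left ?_ (by linarith : 0 < 2 * N + 1)
  refine le_trans ?_ (hweight.trans h_integral)
  nlinarith

end LegendreEnergy

section PolynomialLaplacian

open MvPolynomial

variable {σ R : Type*} [Fintype σ] [CommRing R]

/-- The linear form `⟨y, x⟩` as a polynomial in `x`. -/
def innerPoly (y : σ → R) : MvPolynomial σ R := ∑ i, C (y i) * X i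

variable (σ R) in
/-- The polynomial `|x|²`. -/
def normSqPoly : MvPolynomial σ R := ∑ i, X i ^ 2

/-- The derivative in direction `y`. -/
def dirDeriv (y : σ → R) : Derivation R (MvPolynomial σ R) (MvPolynomial σ R) :=
  mkDerivation R fun i => C (y i)

theorem isHomogeneous_innerPoly (y : σ → R) : (innerPoly y).IsHomogeneous 1 :=
  IsHomogeneous.sum _ _ _ fun i _ => isHomogeneous_C_mul_X (y i) i

theorem isHomogeneous_normSqPoly : (normSqPoly σ R).IsHomogeneous 2 :=
  IsHomogeneous.sum _ _ _ fun i _ => isHomogeneous_X_pow i 2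

theorem eval_innerPoly (y x : σ → R) : eval x (innerPoly y) = ∑ i, y i * x i := by
  simp [innerPoly]

theorem eval_normSqPoly (x : σ → R) : eval x (normSqPoly σ R) = ∑ i, x i ^ 2 := by
  simp [normSqPoly]

theorem pderiv_innerPoly (y : σ → R) (i : σ) : pderiv i (innerPoly y) = C (y i) := by
  classical
  simp [innerPoly, pderiv_X, Pi.single_apply]

theorem pderiv_normSqPoly (i : σ) : pderiv i (normSqPoly σ R) = 2 * X i := by
  classical
  simp [normSqPoly, pderiv_X, Pi.single_apply, Derivation.leibniz_pow, two_mul]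

theorem dirDeriv_apply (y : σ → R) (p : MvPolynomial σ R) :
    dirDeriv y p = ∑ i, C (y i) * pderiv i p := by
  classical
  induction p using MvPolynomial.induction_on with
  | C a => simp [derivation_C]
  | add p q hp hq => simp only [map_add, hp, hq, mul_add, Finset.sum_add_distrib]
  | mul_X p j hp =>
    have hX : dirDeriv y (X j) = C (y j) := mkDerivation_X ..
    simp [Derivation.leibniz, hp, hX, pderiv_X, Pi.single_apply, mul_add, Finset.sum_add_distrib,
      Finset.mul_sum, mul_left_comm, mul_comm p]

theorem dirDeriv_innerPoly (y : σ → R) : dirDeriv y (innerPoly y) = C (∑ i, y i ^ 2) := by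
  simp only [dirDeriv_apply, pderiv_innerPoly, map_sum, pow_two, C_mul]

theorem dirDeriv_normSqPoly (y : σ → R) :
    dirDeriv y (normSqPoly σ R) = 2 * innerPoly y := by
  simp only [dirDeriv_apply, pderiv_normSqPoly, innerPoly, Finset.mul_sum, mul_left_comm]

variable {d : ℕ}

theorem polyLaplacian_apply (p : MvPolynomial (Fin d) ℂ) :
    polyLaplacian d p = ∑ i, pderiv i (pderiv i p) := by
  simp [polyLaplacian]

theorem polyLaplacian_innerPoly_mul (y : Fin d → ℂ) (p : MvPolynomial (Fin d) ℂ) :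
    polyLaplacian d (innerPoly y * p) = innerPoly y * polyLaplacian d p + 2 * dirDeriv y p := by
  simp only [polyLaplacian_apply, dirDeriv_apply, pderiv_mul, map_add, pderiv_innerPoly, pderiv_C,
    Finset.mul_sum, ← Finset.sum_add_distrib]
  exact Finset.sum_congr rfl fun i _ => by ring

theorem polyLaplacian_normSqPoly_mul {p : MvPolynomial (Fin d) ℂ} {n : ℕ}
    (hp : p.IsHomogeneous n) :
    polyLaplacian d (normSqPoly (Fin d) ℂ * p) = normSqPoly (Fin d) ℂ * polyLaplacian d p +
      (4 * (n : MvPolynomial (Fin d) ℂ) + 2 * (d : MvPolynomial (Fin d) ℂ)) * p := by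
  have hterm (i : Fin d) : pderiv i (pderiv i (normSqPoly (Fin d) ℂ * p)) =
      normSqPoly (Fin d) ℂ * pderiv i (pderiv i p) + 4 * (X i * pderiv i p) + 2 * p := by
    have h2 : pderiv i (2 : MvPolynomial (Fin d) ℂ) = 0 := pderiv_C
    simp only [pderiv_mul, map_add, pderiv_normSqPoly, pderiv_X_self, h2]
    ring
  simp only [polyLaplacian_apply, hterm, Finset.sum_add_distrib, ← Finset.mul_sum,
    hp.sum_X_mul_pderiv, Finset.sum_const, Finset.card_univ, Fintype.card_fin, nsmul_eq_mul]
  ring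

theorem coeff_polyLaplacian (p : MvPolynomial (Fin d) ℂ) (m : Fin d →₀ ℕ) :
    coeff m (polyLaplacian d p) =
      ∑ i, coeff (m + Finsupp.single i 2) p * ((m i + 2) * (m i + 1)) := by
  rw [polyLaplacian_apply, coeff_sum]
  refine Finset.sum_congr rfl fun i _ => ?_
  rw [coeff_pderiv, coeff_pderiv, add_assoc, ← Finsupp.single_add]
  simp only [Finsupp.add_apply, Finsupp.single_eq_same]
  push_cast
  ring

theorem eq_zero_of_polyLaplacian_eq_zero {p : MvPolynomial (Fin d) ℂ}
    (hp : polyLaplacian d p = 0) (j : Fin d) (h : ∀ m : Fin d →₀ ℕ, m j ≤ 1 → coeff m p = 0) :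
    p = 0 := by
  suffices hcoeff : ∀ k, ∀ m : Fin d →₀ ℕ, m j = k → coeff m p = 0 by
    ext m
    rw [hcoeff _ m rfl, coeff_zero]
  intro k
  induction k using Nat.strong_induction_on with
  | _ k ih =>
    intro m hm
    rcases Nat.lt_or_ge k 2 with hk | hk
    · exact h m (by omega)
    obtain ⟨l, rfl⟩ : ∃ l, m = l + Finsupp.single j 2 :=
      ⟨m - Finsupp.single j 2, (tsub_add_cancel_of_le (by simpa [hm] using hk)).symm⟩
    have hlj : l j + 2 = k := by simpa using hm
    have hsum := coeff_polyLaplacian p l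
    rw [hp, coeff_zero, Finset.sum_eq_single j] at hsum
    · refine (mul_eq_zero.mp hsum.symm).resolve_right ?_
      exact_mod_cast (by positivity : (l j + 2) * (l j + 1) ≠ 0)
    · intro i _ hij
      rw [ih (l j) (by omega) _ (by simp [hij.symm]), zero_mul]
    · exact fun hj => absurd (Finset.mem_univ j) hj

end PolynomialLaplacian

section ZonalHarmonics

open MvPolynomial

/-- The zonal solid harmonic `|x|ⁿ P_n(⟨x / |x|, y⟩)` of degree `n` with axis `y`, as a polynomial
in `x`; the recurrence is the homogenization of that of the Legendre polynomials. -/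
def solidZonal (y : Fin 3 → ℂ) : ℕ → MvPolynomial (Fin 3) ℂ
  | 0 => 1
  | 1 => innerPoly y
  | n + 2 => C ((n + 2 : ℂ)⁻¹) *
      (C (2 * n + 3 : ℂ) * (innerPoly y * solidZonal y (n + 1)) -
        C (n + 1 : ℂ) * (normSqPoly (Fin 3) ℂ * solidZonal y n))

variable (y : Fin 3 → ℂ)

theorem solidZonal_zero : solidZonal y 0 = 1 := by rw [solidZonal]

theorem solidZonal_one : solidZonal y 1 = innerPoly y := by rw [solidZonal]

theorem solidZonal_add_two (n : ℕ) :
    C (n + 2 : ℂ) * solidZonal y (n + 2) =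
      C (2 * n + 3 : ℂ) * (innerPoly y * solidZonal y (n + 1)) -
        C (n + 1 : ℂ) * (normSqPoly (Fin 3) ℂ * solidZonal y n) := by
  have hn : (n + 2 : ℂ) ≠ 0 := by exact_mod_cast (n + 1).succ_ne_zero
  rw [solidZonal, ← mul_assoc, ← C_mul, mul_inv_cancel₀ hn, C_1, one_mul]

theorem isHomogeneous_solidZonal (n : ℕ) : (solidZonal y n).IsHomogeneous n := by
  induction n using Nat.twoStepInduction with
  | zero => exact solidZonal_zero y ▸ isHomogeneous_one _ _
  | one => exact solidZonal_one y ▸ isHomogeneous_innerPoly y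
  | more n h0 h1 =>
    have hinner := ((isHomogeneous_innerPoly y).mul h1).C_mul (2 * n + 3 : ℂ)
    have hnorm := (isHomogeneous_normSqPoly.mul h0).C_mul (n + 1 : ℂ)
    rw [show 1 + (n + 1) = n + 2 by ring] at hinner
    rw [show 2 + n = n + 2 by ring] at hnorm
    rw [solidZonal]
    exact (hinner.sub hnorm).C_mul _

variable {y}

theorem C_add_two_mul_left_cancel {σ : Type*} {p q : MvPolynomial σ ℂ} {n : ℕ}
    (h : C (n + 2 : ℂ) * p = C (n + 2 : ℂ) * q) : p = q := by
  refine mul_left_cancel₀ ?_ h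
  rw [Ne, C_eq_zero]
  exact_mod_cast (n + 1).succ_ne_zero

theorem dirDeriv_solidZonal_add_one (hy : ∑ i, y i ^ 2 = 1) (n : ℕ) :
    dirDeriv y (solidZonal y (n + 1)) = C (n + 1 : ℂ) * solidZonal y n := by
  have hinner : dirDeriv y (innerPoly y) = 1 := by rw [dirDeriv_innerPoly, hy, C_1]
  induction n using Nat.twoStepInduction with
  | zero => simp [solidZonal_zero, solidZonal_one, hinner]
  | one =>
    have hrec := congrArg (dirDeriv y) (solidZonal_add_two y 0)
    simp only [zero_add, solidZonal_one, solidZonal_zero, derivation_C, map_sub, Derivation.leibniz,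
      hinner, dirDeriv_normSqPoly, Derivation.map_one_eq_zero, smul_eq_mul] at hrec
    apply C_add_two_mul_left_cancel (n := 0)
    rw [solidZonal_one]
    simp only [C_add, C_mul, map_ofNat, map_natCast, C_1] at hrec ⊢
    push_cast at hrec ⊢
    linear_combination hrec
  | more n h0 h1 =>
    have hrec := congrArg (dirDeriv y) (solidZonal_add_two y (n + 1))
    have hprev := solidZonal_add_two y n
    simp only [derivation_C, map_sub, Derivation.leibniz, hinner, dirDeriv_normSqPoly, h0, h1,
      smul_eq_mul] at hrec
    apply C_add_two_mul_left_cancel (n := n + 1)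
    simp only [C_add, C_mul, map_ofNat, map_natCast, C_1] at hrec hprev ⊢
    push_cast at hrec ⊢
    linear_combination hrec - ((n : MvPolynomial (Fin 3) ℂ) + 2) * hprev

theorem polyLaplacian_solidZonal (hy : ∑ i, y i ^ 2 = 1) (n : ℕ) :
    polyLaplacian 3 (solidZonal y n) = 0 := by
  induction n using Nat.twoStepInduction with
  | zero => simp [solidZonal_zero, polyLaplacian_apply]
  | one => simp [solidZonal_one, polyLaplacian_apply, pderiv_innerPoly]
  | more n h0 h1 =>
    have hrec := congrArg (polyLaplacian 3) (solidZonal_add_two y n)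
    simp only [← smul_eq_C_mul, map_sub, map_smul, polyLaplacian_innerPoly_mul, h0, h1,
      polyLaplacian_normSqPoly_mul (isHomogeneous_solidZonal y n),
      dirDeriv_solidZonal_add_one hy] at hrec
    apply C_add_two_mul_left_cancel (n := n)
    simp only [smul_eq_C_mul, C_add, C_mul, map_ofNat, map_natCast, C_1] at hrec ⊢
    push_cast at hrec
    linear_combination hrec

theorem eval_solidZonal {x : Fin 3 → ℂ} {t : ℝ} (hx : ∑ i, x i ^ 2 = 1)
    (ht : ∑ i, y i * x i = t) (n : ℕ) :
    eval x (solidZonal y n) = ((legendre n).eval t : ℝ) := by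
  induction n using Nat.twoStepInduction with
  | zero => simp [solidZonal_zero, legendre_zero]
  | one => simp [solidZonal_one, legendre_one, eval_innerPoly, ht]
  | more n h0 h1 =>
    have hzonal := congrArg (eval x) (solidZonal_add_two y n)
    have hlegendre := congrArg ((↑) : ℝ → ℂ) (eval_legendre_add_two n t)
    simp only [map_sub, map_mul, eval_C, h0, h1, eval_innerPoly, ht, eval_normSqPoly, hx] at hzonal
    push_cast at hlegendre
    have hn : (n + 2 : ℂ) ≠ 0 := by exact_mod_cast (n + 1).succ_ne_zero
    apply mul_left_cancel₀ hn
    linear_combination hzonal - hlegendre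

theorem sum_sq_coe_sphere {d : ℕ} (x : sphere (0 : EuclideanSpace ℝ (Fin d)) 1) :
    ∑ i, ((x : EuclideanSpace ℝ (Fin d)) i : ℂ) ^ 2 = 1 := by
  have h := EuclideanSpace.real_norm_sq_eq (x : EuclideanSpace ℝ (Fin d))
  rw [norm_eq_of_mem_sphere, one_pow] at h
  exact_mod_cast h.symm

theorem legendre_inner_mem_sphericalHarmonics
    (y : sphere (0 : EuclideanSpace ℝ (Fin 3)) 1) (n : ℕ) :
    (fun x : sphere (0 : EuclideanSpace ℝ (Fin 3)) 1 =>
      (((legendre n).eval (inner ℝ (x : EuclideanSpace ℝ (Fin 3)) y) : ℝ) : ℂ)) ∈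
      sphericalHarmonics 3 n := by
  refine ⟨solidZonal (fun i => (y : EuclideanSpace ℝ (Fin 3)) i) n,
    ⟨isHomogeneous_solidZonal _ n, polyLaplacian_solidZonal (sum_sq_coe_sphere y) n⟩, ?_⟩
  ext x
  refine eval_solidZonal (sum_sq_coe_sphere x) ?_ n
  simp [PiLp.inner_apply]

end ZonalHarmonics

section DimensionBound

open MvPolynomial

/-- The exponents of the monomials of degree `m` in three variables in which the last variable has
exponent at most `1`. A harmonic polynomial is determined by its coefficients there, as by the
Cauchy data on a plane. -/
def cauchyExponent (m : ℕ) : Fin (m + 1) ⊕ Fin m → (Fin 3 →₀ ℕ) :=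
  Sum.elim (fun a => Finsupp.equivFunOnFinite.symm ![a.val, m - a.val, 0])
    (fun a => Finsupp.equivFunOnFinite.symm ![a.val, m - 1 - a.val, 1])

theorem exists_cauchyExponent_eq (k : Fin 3 →₀ ℕ) (hk : k 2 ≤ 1) :
    ∃ a, cauchyExponent k.degree a = k := by
  have hdeg : k.degree = k 0 + k 1 + k 2 := by rw [Finsupp.degree_eq_sum, Fin.sum_univ_three]
  rcases Nat.le_one_iff_eq_zero_or_eq_one.mp hk with hk | hk
  · refine ⟨Sum.inl ⟨k 0, by omega⟩, ?_⟩
    ext i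
    fin_cases i <;> simp [cauchyExponent] <;> omega
  · refine ⟨Sum.inr ⟨k 0, by omega⟩, ?_⟩
    ext i
    fin_cases i <;> simp [cauchyExponent] <;> omega

/-- The coefficients of a polynomial in three variables at the exponents `cauchyExponent m`. -/
def cauchyData (m : ℕ) : MvPolynomial (Fin 3) ℂ →ₗ[ℂ] (Fin (m + 1) ⊕ Fin m → ℂ) :=
  LinearMap.pi fun a => lcoeff ℂ (cauchyExponent m a)

theorem injective_domRestrict_cauchyData (m : ℕ) : Function.Injective ((cauchyData m).domRestrict
    (homogeneousSubmodule (Fin 3) ℂ m ⊓ LinearMap.ker (polyLaplacian 3))) := by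
  rw [← LinearMap.ker_eq_bot, LinearMap.ker_eq_bot']
  rintro ⟨p, hhom, hharm⟩ hzero
  refine Subtype.ext (eq_zero_of_polyLaplacian_eq_zero hharm 2 fun k hk => ?_)
  by_cases hdeg : k.degree = m
  · obtain ⟨a, ha⟩ := exists_cauchyExponent_eq k hk
    subst hdeg
    have hcoeff : coeff (cauchyExponent k.degree a) p = 0 := congrFun hzero a
    rwa [ha] at hcoeff
  · exact IsHomogeneous.coeff_eq_zero hhom hdeg

instance finite_sphericalHarmonics (m : ℕ) : Module.Finite ℂ (sphericalHarmonics 3 m) :=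
  have := Module.Finite.of_injective _ (injective_domRestrict_cauchyData m)
  Module.Finite.map _ (restrictSphere 3)

theorem finrank_sphericalHarmonics_le (m : ℕ) :
    Module.finrank ℂ (sphericalHarmonics 3 m) ≤ 2 * m + 1 := by
  have hinj := injective_domRestrict_cauchyData m
  have := Module.Finite.of_injective _ hinj
  calc Module.finrank ℂ (sphericalHarmonics 3 m)
      ≤ Module.finrank ℂ ↥(homogeneousSubmodule (Fin 3) ℂ m ⊓ LinearMap.ker (polyLaplacian 3)) :=
        Submodule.finrank_map_le (restrictSphere 3) _
    _ ≤ Module.finrank ℂ (Fin (m + 1) ⊕ Fin m → ℂ) :=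
        LinearMap.finrank_le_finrank_of_injective hinj
    _ = 2 * m + 1 := by
        rw [Module.finrank_fintype_fun_eq_card, Fintype.card_sum, Fintype.card_fin,
          Fintype.card_fin]
        ring

end DimensionBound

/-- Three-dimensional Euclidean space. -/
abbrev E3 : Type := EuclideanSpace ℝ (Fin 3)

/-- The unit sphere in three-dimensional Euclidean space. -/
abbrev S2 : Type := sphere (0 : E3) 1

section Polar

open Set

variable {V : Type*} [NormedAddCommGroup V] [NormedSpace ℝ V]

theorem integral_volumeIoiPow (n : ℕ) (f : ℝ → V) :
    ∫ x : Ioi (0 : ℝ), f x ∂(Measure.volumeIoiPow n) = ∫ x in Ioi (0 : ℝ), x ^ n • f x := by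
  simp only [Measure.volumeIoiPow, ENNReal.ofReal]
  rw [integral_withDensity_eq_integral_smul,
    integral_subtype_comap measurableSet_Ioi fun a ↦ Real.toNNReal (a ^ n) • f a,
    setIntegral_congr_fun measurableSet_Ioi fun x hx ↦ ?_]
  · rw [NNReal.smul_def, Real.coe_toNNReal _ (pow_nonneg (le_of_lt hx) _)]
  · exact (measurable_subtype_coe.pow_const _).real_toNNReal

theorem norm_smul_homeomorphUnitSphereProd {E : Type*} [NormedAddCommGroup E] [NormedSpace ℝ E]
    (x : ({0}ᶜ : Set E)) :
    (homeomorphUnitSphereProd E x).2.1 • (homeomorphUnitSphereProd E x).1.1 = (x : E) := by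
  have hx : ‖(x : E)‖ ≠ 0 := norm_ne_zero_iff.mpr x.2
  simp only [homeomorphUnitSphereProd_apply_snd_coe, homeomorphUnitSphereProd_apply_fst_coe,
    smul_smul, mul_inv_cancel₀ hx, one_smul]

theorem integral_eq_integral_toSphere {E : Type*} [NormedAddCommGroup E] [NormedSpace ℝ E]
    [FiniteDimensional ℝ E] [Nontrivial E] [MeasurableSpace E] [BorelSpace E] (μ : Measure E)
    [μ.IsAddHaarMeasure] {F : E → V} (hF : Integrable F μ) :
    ∫ x, F x ∂μ = ∫ ρ in Ioi (0 : ℝ), ρ ^ (Module.finrank ℝ E - 1) •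
      ∫ ω : sphere (0 : E) 1, F (ρ • (ω : E)) ∂μ.toSphere := by
  let g : sphere (0 : E) 1 × Ioi (0 : ℝ) → V := fun p => F (p.2.1 • p.1.1)
  have g_comp : g ∘ homeomorphUnitSphereProd E = F ∘ Subtype.val :=
    funext fun x => congrArg F (norm_smul_homeomorphUnitSphereProd x)
  have hmp := μ.measurePreserving_homeomorphUnitSphereProd
  have hemb := (homeomorphUnitSphereProd E).measurableEmbedding
  have h_int : Integrable g (μ.toSphere.prod (Measure.volumeIoiPow (Module.finrank ℝ E - 1))) := by
    rw [← hmp.integrable_comp_emb hemb, g_comp,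
      ← integrableOn_iff_comap_subtypeVal (measurableSet_singleton _).compl]
    exact hF.integrableOn
  calc ∫ x, F x ∂μ = ∫ x : ({0}ᶜ : Set E), F x ∂(μ.comap Subtype.val) := by
        rw [integral_subtype_comap (measurableSet_singleton _).compl, restrict_compl_singleton]
    _ = ∫ x : ({0}ᶜ : Set E), g (homeomorphUnitSphereProd E x) ∂(μ.comap Subtype.val) :=
        congrArg (integral _) g_comp.symm
    _ = ∫ p, g p ∂(μ.toSphere.prod (Measure.volumeIoiPow _)) := hmp.integral_comp hemb g
    _ = ∫ ρ, ∫ ω, g (ω, ρ) ∂μ.toSphere ∂(Measure.volumeIoiPow _) := integral_prod_symm g h_int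
    _ = _ := integral_volumeIoiPow _ fun ρ => ∫ ω : sphere (0 : E) 1, F (ρ • (ω : E)) ∂μ.toSphere

section

variable {d : ℕ}

instance : (sphereMeasure d).IsOpenPosMeasure where
  open_pos U hU hne := by
    rw [sphereMeasure, Measure.smul_apply, smul_eq_mul]
    exact mul_ne_zero (ENNReal.inv_ne_zero.mpr (measure_ne_top _ _)) (hU.measure_ne_zero _ hne)

variable [NeZero d]

theorem toSphere_univ_ne_zero :
    Measure.toSphere (volume : Measure (EuclideanSpace ℝ (Fin d))) univ ≠ 0 :=
  Measure.measure_univ_ne_zero.mpr (Measure.toSphere_ne_zero _)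

instance : IsProbabilityMeasure (sphereMeasure d) where
  measure_univ := by
    rw [sphereMeasure, Measure.smul_apply, smul_eq_mul]
    exact ENNReal.inv_mul_cancel toSphere_univ_ne_zero (measure_ne_top _ _)

end

/-- The area of the unit sphere. -/
def sphereArea : ℝ := (Measure.toSphere (volume : Measure E3)).real univ

theorem sphereArea_pos : 0 < sphereArea :=
  ENNReal.toReal_pos toSphere_univ_ne_zero (measure_ne_top _ _)

theorem integral_toSphere (f : S2 → V) :
    ∫ ω, f ω ∂(Measure.toSphere (volume : Measure E3)) =
      sphereArea • ∫ ω, f ω ∂(sphereMeasure 3) := by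
  rw [sphereMeasure, integral_smul_measure, smul_smul, ENNReal.toReal_inv, ← measureReal_def,
    ← sphereArea, mul_inv_cancel₀ sphereArea_pos.ne', one_smul]

theorem integral_polar {F : E3 → V} (hF : Integrable F) :
    ∫ x, F x = sphereArea •
      ∫ ρ in Ioi (0 : ℝ), ρ ^ 2 • ∫ ω : S2, F (ρ • (ω : E3)) ∂(sphereMeasure 3) := by
  simp only [integral_eq_integral_toSphere volume hF, finrank_euclideanSpace, Fintype.card_fin,
    Nat.add_one_sub_one, integral_toSphere, smul_comm _ sphereArea, integral_smul]

end Polar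

section Moments

open Set

variable {a b : ℝ} {μ ν : Measure ℝ}

theorem integrable_of_ae_mem_Icc [IsFiniteMeasure μ] (hμ : ∀ᵐ t ∂μ, t ∈ Icc a b) {f : ℝ → ℝ}
    (hf : Continuous f) : Integrable f μ := by
  rw [← Measure.restrict_eq_self_of_ae_mem hμ]
  exact hf.continuousOn.integrableOn_Icc

theorem integral_eval_eq_sum [IsFiniteMeasure μ] (hμ : ∀ᵐ t ∂μ, t ∈ Icc a b)
    (p : Polynomial ℝ) : ∫ t, p.eval t ∂μ = p.sum fun k c => c * ∫ t, t ^ k ∂μ := by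
  simp only [Polynomial.eval_eq_sum, Polynomial.sum]
  rw [integral_finsetSum _ fun k _ => (integrable_of_ae_mem_Icc hμ (by fun_prop)).const_mul _]
  simp only [integral_const_mul]

theorem dist_integral_le_of_ae_mem_Icc [IsFiniteMeasure μ] (hμ : ∀ᵐ t ∂μ, t ∈ Icc a b)
    {f g : ℝ → ℝ} (hf : Continuous f) (hg : Continuous g) {ε : ℝ}
    (hfg : ∀ t ∈ Icc a b, |f t - g t| ≤ ε) :
    dist (∫ t, f t ∂μ) (∫ t, g t ∂μ) ≤ ε * μ.real univ := by
  rw [dist_eq_norm,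
    ← integral_sub (integrable_of_ae_mem_Icc hμ hf) (integrable_of_ae_mem_Icc hμ hg)]
  exact norm_integral_le_of_norm_le_const (hμ.mono hfg)

theorem measure_eq_of_integral_pow_eq [IsFiniteMeasure μ] [IsFiniteMeasure ν]
    (hμ : ∀ᵐ t ∂μ, t ∈ Icc a b) (hν : ∀ᵐ t ∂ν, t ∈ Icc a b)
    (h : ∀ k : ℕ, ∫ t, t ^ k ∂μ = ∫ t, t ^ k ∂ν) : μ = ν := by
  refine ext_of_forall_integral_eq_of_IsFiniteMeasure fun f => eq_of_forall_dist_le fun ε hε => ?_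
  set C := μ.real univ + ν.real univ
  have hC : 0 < C + 1 := by positivity
  obtain ⟨p, hp⟩ := exists_polynomial_near_of_continuousOn a b f f.continuous.continuousOn
    (ε / (C + 1)) (by positivity)
  have hpf : ∀ t ∈ Icc a b, |p.eval t - f t| ≤ ε / (C + 1) := fun t ht => (hp t ht).le
  have hμp := dist_integral_le_of_ae_mem_Icc hμ p.continuous f.continuous hpf
  have hνp := dist_integral_le_of_ae_mem_Icc hν p.continuous f.continuous hpf
  have hpp : ∫ t, p.eval t ∂μ = ∫ t, p.eval t ∂ν := by
    simp only [integral_eval_eq_sum hμ, integral_eval_eq_sum hν, h]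
  calc dist (∫ t, f t ∂μ) (∫ t, f t ∂ν)
      ≤ dist (∫ t, p.eval t ∂μ) (∫ t, f t ∂μ) + dist (∫ t, p.eval t ∂ν) (∫ t, f t ∂ν) := by
        rw [hpp]
        exact dist_triangle_left _ _ _
    _ ≤ ε / (C + 1) * C := by linarith
    _ ≤ ε / (C + 1) * (C + 1) := by gcongr; linarith
    _ = ε := div_mul_cancel₀ _ hC.ne'

end Moments

section Archimedes

open Set

/-- The radial factor `∫_0^∞ ρ^k e^{-ρ²} dρ` of a Gaussian moment in polar coordinates. -/
def gaussMoment (k : ℕ) : ℝ := ∫ ρ in Ioi (0 : ℝ), ρ ^ k * Real.exp (-ρ ^ 2)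

theorem gaussMoment_eq (k : ℕ) : gaussMoment k = 1 / 2 * Real.Gamma ((k + 1) / 2) := by
  have hk : (-1 : ℝ) < k := by linarith [(Nat.cast_nonneg k : (0 : ℝ) ≤ k)]
  rw [← integral_rpow_mul_exp_neg_rpow two_pos hk, gaussMoment]
  simp only [Real.rpow_natCast, Real.rpow_ofNat]

theorem gaussMoment_pos (k : ℕ) : 0 < gaussMoment k := by
  rw [gaussMoment_eq]
  have := Real.Gamma_pos_of_pos (s := ((k : ℝ) + 1) / 2) (by positivity)
  positivity

theorem gaussMoment_add_two (k : ℕ) : gaussMoment (k + 2) = (k + 1) / 2 * gaussMoment k := by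
  have h : ((k + 2 : ℕ) + 1 : ℝ) / 2 = (k + 1) / 2 + 1 := by push_cast; ring
  rw [gaussMoment_eq, gaussMoment_eq, h, Real.Gamma_add_one (by positivity)]
  ring

theorem integrable_pow_mul_exp_neg_sq (k : ℕ) :
    Integrable fun x : ℝ => x ^ k * Real.exp (-x ^ 2) := by
  have := integrable_rpow_mul_exp_neg_mul_sq one_pos (s := k)
    (by linarith [(Nat.cast_nonneg k : (0 : ℝ) ≤ k)])
  simpa using this

theorem integral_pow_mul_exp_neg_sq (k : ℕ) :
    ∫ x : ℝ, x ^ k * Real.exp (-x ^ 2) = (1 + (-1) ^ k) * gaussMoment k := by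
  have h_int := integrable_pow_mul_exp_neg_sq k
  have h_neg : ∫ x in Iic (0 : ℝ), x ^ k * Real.exp (-x ^ 2) = (-1) ^ k * gaussMoment k := by
    have h := integral_comp_neg_Iic 0 fun x : ℝ => (-1) ^ k * (x ^ k * Real.exp (-x ^ 2))
    rw [neg_zero] at h
    rw [gaussMoment, ← integral_const_mul, ← h]
    refine setIntegral_congr_fun measurableSet_Iic fun x _ => ?_
    simp only [← mul_assoc, ← mul_pow, neg_one_mul, neg_neg, even_two.neg_pow]
  rw [← intervalIntegral.integral_Iic_add_Ioi h_int.integrableOn h_int.integrableOn, h_neg,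
    ← gaussMoment]
  ring

theorem coord_pow_mul_exp_eq_prod (k : ℕ) (x : E3) : x 0 ^ k * Real.exp (-‖x‖ ^ 2) =
    ∏ i, x i ^ (if i = 0 then k else 0) * Real.exp (-x i ^ 2) := by
  rw [EuclideanSpace.real_norm_sq_eq, Finset.prod_mul_distrib, ← Real.exp_sum]
  simp [Fin.sum_univ_three]

theorem integrable_coord_pow_mul_exp (k : ℕ) :
    Integrable fun x : E3 => x 0 ^ k * Real.exp (-‖x‖ ^ 2) := by
  simp_rw [coord_pow_mul_exp_eq_prod]
  have h := Integrable.fintype_prod (μ := fun _ : Fin 3 => (volume : Measure ℝ))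
    (f := fun i t => t ^ (if i = 0 then k else 0) * Real.exp (-t ^ 2))
    (fun i => integrable_pow_mul_exp_neg_sq _)
  exact (PiLp.volume_preserving_ofLp (Fin 3)).integrable_comp_of_integrable h

theorem integral_coord_pow_mul_exp (k : ℕ) :
    ∫ x : E3, x 0 ^ k * Real.exp (-‖x‖ ^ 2) =
      (1 + (-1) ^ k) * gaussMoment k * (2 * gaussMoment 0) ^ 2 := by
  simp_rw [coord_pow_mul_exp_eq_prod]
  rw [(PiLp.volume_preserving_ofLp (Fin 3)).integral_comp
    (MeasurableEquiv.toLp 2 (Fin 3 → ℝ)).symm.measurableEmbedding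
    (fun z : Fin 3 → ℝ => ∏ i, z i ^ (if i = 0 then k else 0) * Real.exp (-z i ^ 2)),
    integral_fintype_prod_volume_eq_prod (𝕜 := ℝ) (E := fun _ : Fin 3 => ℝ)
      (fun i t => t ^ (if i = 0 then k else 0) * Real.exp (-t ^ 2)), Fin.prod_univ_three]
  simp only [if_true, if_false, one_ne_zero, Fin.reduceEq, integral_pow_mul_exp_neg_sq]
  ring

theorem exists_isometry_inner_eq_coord (y : S2) :
    ∃ L : E3 ≃ₗᵢ[ℝ] E3, ∀ x : E3, L x 0 = inner ℝ x (y : E3) := by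
  have hv : Orthonormal ℝ (({0} : Set (Fin 3)).domRestrict fun _ => (y : E3)) :=
    ⟨fun _ => mem_sphere_zero_iff_norm.mp y.2, fun i j hij => absurd (Subsingleton.elim i j) hij⟩
  obtain ⟨b, hb⟩ := hv.exists_orthonormalBasis_extension_of_card_eq (by simp)
  refine ⟨b.repr, fun x => ?_⟩
  rw [b.repr_apply_apply, hb 0 rfl, real_inner_comm]

theorem integrable_inner_pow_mul_exp (y : S2) (k : ℕ) :
    Integrable fun x : E3 => inner ℝ x (y : E3) ^ k * Real.exp (-‖x‖ ^ 2) := by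
  obtain ⟨L, hL⟩ := exists_isometry_inner_eq_coord y
  simpa only [Function.comp_def, hL, L.norm_map] using
    L.measurePreserving.integrable_comp_of_integrable (integrable_coord_pow_mul_exp k)

theorem integral_inner_pow_mul_exp (y : S2) (k : ℕ) :
    ∫ x : E3, inner ℝ x (y : E3) ^ k * Real.exp (-‖x‖ ^ 2) =
      (1 + (-1) ^ k) * gaussMoment k * (2 * gaussMoment 0) ^ 2 := by
  obtain ⟨L, hL⟩ := exists_isometry_inner_eq_coord y
  rw [← integral_coord_pow_mul_exp, ← L.measurePreserving.integral_comp
    L.toHomeomorph.measurableEmbedding (fun x : E3 => x 0 ^ k * Real.exp (-‖x‖ ^ 2))]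
  simp only [hL, L.norm_map]

theorem integral_inner_pow_mul_exp_eq_sphereArea_mul (y : S2) (k : ℕ) :
    ∫ x : E3, inner ℝ x (y : E3) ^ k * Real.exp (-‖x‖ ^ 2) =
      sphereArea * (gaussMoment (k + 2) * ∫ ω : S2, inner ℝ (ω : E3) (y : E3) ^ k
        ∂(sphereMeasure 3)) := by
  rw [integral_polar (integrable_inner_pow_mul_exp y k), gaussMoment, ← integral_mul_const,
    smul_eq_mul]
  congr 1
  refine setIntegral_congr_fun measurableSet_Ioi fun ρ hρ => ?_
  have h_smul : ∀ ω : S2, inner ℝ (ρ • (ω : E3)) (y : E3) ^ k * Real.exp (-‖ρ • (ω : E3)‖ ^ 2) =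
      (ρ ^ k * Real.exp (-ρ ^ 2)) * inner ℝ (ω : E3) (y : E3) ^ k := by
    intro ω
    rw [real_inner_smul_left, norm_smul, mem_sphere_zero_iff_norm.mp ω.2, mul_one,
      Real.norm_of_nonneg (le_of_lt hρ), mul_pow]
    ring
  simp only [h_smul, integral_const_mul, smul_eq_mul]
  ring

theorem sphereArea_eq : sphereArea = 16 * gaussMoment 0 ^ 2 := by
  obtain ⟨y⟩ : Nonempty S2 := (NormedSpace.sphere_nonempty.mpr zero_le_one).to_subtype
  have h := integral_inner_pow_mul_exp_eq_sphereArea_mul y 0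
  rw [integral_inner_pow_mul_exp, gaussMoment_add_two] at h
  simp only [pow_zero, integral_const, probReal_univ, Nat.cast_zero, smul_eq_mul] at h
  refine mul_left_cancel₀ (gaussMoment_pos 0).ne' ?_
  linarith

theorem integral_inner_pow (y : S2) (k : ℕ) :
    ∫ ω : S2, inner ℝ (ω : E3) (y : E3) ^ k ∂(sphereMeasure 3) =
      (1 + (-1) ^ k) / (2 * (k + 1)) := by
  have h := integral_inner_pow_mul_exp_eq_sphereArea_mul y k
  rw [integral_inner_pow_mul_exp, sphereArea_eq, gaussMoment_add_two] at h
  have h0 := gaussMoment_pos 0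
  have hk := gaussMoment_pos k
  rw [eq_div_iff (by positivity)]
  have h_scale : 4 * gaussMoment 0 ^ 2 * gaussMoment k ≠ 0 := by positivity
  refine mul_left_cancel₀ h_scale ?_
  linarith

/-- The uniform probability measure on `[-1, 1]`. -/
def uniformMeasure : Measure ℝ :=
  (2⁻¹ : ENNReal) • (volume : Measure ℝ).restrict (Icc (-1) 1)

theorem integral_uniformMeasure {V : Type*} [NormedAddCommGroup V] [NormedSpace ℝ V] (f : ℝ → V) :
    ∫ t, f t ∂uniformMeasure = (2⁻¹ : ℝ) • ∫ t in (-1 : ℝ)..1, f t := by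
  rw [uniformMeasure, integral_smul_measure, intervalIntegral.integral_of_le (by norm_num),
    integral_Icc_eq_integral_Ioc, ENNReal.toReal_inv, ENNReal.toReal_ofNat]

instance : IsProbabilityMeasure uniformMeasure where
  measure_univ := by
    rw [uniformMeasure, Measure.smul_apply, Measure.restrict_apply_univ, Real.volume_Icc,
      smul_eq_mul, sub_neg_eq_add, one_add_one_eq_two, ENNReal.ofReal_ofNat]
    exact ENNReal.inv_mul_cancel two_ne_zero ENNReal.ofNat_ne_top

theorem ae_uniformMeasure_mem : ∀ᵐ t ∂uniformMeasure, t ∈ Icc (-1 : ℝ) 1 :=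
  Measure.ae_smul_measure (ae_restrict_mem measurableSet_Icc) _

theorem integral_pow_uniformMeasure (k : ℕ) :
    ∫ t, t ^ k ∂uniformMeasure = (1 + (-1) ^ k) / (2 * (k + 1)) := by
  rw [integral_uniformMeasure, integral_pow, smul_eq_mul, one_pow, pow_succ]
  field_simp
  ring

theorem inner_mem_Icc {E : Type*} [NormedAddCommGroup E] [InnerProductSpace ℝ E]
    (x y : sphere (0 : E) 1) : inner ℝ (x : E) (y : E) ∈ Icc (-1 : ℝ) 1 := by
  have h := abs_real_inner_le_norm (x : E) (y : E)
  rw [mem_sphere_zero_iff_norm.mp x.2, mem_sphere_zero_iff_norm.mp y.2, mul_one] at h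
  exact abs_le.mp h

/-- Archimedes' hat-box theorem. -/
theorem measurePreserving_inner (y : S2) :
    MeasurePreserving (fun ω : S2 => inner ℝ (ω : E3) (y : E3)) (sphereMeasure 3)
      uniformMeasure := by
  have hc : Continuous fun ω : S2 => inner ℝ (ω : E3) (y : E3) := by fun_prop
  have := Measure.isProbabilityMeasure_map (μ := sphereMeasure 3) hc.aemeasurable
  refine ⟨hc.measurable, measure_eq_of_integral_pow_eq (a := -1) (b := 1) ?_
    ae_uniformMeasure_mem fun k => ?_⟩
  · refine (ae_map_iff hc.aemeasurable measurableSet_Icc).mpr ?_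
    exact Filter.Eventually.of_forall fun ω => inner_mem_Icc ω y
  · rw [integral_map hc.aemeasurable (by fun_prop), integral_inner_pow,
      integral_pow_uniformMeasure]

theorem integral_comp_inner {V : Type*} [NormedAddCommGroup V] [NormedSpace ℝ V] {f : ℝ → V}
    (hf : AEStronglyMeasurable f uniformMeasure) (y : S2) :
    ∫ ω : S2, f (inner ℝ (ω : E3) (y : E3)) ∂(sphereMeasure 3) =
      (2⁻¹ : ℝ) • ∫ t in (-1 : ℝ)..1, f t := by
  have hmp := measurePreserving_inner y
  rw [← integral_uniformMeasure, ← hmp.map_eq,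
    integral_map hmp.aemeasurable (hmp.map_eq.symm ▸ hf)]

end Archimedes

section Continuity

theorem integrable_of_continuous {X V : Type*} [TopologicalSpace X] [CompactSpace X]
    [MeasurableSpace X] [OpensMeasurableSpace X] [NormedAddCommGroup V] {μ : Measure X}
    [IsFiniteMeasureOnCompacts μ] {f : X → V} (hf : Continuous f) : Integrable f μ :=
  hf.integrable_of_hasCompactSupport (HasCompactSupport.of_compactSpace _)

theorem eq_zero_of_integral_nonpos {X : Type*} [TopologicalSpace X] [CompactSpace X]
    [MeasurableSpace X] [OpensMeasurableSpace X] {μ : Measure X} [IsFiniteMeasureOnCompacts μ]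
    [μ.IsOpenPosMeasure] {f : X → ℝ} (hf : Continuous f) (h0 : 0 ≤ f) (h : ∫ x, f x ∂μ ≤ 0) :
    f = 0 := by
  have h_int : ∫ x, f x ∂μ = 0 := le_antisymm h (integral_nonneg h0)
  rw [integral_eq_zero_iff_of_nonneg h0 (integrable_of_continuous hf)] at h_int
  exact (hf.ae_eq_iff_eq μ continuous_const).mp h_int

end Continuity

section FamilyKernel

variable {X ι κ : Type*} [Fintype ι] [Fintype κ]

/-- The kernel `∑_l Y_l(x) conj (Y_l(y))` of a finite family of functions. If the family is
orthonormal, this is the reproducing kernel of its span. -/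
def familyKernel (Y : ι → X → ℂ) (x y : X) : ℂ := ∑ l, Y l x * conj (Y l y)

theorem conj_familyKernel (Y : ι → X → ℂ) (x y : X) :
    conj (familyKernel Y x y) = familyKernel Y y x := by
  simp only [familyKernel, map_sum, map_mul, Complex.conj_conj, mul_comm]

theorem familyKernel_mem_span (Y : ι → X → ℂ) (y : X) :
    (fun x => familyKernel Y x y) ∈ Submodule.span ℂ (Set.range Y) := by
  refine (Submodule.mem_span_range_iff_exists_fun ℂ).mpr ⟨fun l => conj (Y l y), ?_⟩
  ext x
  simp only [Finset.sum_apply, Pi.smul_apply, smul_eq_mul, familyKernel, mul_comm]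

variable [TopologicalSpace X] [CompactSpace X] [MeasurableSpace X] [OpensMeasurableSpace X]
  {μ : Measure X} [IsFiniteMeasureOnCompacts μ] {Y : ι → X → ℂ} {Z : κ → X → ℂ}

theorem integral_familyKernel_mul_conj (hY : ∀ l, Continuous (Y l)) (hZ : ∀ k, Continuous (Z k))
    (x y : X) :
    ∫ ω, familyKernel Y ω x * conj (familyKernel Z ω y) ∂μ =
      ∑ l, ∑ k, (∫ ω, Y l ω * conj (Z k ω) ∂μ) * (conj (Y l x) * Z k y) := by
  have h_expand : ∀ ω, familyKernel Y ω x * conj (familyKernel Z ω y) =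
      ∑ l, ∑ k, (Y l ω * conj (Z k ω)) * (conj (Y l x) * Z k y) := by
    intro ω
    simp only [familyKernel, map_sum, map_mul, Complex.conj_conj, Finset.sum_mul_sum,
      mul_mul_mul_comm]
  simp_rw [h_expand]
  rw [integral_finsetSum _ fun l _ => integrable_of_continuous (by fun_prop)]
  refine Finset.sum_congr rfl fun l _ => ?_
  rw [integral_finsetSum _ fun k _ => integrable_of_continuous (by fun_prop)]
  exact Finset.sum_congr rfl fun k _ => integral_mul_const _ _

theorem integral_integral_familyKernel_mul_conj (hY : ∀ l, Continuous (Y l))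
    (hZ : ∀ k, Continuous (Z k)) :
    ∫ y, ∫ x, familyKernel Y x y * conj (familyKernel Z x y) ∂μ ∂μ =
      ((∑ l, ∑ k, ‖∫ x, Y l x * conj (Z k x) ∂μ‖ ^ 2 : ℝ) : ℂ) := by
  simp_rw [integral_familyKernel_mul_conj hY hZ]
  rw [integral_finsetSum _ fun l _ => integrable_of_continuous (by fun_prop)]
  push_cast
  refine Finset.sum_congr rfl fun l _ => ?_
  rw [integral_finsetSum _ fun k _ => integrable_of_continuous (by fun_prop)]
  refine Finset.sum_congr rfl fun k _ => ?_
  rw [integral_const_mul, ← Complex.mul_conj', ← integral_conj]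
  simp only [map_mul, Complex.conj_conj]

theorem integral_mul_conj_eq_zero_of_forall_integral_familyKernel_eq_zero
    (hY : ∀ l, Continuous (Y l)) (hZ : ∀ k, Continuous (Z k))
    (h : ∀ y, ∫ x, familyKernel Y x y * conj (familyKernel Z x y) ∂μ = 0) (l : ι) (k : κ) :
    ∫ x, Y l x * conj (Z k x) ∂μ = 0 := by
  have h_sum := integral_integral_familyKernel_mul_conj (μ := μ) hY hZ
  simp only [h, integral_zero] at h_sum
  have h_zero : ∑ l, ∑ k, ‖∫ x, Y l x * conj (Z k x) ∂μ‖ ^ 2 = 0 := by exact_mod_cast h_sum.symm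
  rw [Finset.sum_eq_zero_iff_of_nonneg fun l _ => Finset.sum_nonneg fun k _ => by positivity]
    at h_zero
  have h_row := h_zero l (Finset.mem_univ l)
  rw [Finset.sum_eq_zero_iff_of_nonneg fun k _ => by positivity] at h_row
  exact norm_eq_zero.mp (pow_eq_zero_iff two_ne_zero |>.mp (h_row k (Finset.mem_univ k)))

end FamilyKernel

section OrthonormalBasis

variable {d m : ℕ}

theorem continuous_of_mem_sphericalHarmonics
    {f : sphere (0 : EuclideanSpace ℝ (Fin d)) 1 → ℂ} (hf : f ∈ sphericalHarmonics d m) :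
    Continuous f := by
  obtain ⟨p, -, rfl⟩ := hf
  exact (MvPolynomial.continuous_eval p).comp (continuous_pi fun i => by fun_prop)

/-- Spherical harmonics as continuous functions. -/
def sphericalHarmonicsToContinuousMap (d m : ℕ) :
    sphericalHarmonics d m →ₗ[ℂ] C(sphere (0 : EuclideanSpace ℝ (Fin d)) 1, ℂ) where
  toFun f := ⟨f, continuous_of_mem_sphericalHarmonics f.2⟩
  map_add' _ _ := rfl
  map_smul' _ _ := rfl

theorem exists_isSphericalHarmonicBasis [NeZero d] (m : ℕ)
    [Module.Finite ℂ (sphericalHarmonics d m)] :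
    ∃ (n : ℕ) (Y : Fin n → sphere (0 : EuclideanSpace ℝ (Fin d)) 1 → ℂ),
      IsSphericalHarmonicBasis d m Y := by
  let Φ := (ContinuousMap.toLp (E := ℂ) 2 (sphereMeasure d) ℂ).toLinearMap ∘ₗ
    sphericalHarmonicsToContinuousMap d m
  have hΦ : Function.Injective Φ := (ContinuousMap.toLp_injective _).comp fun f g h =>
    Subtype.ext (congrArg DFunLike.coe h)
  let e := LinearEquiv.ofInjective Φ hΦ
  let b := stdOrthonormalBasis ℂ (LinearMap.range Φ)
  let B := b.toBasis.map e.symm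
  have h_integral : ∀ l k, ∫ x, (B l).1 x * conj ((B k).1 x) ∂(sphereMeasure d) =
      if k = l then 1 else 0 := by
    intro l k
    have h_inner : inner ℂ (Φ (B k)) (Φ (B l)) = inner ℂ (b k) (b l) := by
      rw [Submodule.coe_inner, ← e.apply_symm_apply (b k), ← e.apply_symm_apply (b l)]
      rfl
    rw [← orthonormal_iff_ite.mp b.orthonormal k l, ← h_inner]
    exact (ContinuousMap.inner_toLp (𝕜 := ℂ) (sphereMeasure d)
      (sphericalHarmonicsToContinuousMap d m (B k))
      (sphericalHarmonicsToContinuousMap d m (B l))).symm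
  refine ⟨_, fun l => (B l).1, ?_, fun l => ?_, fun l k hlk => ?_⟩
  · rw [Set.range_comp' Subtype.val, ← Submodule.coe_subtype, ← Submodule.map_span, B.span_eq,
      Submodule.map_subtype_top]
  · rw [h_integral, if_pos rfl]
  · rw [h_integral, if_neg hlk.symm]

variable {ι : Type*} {Y : ι → sphere (0 : EuclideanSpace ℝ (Fin d)) 1 → ℂ}

namespace IsSphericalHarmonicBasis

theorem mem (hY : IsSphericalHarmonicBasis d m Y) (l : ι) : Y l ∈ sphericalHarmonics d m :=
  hY.span_eq ▸ Submodule.subset_span ⟨l, rfl⟩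

theorem continuous (hY : IsSphericalHarmonicBasis d m Y) (l : ι) : Continuous (Y l) :=
  continuous_of_mem_sphericalHarmonics (hY.mem l)

theorem integral_sum_mul_conj [Fintype ι] [NeZero d]
    (hY : IsSphericalHarmonicBasis d m Y) (c : ι → ℂ) (l : ι) :
    ∫ x, (∑ k, c k • Y k) x * conj (Y l x) ∂(sphereMeasure d) = c l := by
  have hYc := hY.continuous
  simp only [Finset.sum_apply, Pi.smul_apply, smul_eq_mul, Finset.sum_mul, mul_assoc]
  rw [integral_finsetSum _ fun k _ => integrable_of_continuous (by fun_prop)]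
  simp only [integral_const_mul]
  rw [Finset.sum_eq_single l (fun k _ hk => by rw [hY.integral_ne k l hk, mul_zero])
    fun hl => absurd (Finset.mem_univ l) hl, hY.integral_self, mul_one]

theorem linearIndependent [Finite ι] [NeZero d] (hY : IsSphericalHarmonicBasis d m Y) :
    LinearIndependent ℂ Y := by
  cases nonempty_fintype ι
  refine Fintype.linearIndependent_iff.mpr fun c hc l => ?_
  rw [← hY.integral_sum_mul_conj c l, hc]
  simp only [Pi.zero_apply, zero_mul, integral_zero]

variable [Fintype ι]

theorem card_eq_finrank [NeZero d] (hY : IsSphericalHarmonicBasis d m Y) :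
    Fintype.card ι = Module.finrank ℂ (sphericalHarmonics d m) := by
  rw [← hY.span_eq, finrank_span_eq_card hY.linearIndependent]

theorem familyKernel_mem (hY : IsSphericalHarmonicBasis d m Y)
    (y : sphere (0 : EuclideanSpace ℝ (Fin d)) 1) :
    (fun x => familyKernel Y x y) ∈ sphericalHarmonics d m :=
  hY.span_eq ▸ familyKernel_mem_span Y y

theorem integral_mul_conj_familyKernel [NeZero d] (hY : IsSphericalHarmonicBasis d m Y)
    {f : sphere (0 : EuclideanSpace ℝ (Fin d)) 1 → ℂ} (hf : f ∈ sphericalHarmonics d m)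
    (y : sphere (0 : EuclideanSpace ℝ (Fin d)) 1) :
    ∫ x, f x * conj (familyKernel Y x y) ∂(sphereMeasure d) = f y := by
  have hfc := continuous_of_mem_sphericalHarmonics hf
  have hYc := hY.continuous
  have h_expand : ∀ x, f x * conj (familyKernel Y x y) = ∑ l, f x * conj (Y l x) * Y l y := by
    intro x
    simp only [familyKernel, map_sum, map_mul, Complex.conj_conj, Finset.mul_sum, mul_assoc]
  simp_rw [h_expand]
  rw [integral_finsetSum _ fun l _ => integrable_of_continuous (by fun_prop)]
  simp only [integral_mul_const]
  rw [← hY.span_eq, Submodule.mem_span_range_iff_exists_fun] at hf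
  obtain ⟨c, rfl⟩ := hf
  simp_rw [hY.integral_sum_mul_conj]
  simp only [Finset.sum_apply, Pi.smul_apply, smul_eq_mul]

theorem integral_familyKernel_diag [NeZero d] (hY : IsSphericalHarmonicBasis d m Y) :
    ∫ y, familyKernel Y y y ∂(sphereMeasure d) = Fintype.card ι := by
  have hYc := hY.continuous
  unfold familyKernel
  rw [integral_finsetSum _ fun l _ => integrable_of_continuous (by fun_prop)]
  simp only [hY.integral_self, Finset.sum_const, Finset.card_univ, nsmul_eq_mul, mul_one]

end IsSphericalHarmonicBasis

end OrthonormalBasis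

section Addition

theorem integral_legendre_inner_mul_legendre_inner_self (n k : ℕ) (y : S2) :
    ∫ x : S2, (legendre n).eval (inner ℝ (x : E3) (y : E3)) *
      (legendre k).eval (inner ℝ (x : E3) (y : E3)) ∂(sphereMeasure 3) =
      if n = k then 1 / (2 * n + 1 : ℝ) else 0 := by
  rw [integral_comp_inner (f := fun t => (legendre n).eval t * (legendre k).eval t)
    ((legendre n).continuous.mul (legendre k).continuous).aestronglyMeasurable, smul_eq_mul]
  split_ifs with hnk
  · subst hnk
    simp only [← sq]
    rw [integral_legendre_sq]
    field_simp
  · rw [integral_legendre_mul_legendre_of_ne hnk, mul_zero]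

/-- The zonal harmonic of degree `m`, normalized so as to be the reproducing kernel of the spherical
harmonics of degree `m` on the two-dimensional sphere. -/
def zonalKernel (m : ℕ) (x y : S2) : ℝ :=
  (2 * m + 1) * (legendre m).eval (inner ℝ (x : E3) (y : E3))

theorem zonalKernel_comm (m : ℕ) (x y : S2) : zonalKernel m x y = zonalKernel m y x := by
  rw [zonalKernel, zonalKernel, real_inner_comm]

theorem abs_zonalKernel_le (m : ℕ) (x y : S2) : |zonalKernel m x y| ≤ 2 * m + 1 := by
  rw [zonalKernel, abs_mul, abs_of_nonneg (by positivity)]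
  exact mul_le_of_le_one_right (by positivity) (abs_legendre_le_one m (inner_mem_Icc x y))

theorem continuous_zonalKernel (m : ℕ) (y : S2) : Continuous fun x => zonalKernel m x y :=
  continuous_const.mul ((legendre m).continuous.comp (by fun_prop))

theorem zonalKernel_mem (m : ℕ) (y : S2) :
    (fun x => (zonalKernel m x y : ℂ)) ∈ sphericalHarmonics 3 m := by
  convert Submodule.smul_mem _ ((2 * m + 1 : ℝ) : ℂ) (legendre_inner_mem_sphericalHarmonics y m)
    using 1
  ext x
  simp only [zonalKernel, Complex.ofReal_mul, Pi.smul_apply, smul_eq_mul]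

theorem zonalKernel_self (m : ℕ) (y : S2) : zonalKernel m y y = 2 * m + 1 := by
  rw [zonalKernel, real_inner_self_eq_norm_sq, mem_sphere_zero_iff_norm.mp y.2, one_pow,
    eval_one_legendre, mul_one]

theorem integral_zonalKernel_mul_self (n k : ℕ) (y : S2) :
    ∫ x, zonalKernel n x y * zonalKernel k x y ∂(sphereMeasure 3) =
      if n = k then (2 * n + 1 : ℝ) else 0 := by
  simp only [zonalKernel, mul_mul_mul_comm (2 * (n : ℝ) + 1)]
  rw [integral_const_mul, integral_legendre_inner_mul_legendre_inner_self, mul_ite, mul_zero]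
  split_ifs with hnk
  · subst hnk
    field_simp
  · rfl

namespace IsSphericalHarmonicBasis

section FamilyKernel

variable {m : ℕ} {ι : Type*} [Fintype ι] {Y : ι → S2 → ℂ}

theorem integral_norm_zonalKernel_sub_familyKernel_sq (hY : IsSphericalHarmonicBasis 3 m Y)
    (y : S2) :
    ∫ x, ‖(zonalKernel m x y : ℂ) - familyKernel Y x y‖ ^ 2 ∂(sphereMeasure 3) =
      (familyKernel Y y y).re - (2 * m + 1) := by
  have hW := zonalKernel_mem m y
  have hD : (fun x => (zonalKernel m x y : ℂ) - familyKernel Y x y) ∈ sphericalHarmonics 3 m :=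
    Submodule.sub_mem _ hW (hY.familyKernel_mem y)
  have hWc := continuous_zonalKernel m y
  have hZc := continuous_of_mem_sphericalHarmonics (hY.familyKernel_mem y)
  have h_expand : ∀ x, ((‖(zonalKernel m x y : ℂ) - familyKernel Y x y‖ ^ 2 : ℝ) : ℂ) =
      ((zonalKernel m x y * zonalKernel m x y : ℝ) : ℂ) -
        conj ((zonalKernel m x y : ℂ) * conj (familyKernel Y x y)) -
        ((zonalKernel m x y : ℂ) - familyKernel Y x y) * conj (familyKernel Y x y) := by
    intro x
    push_cast
    rw [← Complex.mul_conj']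
    simp only [map_sub, map_mul, Complex.conj_conj, Complex.conj_ofReal]
    ring
  have h_integral : ((∫ x, ‖(zonalKernel m x y : ℂ) - familyKernel Y x y‖ ^ 2
      ∂(sphereMeasure 3) : ℝ) : ℂ) = familyKernel Y y y - (2 * m + 1) := by
    rw [← integral_complex_ofReal]
    simp_rw [h_expand]
    rw [integral_sub, integral_sub, integral_complex_ofReal, integral_zonalKernel_mul_self,
      if_pos rfl, integral_conj, hY.integral_mul_conj_familyKernel hW, Complex.conj_ofReal,
      hY.integral_mul_conj_familyKernel hD, zonalKernel_self]
    · push_cast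
      ring
    all_goals exact integrable_of_continuous (by fun_prop)
  simpa using congrArg Complex.re h_integral

theorem familyKernel_diag_re (hY : IsSphericalHarmonicBasis 3 m Y) (y : S2) :
    (familyKernel Y y y).re = 2 * m + 1 := by
  have hYc := hY.continuous
  have hc : Continuous fun y => familyKernel Y y y := by
    unfold familyKernel
    fun_prop
  refine sub_eq_zero.mp (congrFun (eq_zero_of_integral_nonpos (μ := sphereMeasure 3)
    (f := fun y => (familyKernel Y y y).re - (2 * m + 1)) (by fun_prop) (fun y => ?_) ?_) y)
  · simp only [Pi.zero_apply]
    rw [← hY.integral_norm_zonalKernel_sub_familyKernel_sq y]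
    exact integral_nonneg fun x => by positivity
  · have h_card : (Fintype.card ι : ℝ) ≤ 2 * m + 1 := by
      exact_mod_cast hY.card_eq_finrank.trans_le (finrank_sphericalHarmonics_le m)
    have h_re := (integral_re (𝕜 := ℂ) (integrable_of_continuous (μ := sphereMeasure 3) hc)).trans
      (congrArg Complex.re hY.integral_familyKernel_diag)
    rw [integral_sub (integrable_of_continuous (by fun_prop)) (integrable_const _)]
    simp only [RCLike.re_to_complex, Complex.natCast_re] at h_re
    simpa only [h_re, integral_const, probReal_univ, one_smul, sub_nonpos]

/-- The addition theorem for spherical harmonics. -/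
theorem familyKernel_eq_zonalKernel (hY : IsSphericalHarmonicBasis 3 m Y) (x y : S2) :
    familyKernel Y x y = zonalKernel m x y := by
  have hDc := continuous_of_mem_sphericalHarmonics
    (Submodule.sub_mem _ (zonalKernel_mem m y) (hY.familyKernel_mem y))
  have h_zero := eq_zero_of_integral_nonpos (μ := sphereMeasure 3)
    (f := fun x => ‖(zonalKernel m x y : ℂ) - familyKernel Y x y‖ ^ 2) (hDc.norm.pow 2)
    (fun x => by positivity)
    (by rw [hY.integral_norm_zonalKernel_sub_familyKernel_sq, hY.familyKernel_diag_re, sub_self])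
  have hx := congrFun h_zero x
  rw [Pi.zero_apply, sq_eq_zero_iff, norm_eq_zero, sub_eq_zero] at hx
  exact hx.symm

end FamilyKernel

theorem integral_mul_conj_eq_zero {m k : ℕ} {ι κ : Type*} [Finite ι] [Finite κ]
    {Y : ι → S2 → ℂ} {Z : κ → S2 → ℂ} (hY : IsSphericalHarmonicBasis 3 m Y)
    (hZ : IsSphericalHarmonicBasis 3 k Z) (hmk : m ≠ k) (l : ι) (l' : κ) :
    ∫ x, Y l x * conj (Z l' x) ∂(sphereMeasure 3) = 0 := by
  cases nonempty_fintype ι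
  cases nonempty_fintype κ
  refine integral_mul_conj_eq_zero_of_forall_integral_familyKernel_eq_zero hY.continuous
    hZ.continuous (fun y => ?_) l l'
  simp only [hY.familyKernel_eq_zonalKernel, hZ.familyKernel_eq_zonalKernel, Complex.conj_ofReal,
    ← Complex.ofReal_mul]
  rw [integral_complex_ofReal, integral_zonalKernel_mul_self, if_neg hmk, Complex.ofReal_zero]

end IsSphericalHarmonicBasis

theorem integral_zonalKernel_mul_zonalKernel (m k : ℕ) (x y : S2) :
    ∫ ω, zonalKernel m ω x * zonalKernel k ω y ∂(sphereMeasure 3) =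
      if m = k then zonalKernel m x y else 0 := by
  obtain ⟨_, Y, hY⟩ := exists_isSphericalHarmonicBasis (d := 3) m
  obtain ⟨_, Z, hZ⟩ := exists_isSphericalHarmonicBasis (d := 3) k
  have h_complex : ((∫ ω, zonalKernel m ω x * zonalKernel k ω y ∂(sphereMeasure 3) : ℝ) : ℂ) =
      ∫ ω, familyKernel Y ω x * conj (familyKernel Z ω y) ∂(sphereMeasure 3) := by
    simp only [hY.familyKernel_eq_zonalKernel, hZ.familyKernel_eq_zonalKernel, Complex.conj_ofReal,
      ← Complex.ofReal_mul, integral_complex_ofReal]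
  rw [← Complex.ofReal_inj, h_complex]
  split_ifs with hmk
  · subst hmk
    have h_eq : ∀ ω, familyKernel Z ω y = familyKernel Y ω y := fun ω => by
      rw [hZ.familyKernel_eq_zonalKernel, hY.familyKernel_eq_zonalKernel]
    simp_rw [h_eq]
    rw [hY.integral_mul_conj_familyKernel (hY.familyKernel_mem x), hY.familyKernel_eq_zonalKernel,
      zonalKernel_comm]
  · rw [integral_familyKernel_mul_conj hY.continuous hZ.continuous]
    simp only [hY.integral_mul_conj_eq_zero hZ hmk, zero_mul, Finset.sum_const_zero,
      Complex.ofReal_zero]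

theorem integral_legendre_inner_mul_legendre_inner (m k : ℕ) (x y : S2) :
    ∫ ω : S2, (legendre m).eval (inner ℝ (ω : E3) (x : E3)) *
      (legendre k).eval (inner ℝ (ω : E3) (y : E3)) ∂(sphereMeasure 3) =
      if m = k then (legendre m).eval (inner ℝ (x : E3) (y : E3)) / (2 * m + 1) else 0 := by
  have h := integral_zonalKernel_mul_zonalKernel m k x y
  simp only [zonalKernel, mul_mul_mul_comm (2 * (m : ℝ) + 1), integral_const_mul] at h
  have hm : (2 * m + 1 : ℝ) ≠ 0 := by positivity
  have hk : (2 * k + 1 : ℝ) ≠ 0 := by positivity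
  refine mul_left_cancel₀ (mul_ne_zero hm hk) ?_
  rw [h]
  split_ifs with hmk
  · subst hmk
    field_simp
  · rw [mul_zero]

end Addition

section LegendreBasis

open Set

theorem memLp_eval (p : Polynomial ℝ) : MemLp (fun t => p.eval t) 2 uniformMeasure := by
  obtain ⟨C, hC⟩ := isCompact_Icc.exists_bound_of_continuousOn
    (p.continuous.continuousOn (s := Icc (-1 : ℝ) 1))
  exact MemLp.of_bound p.continuous.aestronglyMeasurable C
    (ae_uniformMeasure_mem.mono fun t ht => hC t ht)

/-- A polynomial as an element of `L²([-1, 1])`. -/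
def polyL2 : Polynomial ℝ →ₗ[ℝ] Lp ℝ 2 uniformMeasure where
  toFun p := (memLp_eval p).toLp _
  map_add' p q := by
    simp only [← MemLp.toLp_add, Polynomial.eval_add]
    rfl
  map_smul' c p := by
    simp only [RingHom.id_apply, ← MemLp.toLp_const_smul, Polynomial.eval_smul]
    rfl

theorem coeFn_polyL2 (p : Polynomial ℝ) : polyL2 p =ᵐ[uniformMeasure] fun t => p.eval t :=
  (memLp_eval p).coeFn_toLp

theorem inner_polyL2 (p q : Polynomial ℝ) :
    inner ℝ (polyL2 p) (polyL2 q) = ∫ t, p.eval t * q.eval t ∂uniformMeasure := by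
  rw [L2.inner_def]
  refine integral_congr_ae ?_
  filter_upwards [coeFn_polyL2 p, coeFn_polyL2 q] with t hp hq
  rw [hp, hq, Real.inner_apply]

/-- The normalized Legendre polynomials in `L²([-1, 1])`. -/
def legendreL2 (n : ℕ) : Lp ℝ 2 uniformMeasure :=
  √(2 * n + 1) • polyL2 (legendre n)

theorem orthonormal_legendreL2 : Orthonormal ℝ legendreL2 := by
  rw [orthonormal_iff_ite]
  intro n k
  rw [legendreL2, legendreL2, real_inner_smul_left, real_inner_smul_right, inner_polyL2,
    integral_uniformMeasure]
  split_ifs with hnk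
  · subst hnk
    simp only [← sq]
    rw [integral_legendre_sq, ← mul_assoc, Real.mul_self_sqrt (by positivity), smul_eq_mul]
    field_simp
  · rw [integral_legendre_mul_legendre_of_ne hnk, smul_zero, mul_zero, mul_zero]

theorem polyL2_mem_span (p : Polynomial ℝ) :
    polyL2 p ∈ Submodule.span ℝ (range legendreL2) := by
  have hp : polyL2 p ∈ (Submodule.span ℝ (range legendre)).map polyL2 := by
    rw [span_range_legendre]
    exact Submodule.mem_map_of_mem Submodule.mem_top
  rw [Submodule.map_span] at hp
  refine Submodule.span_le.mpr ?_ hp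
  rintro _ ⟨_, ⟨n, rfl⟩, rfl⟩
  have h_sqrt : √(2 * n + 1 : ℝ) ≠ 0 := by positivity
  exact (Submodule.smul_mem_iff _ h_sqrt).mp (Submodule.subset_span ⟨n, rfl⟩)

theorem norm_toLp_sub_polyL2_le {f : BoundedContinuousFunction ℝ ℝ} {p : Polynomial ℝ} {ε : ℝ}
    (hε : 0 ≤ ε) (h : ∀ t ∈ Icc (-1 : ℝ) 1, |p.eval t - f t| ≤ ε) :
    ‖BoundedContinuousFunction.toLp 2 uniformMeasure ℝ f - polyL2 p‖ ≤ ε := by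
  have h_ae : ∀ᵐ t ∂uniformMeasure,
      ‖(BoundedContinuousFunction.toLp 2 uniformMeasure ℝ f - polyL2 p :
        Lp ℝ 2 uniformMeasure) t‖ ≤ ε := by
    filter_upwards [Lp.coeFn_sub (BoundedContinuousFunction.toLp 2 uniformMeasure ℝ f) (polyL2 p),
      BoundedContinuousFunction.coeFn_toLp 2 uniformMeasure ℝ f, coeFn_polyL2 p,
      ae_uniformMeasure_mem] with t h_sub hf hp ht
    rw [h_sub, Pi.sub_apply, hf, hp, Real.norm_eq_abs, abs_sub_comm]
    exact h t ht
  simpa [measureUnivNNReal] using Lp.norm_le_of_ae_bound hε h_ae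

theorem topologicalClosure_span_legendreL2 :
    ⊤ ≤ (Submodule.span ℝ (range legendreL2)).topologicalClosure := by
  intro g _
  refine closure_minimal ?_ (Submodule.isClosed_topologicalClosure _)
    (BoundedContinuousFunction.toLp_denseRange ℝ uniformMeasure (p := 2) ℝ ENNReal.ofNat_ne_top g)
  rintro _ ⟨f, rfl⟩
  refine Metric.mem_closure_iff.mpr fun ε hε => ?_
  obtain ⟨p, hp⟩ := exists_polynomial_near_of_continuousOn (-1) 1 f f.continuous.continuousOn
    (ε / 2) (by positivity)
  refine ⟨polyL2 p, polyL2_mem_span p, ?_⟩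
  rw [dist_eq_norm]
  exact (norm_toLp_sub_polyL2_le (by positivity) fun t ht => (hp t ht).le).trans_lt
    (half_lt_self hε)

/-- The normalized Legendre polynomials as a Hilbert basis of `L²([-1, 1])`. -/
def legendreBasis : HilbertBasis ℕ ℝ (Lp ℝ 2 uniformMeasure) :=
  HilbertBasis.mk orthonormal_legendreL2 topologicalClosure_span_legendreL2

theorem legendreBasis_apply (n : ℕ) : legendreBasis n = legendreL2 n := by
  rw [legendreBasis, HilbertBasis.coe_mk]

end LegendreBasis

section FunkHecke

/-- The isometry `g ↦ g(⟨·, x⟩)`. -/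
def zonal (x : S2) : Lp ℝ 2 uniformMeasure →ₗᵢ[ℝ] Lp ℝ 2 (sphereMeasure 3) :=
  Lp.compMeasurePreservingₗᵢ ℝ _ (measurePreserving_inner x)

theorem coeFn_zonal (x : S2) {g : Lp ℝ 2 uniformMeasure} {f : ℝ → ℝ}
    (hg : g =ᵐ[uniformMeasure] f) :
    zonal x g =ᵐ[sphereMeasure 3] fun ω => f (inner ℝ (ω : E3) (x : E3)) :=
  (Lp.coeFn_compMeasurePreserving g (measurePreserving_inner x)).trans
    ((measurePreserving_inner x).quasiMeasurePreserving.ae_eq_comp hg)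

theorem inner_zonal {x y : S2} {g h : Lp ℝ 2 uniformMeasure} {f k : ℝ → ℝ}
    (hg : g =ᵐ[uniformMeasure] f) (hh : h =ᵐ[uniformMeasure] k) :
    inner ℝ (zonal x g) (zonal y h) = ∫ ω : S2, f (inner ℝ (ω : E3) (x : E3)) *
      k (inner ℝ (ω : E3) (y : E3)) ∂(sphereMeasure 3) := by
  rw [L2.inner_def]
  refine integral_congr_ae ?_
  filter_upwards [coeFn_zonal x hg, coeFn_zonal y hh] with ω hx hy
  rw [hx, hy, Real.inner_apply]

theorem inner_zonal_legendreL2 (x y : S2) (m k : ℕ) :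
    inner ℝ (zonal x (legendreL2 m)) (zonal y (legendreL2 k)) =
      if m = k then (legendre m).eval (inner ℝ (x : E3) (y : E3)) else 0 := by
  rw [legendreL2, legendreL2, map_smul, map_smul, real_inner_smul_left, real_inner_smul_right,
    inner_zonal (coeFn_polyL2 _) (coeFn_polyL2 _), integral_legendre_inner_mul_legendre_inner]
  split_ifs with hmk
  · subst hmk
    rw [← mul_assoc, Real.mul_self_sqrt (by positivity)]
    field_simp
  · rw [mul_zero, mul_zero]

/-- The Funk–Hecke formula. -/
theorem adjoint_zonal_legendreL2 (x y : S2) (k : ℕ) :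
    ContinuousLinearMap.adjoint (zonal x).toContinuousLinearMap (zonal y (legendreL2 k)) =
      (legendre k).eval (inner ℝ (x : E3) (y : E3)) • legendreL2 k := by
  refine legendreBasis.repr.injective (lp.ext (funext fun m => ?_))
  rw [HilbertBasis.repr_apply_apply, HilbertBasis.repr_apply_apply, legendreBasis_apply,
    ContinuousLinearMap.adjoint_inner_right, real_inner_smul_right,
    orthonormal_iff_ite.mp orthonormal_legendreL2, LinearIsometry.coe_toContinuousLinearMap,
    inner_zonal_legendreL2, mul_ite, mul_one, mul_zero]
  split_ifs with hmk
  · rw [hmk]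
  · rfl

theorem hasSum_inner_zonal (x y : S2) (g h : Lp ℝ 2 uniformMeasure) :
    HasSum (fun m => inner ℝ (legendreL2 m) g * inner ℝ (legendreL2 m) h *
      (legendre m).eval (inner ℝ (x : E3) (y : E3))) (inner ℝ (zonal x g) (zonal y h)) := by
  have h_term : ∀ m, inner ℝ (zonal x g) (zonal y (legendreL2 m)) =
      inner ℝ (legendreL2 m) g * (legendre m).eval (inner ℝ (x : E3) (y : E3)) := by
    intro m
    rw [← LinearIsometry.coe_toContinuousLinearMap (zonal x),
      ← ContinuousLinearMap.adjoint_inner_right, adjoint_zonal_legendreL2, real_inner_smul_right,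
      real_inner_comm g, mul_comm]
  refine ((legendreBasis.hasSum_repr h).mapL
    ((innerSL ℝ (zonal x g)).comp (zonal y).toContinuousLinearMap)).congr_fun fun m => ?_
  simp only [map_smul, HilbertBasis.repr_apply_apply, legendreBasis_apply, smul_eq_mul,
    ContinuousLinearMap.comp_apply, LinearIsometry.coe_toContinuousLinearMap, innerSL_apply_apply,
    h_term]
  ring

end FunkHecke

section Cap

open Set

/-- The Legendre coefficient `½ ∫_c^1 P_m` of the indicator of `[c, ∞)` on `[-1, 1]`; the
endpoint is clamped so that this holds for every real `c`. -/
def capCoeff (m : ℕ) (c : ℝ) : ℝ :=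
  2⁻¹ * ∫ t in (max (-1) (min 1 c))..1, (legendre m).eval t

/-- The normalized area of the intersection of two congruent spherical caps. -/
def capOverlap (c : ℝ) (x y : S2) : ℝ :=
  (sphereMeasure 3).real {ω | c ≤ inner ℝ (ω : E3) (x : E3) ∧ c ≤ inner ℝ (ω : E3) (y : E3)}

theorem capCoeff_of_one_le (m : ℕ) {c : ℝ} (hc : 1 ≤ c) : capCoeff m c = 0 := by
  rw [capCoeff, min_eq_left hc, max_eq_right (by norm_num), intervalIntegral.integral_same,
    mul_zero]

theorem capCoeff_of_mem (m : ℕ) {c : ℝ} (hc : c ∈ Icc (-1 : ℝ) 1) :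
    capCoeff m c = 2⁻¹ * ∫ t in c..1, (legendre m).eval t := by
  rw [capCoeff, min_eq_right hc.2, max_eq_right hc.1]

theorem capCoeff_eq_legendrePrimitive {m : ℕ} (hm : 1 ≤ m) {c : ℝ} (hc : c ∈ Icc (-1 : ℝ) 1) :
    capCoeff m c = (legendrePrimitive m).eval c / (2 * (m * (m + 1))) := by
  rw [capCoeff_of_mem m hc, integral_eval_legendre hm, inv_mul_eq_div, div_div, mul_comm (2 : ℝ)]

theorem capCoeff_zero {c : ℝ} (hc : c ∈ Icc (-1 : ℝ) 1) : capCoeff 0 c = (1 - c) / 2 := by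
  rw [capCoeff_of_mem 0 hc]
  simp only [legendre_zero, Polynomial.eval_one, intervalIntegral.integral_const, smul_eq_mul,
    mul_one, inv_mul_eq_div]

theorem capCoeff_clamp (m : ℕ) (c : ℝ) : capCoeff m (max (-1) (min 1 c)) = capCoeff m c :=
  capCoeff_of_mem m ⟨le_max_left _ _, max_le (by norm_num) (min_le_left _ _)⟩

theorem continuous_capCoeff (m : ℕ) : Continuous (capCoeff m) := by
  have h_primitive : Continuous fun d : ℝ => ∫ t in d..1, (legendre m).eval t := by
    simp_rw [intervalIntegral.integral_symm (1 : ℝ)]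
    exact (intervalIntegral.continuous_primitive
      (fun a b => (legendre m).continuous.intervalIntegrable a b) 1).neg
  exact continuous_const.mul (h_primitive.comp (by fun_prop))

theorem setIntegral_Ici_uniformMeasure (m : ℕ) (c : ℝ) :
    ∫ t in Ici c, (legendre m).eval t ∂uniformMeasure = capCoeff m c := by
  rw [uniformMeasure, Measure.restrict_smul, integral_smul_measure,
    Measure.restrict_restrict measurableSet_Ici, ← Ici_inter_Iic, ← inter_assoc, Ici_inter_Ici,
    Ici_inter_Iic, max_comm]
  rcases le_total c 1 with hc | hc
  · rw [capCoeff, min_eq_right hc, intervalIntegral.integral_of_le (max_le (by norm_num) hc),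
      ← integral_Icc_eq_integral_Ioc]
    simp
  · rw [capCoeff_of_one_le m hc, Measure.restrict_eq_zero.mpr, integral_zero_measure, smul_zero]
    simp [hc]

theorem inner_legendreL2_indicatorConstLp (m : ℕ) (c : ℝ) :
    inner ℝ (legendreL2 m) (indicatorConstLp 2 (measurableSet_Ici (a := c))
      (measure_ne_top uniformMeasure _) (1 : ℝ)) = √(2 * m + 1) * capCoeff m c := by
  rw [legendreL2, real_inner_smul_left, real_inner_comm, L2.inner_indicatorConstLp_one,
    ← setIntegral_Ici_uniformMeasure,
    integral_congr_ae (ae_restrict_of_ae (coeFn_polyL2 (legendre m)))]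

theorem inner_zonal_indicatorConstLp (c : ℝ) (x y : S2) :
    inner ℝ (zonal x (indicatorConstLp 2 (measurableSet_Ici (a := c)) (measure_ne_top _ _) 1))
      (zonal y (indicatorConstLp 2 (measurableSet_Ici (a := c)) (measure_ne_top _ _) 1)) =
      capOverlap c x y := by
  have h_meas : MeasurableSet {ω : S2 | c ≤ inner ℝ (ω : E3) (x : E3) ∧
      c ≤ inner ℝ (ω : E3) (y : E3)} := by measurability
  rw [inner_zonal indicatorConstLp_coeFn indicatorConstLp_coeFn, capOverlap,
    ← integral_indicator_one h_meas]
  refine integral_congr_ae (ae_of_all _ fun ω => ?_)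
  by_cases hx : c ≤ inner ℝ (ω : E3) (x : E3) <;> by_cases hy : c ≤ inner ℝ (ω : E3) (y : E3) <;>
    simp [indicator, hx, hy]

theorem hasSum_capOverlap (c : ℝ) (x y : S2) :
    HasSum (fun m => capCoeff m c ^ 2 * zonalKernel m x y) (capOverlap c x y) := by
  have h := hasSum_inner_zonal x y
    (indicatorConstLp 2 (measurableSet_Ici (a := c)) (measure_ne_top _ _) 1)
    (indicatorConstLp 2 (measurableSet_Ici (a := c)) (measure_ne_top _ _) 1)
  simp only [inner_zonal_indicatorConstLp, inner_legendreL2_indicatorConstLp] at h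
  refine h.congr_fun fun m => ?_
  rw [mul_mul_mul_comm, Real.mul_self_sqrt (by positivity), zonalKernel]
  ring

theorem capCoeff_sq_le (m : ℕ) (c : ℝ) : capCoeff m c ^ 2 ≤ 2 / (m + 1 : ℝ) ^ 3 := by
  rw [← capCoeff_clamp]
  set d := max (-1) (min 1 c)
  have hd : d ∈ Icc (-1 : ℝ) 1 := ⟨le_max_left _ _, max_le (by norm_num) (min_le_left _ _)⟩
  rcases Nat.eq_zero_or_pos m with rfl | hm
  · rw [capCoeff_zero hd, Nat.cast_zero, zero_add, one_pow, div_one]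
    nlinarith [hd.1, hd.2]
  · have hm' : (1 : ℝ) ≤ m := by exact_mod_cast hm
    rw [capCoeff_eq_legendrePrimitive hm hd, div_pow]
    calc (legendrePrimitive m).eval d ^ 2 / (2 * (m * (m + 1))) ^ 2
        ≤ m / (2 * (m * (m + 1))) ^ 2 := by
          gcongr
          exact eval_legendrePrimitive_sq_le _ hd
      _ = 1 / (4 * m * (m + 1) ^ 2 : ℝ) := by field_simp; norm_num
      _ ≤ 2 / (m + 1 : ℝ) ^ 3 := by
          rw [div_le_div_iff₀ (by positivity) (by positivity)]
          nlinarith [pow_pos (by linarith : (0 : ℝ) < m + 1) 2]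

theorem integral_capCoeff_zero_sq {a : ℝ} (ha : -1 ≤ a) (ha1 : a ≤ 1) :
    ∫ s in a..1, capCoeff 0 s ^ 2 = (1 - a) ^ 3 / 12 := by
  have h_eq : ∀ s ∈ uIcc a 1, capCoeff 0 s ^ 2 = 4⁻¹ * (1 - s) ^ 2 := by
    intro s hs
    rw [uIcc_of_le ha1] at hs
    rw [capCoeff_zero ⟨ha.trans hs.1, hs.2⟩]
    ring
  rw [intervalIntegral.integral_congr h_eq, intervalIntegral.integral_const_mul,
    intervalIntegral.integral_comp_sub_left (fun s => s ^ 2), integral_pow]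
  ring

theorem le_integral_capCoeff_sq (m : ℕ) {a : ℝ} (ha : 0 ≤ a) (ha1 : a < 1) :
    (1 - a) ^ 4 / 240 / (m + 1 : ℝ) ^ 3 ≤ ∫ s in a..1, capCoeff m s ^ 2 := by
  rcases Nat.eq_zero_or_pos m with rfl | hm
  · rw [integral_capCoeff_zero_sq (by linarith) ha1.le, Nat.cast_zero, zero_add, one_pow, div_one]
    nlinarith [pow_pos (sub_pos.mpr ha1) 3]
  · have h_eq : ∀ s ∈ uIcc a 1, capCoeff m s ^ 2 =
        ((2 * (m * (m + 1))) ^ 2 : ℝ)⁻¹ * (legendrePrimitive m).eval s ^ 2 := by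
      intro s hs
      rw [uIcc_of_le ha1.le] at hs
      rw [capCoeff_eq_legendrePrimitive hm ⟨by linarith [hs.1], hs.2⟩, div_pow, inv_mul_eq_div]
    rw [intervalIntegral.integral_congr h_eq, intervalIntegral.integral_const_mul]
    calc (1 - a) ^ 4 / 240 / (m + 1 : ℝ) ^ 3
        ≤ (1 - a) ^ 4 / 240 / (m ^ 2 * (m + 1 : ℝ)) := by
          gcongr
          nlinarith
      _ = ((2 * (m * (m + 1))) ^ 2 : ℝ)⁻¹ * ((1 - a) ^ 4 / 60 * (m + 1)) := by
          field_simp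
          ring
      _ ≤ _ := by
          gcongr
          exact le_integral_legendrePrimitive_sq hm ha ha1

end Cap

section CapHeight

open Set

/-- The ball of radius `R` around `ρω`, `ω ∈ S²`, meets the sphere in the cap
`⟨·, ω⟩ ≥ capHeight R ρ`. -/
def capHeight (R ρ : ℝ) : ℝ := (1 + ρ ^ 2 - R ^ 2) / (2 * ρ)

theorem dist_smul_le_iff {E : Type*} [NormedAddCommGroup E] [InnerProductSpace ℝ E] {x ω : E}
    (hx : ‖x‖ = 1) (hω : ‖ω‖ = 1) {R ρ : ℝ} (hR : 0 ≤ R) (hρ : 0 < ρ) :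
    dist (ρ • ω) x ≤ R ↔ capHeight R ρ ≤ inner ℝ ω x := by
  rw [dist_comm, dist_eq_norm, ← sq_le_sq₀ (norm_nonneg _) hR, norm_sub_sq_real, inner_smul_right,
    norm_smul, hx, hω, Real.norm_of_nonneg hρ.le, capHeight, div_le_iff₀ (by positivity),
    real_inner_comm]
  constructor <;> intro h <;> nlinarith

theorem one_le_capHeight {R ρ : ℝ} (hR : 0 ≤ R) (hρ : 1 + R < ρ) : 1 ≤ capHeight R ρ := by
  rw [capHeight, le_div_iff₀ (by linarith)]
  nlinarith

theorem capHeight_nonneg {R ρ : ℝ} (hR : 0 ≤ R) (hρ : R ≤ ρ) : 0 ≤ capHeight R ρ :=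
  div_nonneg (by nlinarith) (by linarith)

theorem capHeight_lt_one {R ρ : ℝ} (hρ : 0 < ρ) (h : |ρ - 1| < R) : capHeight R ρ < 1 := by
  rw [capHeight, div_lt_one (by linarith)]
  nlinarith [sq_lt_sq.mpr (h.trans_le (le_abs_self R))]

theorem capHeight_one_add {R : ℝ} (hR : 0 ≤ R) : capHeight R (1 + R) = 1 := by
  rw [capHeight]
  field_simp
  ring

theorem measurable_capHeight (R : ℝ) : Measurable (capHeight R) := by
  unfold capHeight
  fun_prop

theorem hasDerivAt_capHeight (R : ℝ) {ρ : ℝ} (hρ : ρ ≠ 0) :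
    HasDerivAt (capHeight R) ((ρ ^ 2 - 1 + R ^ 2) / (2 * ρ ^ 2)) ρ := by
  have h_num : HasDerivAt (fun ρ : ℝ => 1 + ρ ^ 2 - R ^ 2) (2 * ρ) ρ := by
    simpa using ((hasDerivAt_pow 2 ρ).const_add 1).sub_const (R ^ 2)
  have h_den : HasDerivAt (fun ρ : ℝ => 2 * ρ) 2 ρ := by
    simpa using (hasDerivAt_id ρ).const_mul 2
  refine (h_num.div h_den (by positivity)).congr_deriv ?_
  field_simp
  ring

/-- The substitution `s = capHeight R ρ` has derivative at most `ρ²` where `1 ≤ ρ` and `R ≤ ρ`. -/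
theorem integral_capHeight_le_setIntegral {R a b : ℝ} (hR : 0 ≤ R) (ha : 1 ≤ a) (hRa : R ≤ a)
    (hab : a ≤ b) {f : ℝ → ℝ} (hf : Continuous f) (hf0 : 0 ≤ f)
    (hf_int : IntegrableOn (fun ρ => ρ ^ 2 * f (capHeight R ρ)) (Ioi 0)) :
    ∫ s in capHeight R a..capHeight R b, f s ≤ ∫ ρ in Ioi 0, ρ ^ 2 * f (capHeight R ρ) := by
  have h_one_le : ∀ ρ ∈ uIcc a b, 1 ≤ ρ := fun ρ hρ => ha.trans (uIcc_of_le hab ▸ hρ).1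
  have h_deriv : ∀ ρ ∈ uIcc a b,
      HasDerivAt (capHeight R) ((ρ ^ 2 - 1 + R ^ 2) / (2 * ρ ^ 2)) ρ :=
    fun ρ hρ => hasDerivAt_capHeight R (by linarith [h_one_le ρ hρ])
  have h_cont : ContinuousOn (fun ρ : ℝ => (ρ ^ 2 - 1 + R ^ 2) / (2 * ρ ^ 2)) (uIcc a b) :=
    ContinuousOn.div (by fun_prop) (by fun_prop) fun ρ hρ => by
      have := h_one_le ρ hρ
      positivity
  have h_cap : ContinuousOn (capHeight R) (uIcc a b) := fun ρ hρ =>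
    (h_deriv ρ hρ).continuousAt.continuousWithinAt
  have h_subset : Ioc a b ⊆ Ioi 0 := fun ρ hρ => one_pos.trans_le (ha.trans hρ.1.le)
  rw [← intervalIntegral.integral_comp_mul_deriv h_deriv h_cont hf]
  calc ∫ ρ in a..b, (f ∘ capHeight R) ρ * ((ρ ^ 2 - 1 + R ^ 2) / (2 * ρ ^ 2))
      ≤ ∫ ρ in a..b, ρ ^ 2 * f (capHeight R ρ) := by
        refine intervalIntegral.integral_mono_on (μ := volume) hab
          ((hf.comp_continuousOn h_cap).mul h_cont).intervalIntegrable
          ((intervalIntegrable_iff_integrableOn_Ioc_of_le hab).mpr (hf_int.mono_set h_subset))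
          fun ρ hρ => ?_
        have hρ1 : 1 ≤ ρ := ha.trans hρ.1
        rw [mul_comm]
        refine mul_le_mul_of_nonneg_right ?_ (hf0 _)
        rw [div_le_iff₀ (by positivity)]
        nlinarith [hRa.trans hρ.1, sq_nonneg (ρ ^ 2 - 1)]
    _ = ∫ ρ in Ioc a b, ρ ^ 2 * f (capHeight R ρ) := intervalIntegral.integral_of_le hab
    _ ≤ ∫ ρ in Ioi 0, ρ ^ 2 * f (capHeight R ρ) :=
        setIntegral_mono_set hf_int (ae_of_all _ fun ρ => mul_nonneg (sq_nonneg ρ) (hf0 _))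
          h_subset.eventuallyLE

end CapHeight

section KernelExpansion

open Set

theorem dirac_real_closedBall {X : Type*} [PseudoMetricSpace X] [MeasurableSpace X]
    [OpensMeasurableSpace X] (x z : X) (R : ℝ) :
    (Measure.dirac x).real (closedBall z R) = (closedBall x R).indicator 1 z := by
  rw [measureReal_def, Measure.dirac_apply' _ measurableSet_closedBall]
  by_cases h : dist x z ≤ R <;> simp [indicator, mem_closedBall, dist_comm z x, h]

/-- The factor relating `K_{3,r}` to integrals over the radius. -/
def kernelConst (r : ℝ) : ℝ :=
  (volume.real (closedBall (0 : E3) (r / 2)))⁻¹ * sphereArea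

theorem kernelConst_pos {r : ℝ} (hr : 0 < r) : 0 < kernelConst r := by
  have h_vol : 0 < volume.real (closedBall (0 : E3) (r / 2)) :=
    ENNReal.toReal_pos (measure_closedBall_pos _ _ (by positivity)).ne' measure_closedBall_lt_top.ne
  exact mul_pos (inv_pos.mpr h_vol) sphereArea_pos

theorem integral_dirac_mul_dirac_sphere {R ρ : ℝ} (hR : 0 ≤ R) (hρ : 0 < ρ) (x y : S2) :
    ∫ ω : S2, (Measure.dirac (x : E3)).real (closedBall (ρ • (ω : E3)) R) *
      (Measure.dirac (y : E3)).real (closedBall (ρ • (ω : E3)) R) ∂(sphereMeasure 3) =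
      capOverlap (capHeight R ρ) x y := by
  have h_meas : MeasurableSet {ω : S2 | capHeight R ρ ≤ inner ℝ (ω : E3) (x : E3) ∧
      capHeight R ρ ≤ inner ℝ (ω : E3) (y : E3)} := by measurability
  rw [capOverlap, ← integral_indicator_one h_meas]
  refine integral_congr_ae (ae_of_all _ fun ω => ?_)
  have h_iff (v : S2) := dist_smul_le_iff (mem_sphere_zero_iff_norm.mp v.2)
    (mem_sphere_zero_iff_norm.mp ω.2) hR hρ
  simp only [dirac_real_closedBall, indicator, mem_closedBall, h_iff, mem_ofPred_eq, Pi.one_apply,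
    ite_and, mul_ite, mul_one, mul_zero]
  split_ifs <;> rfl

theorem ballKernel_sphere {r : ℝ} (hr : 0 ≤ r) (x y : S2) :
    ballKernel 3 r x y = kernelConst r *
      ∫ ρ in Ioi (0 : ℝ), ρ ^ 2 * capOverlap (capHeight (r / 2) ρ) x y := by
  rw [ballKernel, integral_polar (integrable_dirac_mul_dirac 3 (r / 2) x y), kernelConst,
    smul_eq_mul, mul_assoc]
  congr 2
  refine setIntegral_congr_fun measurableSet_Ioi fun ρ hρ => ?_
  simp only [smul_eq_mul, integral_dirac_mul_dirac_sphere (by positivity : 0 ≤ r / 2) hρ]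

theorem sq_mul_capCoeff_sq_le {R ρ : ℝ} (hR : 0 ≤ R) (hρ : 0 < ρ) (m : ℕ) :
    ρ ^ 2 * capCoeff m (capHeight R ρ) ^ 2 ≤
      (Ioc 0 (1 + R)).indicator (fun _ => (1 + R) ^ 2 * (2 / (m + 1 : ℝ) ^ 3)) ρ := by
  rcases le_or_gt ρ (1 + R) with h | h
  · rw [indicator_of_mem (show ρ ∈ Ioc 0 (1 + R) from ⟨hρ, h⟩)]
    gcongr
    exact capCoeff_sq_le m _
  · rw [capCoeff_of_one_le m (one_le_capHeight hR h), zero_pow two_ne_zero, mul_zero]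
    exact indicator_nonneg (fun _ _ => by positivity) _

theorem integrable_indicator_Ioc_const (a b C : ℝ) :
    Integrable ((Ioc a b).indicator fun _ => C) :=
  (integrable_indicator_iff measurableSet_Ioc).mpr (integrableOn_const measure_Ioc_lt_top.ne)

theorem integrableOn_sq_mul_capCoeff_sq {R : ℝ} (hR : 0 ≤ R) (m : ℕ) :
    IntegrableOn (fun ρ => ρ ^ 2 * capCoeff m (capHeight R ρ) ^ 2) (Ioi 0) := by
  refine (integrable_indicator_Ioc_const 0 (1 + R)
    ((1 + R) ^ 2 * (2 / (m + 1 : ℝ) ^ 3))).integrableOn.mono' ?_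
    ((ae_restrict_mem measurableSet_Ioi).mono fun ρ hρ => ?_)
  · have h_cap := (continuous_capCoeff m).measurable.comp (measurable_capHeight R)
    exact ((measurable_id.pow_const 2).mul (h_cap.pow_const 2)).aestronglyMeasurable
  · rw [Real.norm_of_nonneg (by positivity)]
    exact sq_mul_capCoeff_sq_le hR hρ m

theorem integral_sq_mul_capCoeff_sq_le {R : ℝ} (hR : 0 ≤ R) (m : ℕ) :
    ∫ ρ in Ioi 0, ρ ^ 2 * capCoeff m (capHeight R ρ) ^ 2 ≤
      (1 + R) ^ 3 * (2 / (m + 1 : ℝ) ^ 3) := by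
  calc ∫ ρ in Ioi 0, ρ ^ 2 * capCoeff m (capHeight R ρ) ^ 2
      ≤ ∫ ρ in Ioi 0, (Ioc 0 (1 + R)).indicator
          (fun _ => (1 + R) ^ 2 * (2 / (m + 1 : ℝ) ^ 3)) ρ :=
        setIntegral_mono_on (integrableOn_sq_mul_capCoeff_sq hR m)
          (integrable_indicator_Ioc_const 0 (1 + R) _).integrableOn measurableSet_Ioi
          fun ρ hρ => sq_mul_capCoeff_sq_le hR hρ m
    _ = (1 + R) * ((1 + R) ^ 2 * (2 / (m + 1 : ℝ) ^ 3)) := by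
        rw [setIntegral_indicator measurableSet_Ioc,
          inter_eq_self_of_subset_right Ioc_subset_Ioi_self, setIntegral_const,
          Real.volume_real_Ioc_of_le (by positivity), sub_zero, smul_eq_mul]
    _ = (1 + R) ^ 3 * (2 / (m + 1 : ℝ) ^ 3) := by ring

/-- The coefficients of the expansion of `K_{3,r}` on the sphere in spherical harmonics. -/
def kernelCoeff (r : ℝ) (m : ℕ) : ℝ :=
  kernelConst r * ∫ ρ in Ioi (0 : ℝ), ρ ^ 2 * capCoeff m (capHeight (r / 2) ρ) ^ 2

theorem summable_inv_add_one_sq : Summable fun m : ℕ => 1 / (m + 1 : ℝ) ^ 2 := by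
  simpa using (summable_nat_add_iff 1).mpr (Real.summable_one_div_nat_pow (p := 2).mpr one_lt_two)

theorem summable_integral_norm_capCoeff_sq_mul_zonalKernel {R : ℝ} (hR : 0 ≤ R) (x y : S2) :
    Summable fun m => ∫ ρ in Ioi 0,
      ‖ρ ^ 2 * capCoeff m (capHeight R ρ) ^ 2 * zonalKernel m x y‖ := by
  refine Summable.of_nonneg_of_le (fun m => integral_nonneg fun ρ => norm_nonneg _) (fun m => ?_)
    (summable_inv_add_one_sq.mul_left ((1 + R) ^ 3 * 4))
  have h_norm : ∀ ρ, ‖ρ ^ 2 * capCoeff m (capHeight R ρ) ^ 2 * zonalKernel m x y‖ =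
      ρ ^ 2 * capCoeff m (capHeight R ρ) ^ 2 * |zonalKernel m x y| := fun ρ => by
    rw [norm_mul, Real.norm_of_nonneg (by positivity), Real.norm_eq_abs]
  simp_rw [h_norm]
  rw [integral_mul_const]
  calc (∫ ρ in Ioi 0, ρ ^ 2 * capCoeff m (capHeight R ρ) ^ 2) * |zonalKernel m x y|
      ≤ (1 + R) ^ 3 * (2 / (m + 1 : ℝ) ^ 3) * (2 * (m + 1)) := by
        gcongr
        · exact integral_sq_mul_capCoeff_sq_le hR m
        · linarith [abs_zonalKernel_le m x y]
    _ = (1 + R) ^ 3 * 4 * (1 / (m + 1 : ℝ) ^ 2) := by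
        field_simp
        ring

theorem hasSum_kernelCoeff_mul_zonalKernel {r : ℝ} (hr : 0 ≤ r) (x y : S2) :
    HasSum (fun m => kernelCoeff r m * zonalKernel m x y) (ballKernel 3 r x y) := by
  have hR : 0 ≤ r / 2 := by positivity
  have h_sum := (hasSum_integral_of_summable_integral_norm
    (fun m => (integrableOn_sq_mul_capCoeff_sq hR m).mul_const (zonalKernel m x y))
    (summable_integral_norm_capCoeff_sq_mul_zonalKernel hR x y)).mul_left (kernelConst r)
  have h_tsum : ∀ ρ, ∑' m, ρ ^ 2 * capCoeff m (capHeight (r / 2) ρ) ^ 2 * zonalKernel m x y =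
      ρ ^ 2 * capOverlap (capHeight (r / 2) ρ) x y := fun ρ => by
    simp only [mul_assoc]
    exact ((hasSum_capOverlap (capHeight (r / 2) ρ) x y).mul_left (ρ ^ 2)).tsum_eq
  simp only [h_tsum, ← ballKernel_sphere hr, integral_mul_const, ← mul_assoc] at h_sum
  exact h_sum

theorem kernelCoeff_le {r : ℝ} (hr : 0 < r) (m : ℕ) :
    kernelCoeff r m ≤ kernelConst r * (1 + r / 2) ^ 3 * 2 / (m + 1 : ℝ) ^ 3 := by
  calc kernelCoeff r m ≤ kernelConst r * ((1 + r / 2) ^ 3 * (2 / (m + 1 : ℝ) ^ 3)) :=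
        mul_le_mul_of_nonneg_left (integral_sq_mul_capCoeff_sq_le (by positivity) m)
          (kernelConst_pos hr).le
    _ = _ := by ring

theorem exists_le_kernelCoeff {r : ℝ} (hr : 0 < r) :
    ∃ δ : ℝ, 0 < δ ∧ ∀ m : ℕ, δ / (m + 1 : ℝ) ^ 3 ≤ kernelCoeff r m := by
  set R := r / 2
  have hR : 0 < R := by positivity
  set a := max 1 R
  have ha : 1 ≤ a := le_max_left _ _
  have hRa : R ≤ a := le_max_right _ _
  have hab : a < 1 + R := max_lt (by linarith) (by linarith)
  have h_nonneg := capHeight_nonneg hR.le hRa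
  have h_lt : capHeight R a < 1 :=
    capHeight_lt_one (by linarith) (abs_lt.mpr ⟨by linarith, by linarith⟩)
  refine ⟨kernelConst r * ((1 - capHeight R a) ^ 4 / 240), ?_, fun m => ?_⟩
  · exact mul_pos (kernelConst_pos hr) (by have := sub_pos.mpr h_lt; positivity)
  · rw [kernelCoeff, mul_div_assoc]
    refine mul_le_mul_of_nonneg_left ?_ (kernelConst_pos hr).le
    calc (1 - capHeight R a) ^ 4 / 240 / (m + 1 : ℝ) ^ 3
        ≤ ∫ s in capHeight R a..1, capCoeff m s ^ 2 := le_integral_capCoeff_sq m h_nonneg h_lt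
      _ = ∫ s in capHeight R a..capHeight R (1 + R), capCoeff m s ^ 2 := by
          rw [capHeight_one_add hR.le]
      _ ≤ ∫ ρ in Ioi 0, ρ ^ 2 * capCoeff m (capHeight R ρ) ^ 2 :=
          integral_capHeight_le_setIntegral hR.le ha hRa hab.le ((continuous_capCoeff m).pow 2)
            (fun s => sq_nonneg _) (integrableOn_sq_mul_capCoeff_sq hR.le m)

end KernelExpansion

section ReproducingKernels

variable {X : Type*}

/-- The quadratic form `∑ conj (w x) w y k x y` of a kernel on finitely supported vectors. -/
def quadForm (k : X → X → ℂ) (w : X →₀ ℂ) : ℂ :=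
  ∑ x ∈ w.support, ∑ y ∈ w.support, conj (w x) * w y * k x y

theorem norm_sq_linearCombination {F : Type*} [SeminormedAddCommGroup F] [InnerProductSpace ℂ F]
    (Φ : X → F) (w : X →₀ ℂ) :
    ((‖Finsupp.linearCombination ℂ Φ w‖ ^ 2 : ℝ) : ℂ) =
      quadForm (fun x y => inner ℂ (Φ x) (Φ y)) w := by
  have h_inner := inner_self_eq_norm_sq_to_K (𝕜 := ℂ) (Finsupp.linearCombination ℂ Φ w)
  rw [Complex.ofReal_pow]
  refine h_inner.symm.trans ?_
  rw [Finsupp.linearCombination_apply, Finsupp.sum, sum_inner, quadForm]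
  refine Finset.sum_congr rfl fun x _ => ?_
  rw [inner_sum]
  refine Finset.sum_congr rfl fun y _ => ?_
  rw [inner_smul_left, inner_smul_right, mul_assoc]

theorem posSemidef_kernelMatrix {k : X → X → ℂ} (h_conj : ∀ x y, conj (k y x) = k x y)
    (h_nonneg : ∀ w, 0 ≤ (quadForm k w).re) : (kernelMatrix k).PosSemidef := by
  have h_iff := (RKHS.posSemidef_tfae (K := kernelMatrix k)).out 0 2
  refine h_iff.mpr ⟨?_, fun w => ?_⟩
  · ext x y
    have h_id : star (ContinuousLinearMap.id ℂ ℂ) = ContinuousLinearMap.id ℂ ℂ :=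
      star_one (ℂ →L[ℂ] ℂ)
    simp [h_id, kernelMatrix, Matrix.conjTranspose_apply, h_conj]
  · refine (h_nonneg w).trans_eq ?_
    simp only [quadForm, Finsupp.sum, RCLike.re_to_complex]
    congr 1
    refine Finset.sum_congr rfl fun x _ => Finset.sum_congr rfl fun y _ => ?_
    simp [kernelMatrix, h_conj]
    ring

variable {H H' : Type*} [NormedAddCommGroup H] [InnerProductSpace ℂ H] [RKHS ℂ H X ℂ]
  [CompleteSpace H] [NormedAddCommGroup H'] [InnerProductSpace ℂ H'] [RKHS ℂ H' X ℂ]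
  [CompleteSpace H']

variable (H) in
/-- The element of a reproducing kernel Hilbert space of scalar functions which represents
evaluation at `x`. -/
def reproducer (x : X) : H := RKHS.kerFun H x 1

theorem inner_reproducer (x : X) (f : H) : inner ℂ (reproducer H x) f = f x := by
  simp [reproducer]

theorem inner_reproducer_reproducer {k : X → X → ℂ} (hk : RKHS.kernel H = kernelMatrix k)
    (x y : X) : inner ℂ (reproducer H x) (reproducer H y) = k x y := by
  rw [inner_reproducer, reproducer, RKHS.kerFun_apply, hk]
  simp [kernelMatrix]

theorem norm_sq_linearCombination_reproducer {k : X → X → ℂ}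
    (hk : RKHS.kernel H = kernelMatrix k) (w : X →₀ ℂ) :
    ‖Finsupp.linearCombination ℂ (reproducer H) w‖ ^ 2 = (quadForm k w).re := by
  rw [← Complex.ofReal_re (‖_‖ ^ 2), norm_sq_linearCombination]
  simp_rw [inner_reproducer_reproducer hk]

theorem denseRange_linearCombination_reproducer :
    DenseRange (Finsupp.linearCombination ℂ (reproducer H)) := by
  have h_top : (LinearMap.range (Finsupp.linearCombination ℂ (reproducer H))).topologicalClosure =
      ⊤ := by
    rw [Submodule.topologicalClosure_eq_top_iff, Submodule.eq_bot_iff]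
    intro f hf
    refine RKHS.ext fun x => ?_
    rw [← inner_reproducer, RKHS.coe_zero, Pi.zero_apply]
    exact hf _ ⟨Finsupp.single x 1, by simp⟩
  exact Submodule.dense_iff_topologicalClosure_eq_top.mpr h_top

theorem exists_clm_reproducer_eq {F : Type*} [NormedAddCommGroup F] [NormedSpace ℂ F]
    [CompleteSpace F] (Φ : X → F) {C : ℝ}
    (h : ∀ w : X →₀ ℂ, ‖Finsupp.linearCombination ℂ Φ w‖ ≤
      C * ‖Finsupp.linearCombination ℂ (reproducer H) w‖) :
    ∃ V : H →L[ℂ] F, ∀ x, V (reproducer H x) = Φ x := by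
  refine ⟨(Finsupp.linearCombination ℂ Φ).extendOfNorm
    (Finsupp.linearCombination ℂ (reproducer H)), fun x => ?_⟩
  simpa using LinearMap.extendOfNorm_eq denseRange_linearCombination_reproducer ⟨C, h⟩
    (Finsupp.single x 1)

/-- The inclusion is the adjoint of the operator which maps the reproducing elements of `H'` to
those of `H`. -/
theorem exists_clm_of_quadForm_le {k k' : X → X → ℂ} (hk : RKHS.kernel H = kernelMatrix k)
    (hk' : RKHS.kernel H' = kernelMatrix k') {C : ℝ} (hC : 0 ≤ C)
    (h : ∀ w, (quadForm k w).re ≤ C * (quadForm k' w).re) :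
    ∃ T : H →L[ℂ] H', ∀ f x, T f x = f x := by
  obtain ⟨V, hV⟩ := exists_clm_reproducer_eq (H := H') (reproducer H) (C := √C) fun w => by
    rw [← sq_le_sq₀ (norm_nonneg _) (by positivity), mul_pow, Real.sq_sqrt hC,
      norm_sq_linearCombination_reproducer hk, norm_sq_linearCombination_reproducer hk']
    exact h w
  refine ⟨ContinuousLinearMap.adjoint V, fun f x => ?_⟩
  rw [← inner_reproducer, ContinuousLinearMap.adjoint_inner_right, hV, inner_reproducer]

theorem exists_continuousLinearEquiv_of_quadForm_le {k k' : X → X → ℂ}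
    (hk : RKHS.kernel H = kernelMatrix k) (hk' : RKHS.kernel H' = kernelMatrix k') {C C' : ℝ}
    (hC : 0 ≤ C) (hC' : 0 ≤ C') (h : ∀ w, (quadForm k w).re ≤ C * (quadForm k' w).re)
    (h' : ∀ w, (quadForm k' w).re ≤ C' * (quadForm k w).re) :
    ∃ T : H ≃L[ℂ] H', ∀ f x, T f x = f x := by
  obtain ⟨T, hT⟩ := exists_clm_of_quadForm_le hk hk' hC h
  obtain ⟨S, hS⟩ := exists_clm_of_quadForm_le hk' hk hC' h'
  refine ⟨ContinuousLinearEquiv.equivOfInverse T S (fun f => ?_) (fun f => ?_), hT⟩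
  · exact RKHS.ext fun x => by rw [hS, hT]
  · exact RKHS.ext fun x => by rw [hT, hS]

/-- The adjoint of the operator which maps the reproducing elements to their features maps the
features to the reproducing elements. -/
theorem exists_clm_forall_apply_eq_inner {F : Type*} [NormedAddCommGroup F]
    [InnerProductSpace ℂ F] [CompleteSpace F] {k : X → X → ℂ}
    (hk : RKHS.kernel H = kernelMatrix k) (Φ : X → F) (hΦ : ∀ x y, inner ℂ (Φ x) (Φ y) = k x y) :
    ∃ V : H →L[ℂ] F, ∀ f x, f x = inner ℂ (Φ x) (V f) := by
  obtain ⟨V, hV⟩ := exists_clm_reproducer_eq (H := H) Φ (C := 1) fun w => by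
    rw [one_mul, ← sq_le_sq₀ (norm_nonneg _) (norm_nonneg _),
      norm_sq_linearCombination_reproducer hk, ← Complex.ofReal_re (‖_‖ ^ 2),
      norm_sq_linearCombination]
    simp_rw [hΦ, le_refl]
  refine ⟨V, fun f x => ?_⟩
  have h_adjoint : ContinuousLinearMap.adjoint V (Φ x) = reproducer H x := RKHS.ext fun y => by
    rw [← inner_reproducer, ContinuousLinearMap.adjoint_inner_right, hV, hΦ, ← inner_reproducer,
      inner_reproducer_reproducer hk]
  rw [← ContinuousLinearMap.adjoint_inner_left, h_adjoint, inner_reproducer]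

end ReproducingKernels

section ExpandedKernels

variable {X : Type*}

theorem quadForm_familyKernel {ι : Type*} [Fintype ι] (Y : ι → X → ℂ) (w : X →₀ ℂ) :
    quadForm (familyKernel Y) w =
      ((∑ l, ‖∑ y ∈ w.support, w y * conj (Y l y)‖ ^ 2 : ℝ) : ℂ) := by
  push_cast
  simp_rw [← Complex.conj_mul', map_sum, Finset.sum_mul_sum, quadForm, familyKernel,
    Finset.mul_sum]
  rw [Finset.sum_comm (s := Finset.univ)]
  refine Finset.sum_congr rfl fun x _ => ?_
  rw [Finset.sum_comm (s := Finset.univ)]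
  refine Finset.sum_congr rfl fun y _ => Finset.sum_congr rfl fun l _ => ?_
  rw [map_mul, Complex.conj_conj]
  ring

theorem quadForm_familyKernel_re_nonneg {ι : Type*} [Fintype ι] (Y : ι → X → ℂ) (w : X →₀ ℂ) :
    0 ≤ (quadForm (familyKernel Y) w).re := by
  rw [quadForm_familyKernel, Complex.ofReal_re]
  positivity

variable {α : Type*} {ι : α → Type*} [∀ m, Fintype (ι m)] {Y : ∀ m, ι m → X → ℂ}
  {k k' : X → X → ℂ} {c c' : α → ℝ}

theorem hasSum_quadForm_re
    (hk : ∀ x y, HasSum (fun m => (c m : ℂ) * familyKernel (Y m) x y) (k x y)) (w : X →₀ ℂ) :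
    HasSum (fun m => c m * (quadForm (familyKernel (Y m)) w).re) (quadForm k w).re := by
  have h_sum : HasSum (fun m => ∑ x ∈ w.support, ∑ y ∈ w.support,
      conj (w x) * w y * ((c m : ℂ) * familyKernel (Y m) x y)) (quadForm k w) :=
    hasSum_sum fun x _ => hasSum_sum fun y _ => (hk x y).mul_left _
  refine (Complex.hasSum_re h_sum).congr_fun fun m => ?_
  rw [← Complex.re_ofReal_mul]
  congr 1
  simp only [quadForm, Finset.mul_sum, mul_left_comm]

theorem quadForm_re_le
    (hk : ∀ x y, HasSum (fun m => (c m : ℂ) * familyKernel (Y m) x y) (k x y))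
    (hk' : ∀ x y, HasSum (fun m => (c' m : ℂ) * familyKernel (Y m) x y) (k' x y))
    {C : ℝ} (hC : ∀ m, c m ≤ C * c' m) (w : X →₀ ℂ) :
    (quadForm k w).re ≤ C * (quadForm k' w).re := by
  refine hasSum_le (fun m => ?_) (hasSum_quadForm_re hk w) ((hasSum_quadForm_re hk' w).mul_left C)
  rw [← mul_assoc]
  exact mul_le_mul_of_nonneg_right (hC m) (quadForm_familyKernel_re_nonneg (Y m) w)

theorem posSemidef_kernelMatrix_of_hasSum (hc : 0 ≤ c)
    (hk : ∀ x y, HasSum (fun m => (c m : ℂ) * familyKernel (Y m) x y) (k x y)) :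
    (kernelMatrix k).PosSemidef := by
  refine posSemidef_kernelMatrix (fun x y => ?_) fun w => ?_
  · refine ((Complex.hasSum_conj'.mpr (hk y x)).congr_fun fun m => ?_).unique (hk x y)
    rw [map_mul, Complex.conj_ofReal, conj_familyKernel]
  · exact (hasSum_quadForm_re hk w).nonneg fun m =>
      mul_nonneg (hc m) (quadForm_familyKernel_re_nonneg (Y m) w)

end ExpandedKernels

section SphereSobolev

/-- The factor `(1 + m(m+1))^{-3/2}` of the Sobolev kernel on the sphere, in the form in which it
occurs in `sphereSobolevTerm`. -/
def sobolevCoeff (m : ℕ) : ℝ :=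
  (1 + (m : ℝ) * ((m : ℝ) + ((3 : ℕ) : ℝ) - 2)) ^ (-(3 / 2) : ℝ)

theorem sq_rpow_neg_three_halves {t : ℝ} (ht : 0 ≤ t) :
    (t ^ 2) ^ (-(3 / 2) : ℝ) = 1 / t ^ 3 := by
  rw [← Real.rpow_natCast t 2, ← Real.rpow_mul ht, one_div, ← Real.rpow_natCast t 3,
    ← Real.rpow_neg ht]
  norm_num

theorem le_sobolevCoeff (m : ℕ) : 1 / (m + 1 : ℝ) ^ 3 ≤ sobolevCoeff m := by
  rw [← sq_rpow_neg_three_halves (by positivity), sobolevCoeff]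
  have := m.cast_nonneg (α := ℝ)
  refine Real.rpow_le_rpow_of_nonpos ?_ ?_ (by norm_num) <;> push_cast <;> nlinarith

theorem sobolevCoeff_nonneg : 0 ≤ sobolevCoeff := fun m =>
  (by positivity : (0 : ℝ) ≤ 1 / (m + 1 : ℝ) ^ 3).trans (le_sobolevCoeff m)

theorem sobolevCoeff_le (m : ℕ) : sobolevCoeff m ≤ 8 / (m + 1 : ℝ) ^ 3 := by
  have h_half : 8 / (m + 1 : ℝ) ^ 3 = 1 / ((m + 1 : ℝ) / 2) ^ 3 := by
    field_simp
    norm_num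
  have := m.cast_nonneg (α := ℝ)
  rw [h_half, ← sq_rpow_neg_three_halves (by positivity), sobolevCoeff]
  refine Real.rpow_le_rpow_of_nonpos (by positivity) ?_ (by norm_num)
  push_cast
  nlinarith

variable {ι : ℕ → Type*} [∀ m, Fintype (ι m)] {Y : ∀ m, ι m → S2 → ℂ}

theorem sphereSobolevTerm_eq (Y : ∀ m, ι m → S2 → ℂ) (x y : S2) (m : ℕ) :
    sphereSobolevTerm 3 (3 / 2) Y x y m = (sobolevCoeff m : ℂ) * familyKernel (Y m) x y := rfl

theorem summable_sphereSobolevTerm (hY : ∀ m, IsSphericalHarmonicBasis 3 m (Y m)) (x y : S2) :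
    Summable (sphereSobolevTerm 3 (3 / 2) Y x y) := by
  refine Summable.of_norm_bounded (summable_inv_add_one_sq.mul_left 16) fun m => ?_
  rw [sphereSobolevTerm_eq, (hY m).familyKernel_eq_zonalKernel, norm_mul, Complex.norm_real,
    Complex.norm_real, Real.norm_of_nonneg (sobolevCoeff_nonneg m), Real.norm_eq_abs]
  calc sobolevCoeff m * |zonalKernel m x y| ≤ (8 / (m + 1 : ℝ) ^ 3) * (2 * (m + 1)) := by
        gcongr
        · exact sobolevCoeff_le m
        · linarith [abs_zonalKernel_le m x y]
    _ = 16 * (1 / (m + 1 : ℝ) ^ 2) := by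
        field_simp
        norm_num

theorem hasSum_sphereSobolevTerm (hY : ∀ m, IsSphericalHarmonicBasis 3 m (Y m)) (x y : S2) :
    HasSum (fun m => (sobolevCoeff m : ℂ) * familyKernel (Y m) x y)
      (∑' m, sphereSobolevTerm 3 (3 / 2) Y x y m) :=
  (summable_sphereSobolevTerm hY x y).hasSum

theorem posSemidef_sphereSobolevMatrix (hY : ∀ m, IsSphericalHarmonicBasis 3 m (Y m)) :
    (sphereSobolevMatrix 3 (3 / 2) Y).PosSemidef :=
  posSemidef_kernelMatrix_of_hasSum sobolevCoeff_nonneg (hasSum_sphereSobolevTerm hY)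

theorem hasSum_ballKernel (hY : ∀ m, IsSphericalHarmonicBasis 3 m (Y m)) {r : ℝ} (hr : 0 ≤ r)
    (x y : S2) : HasSum (fun m => (kernelCoeff r m : ℂ) * familyKernel (Y m) x y)
      (ballKernel 3 r x y : ℂ) := by
  refine (Complex.hasSum_ofReal.mpr
    (hasSum_kernelCoeff_mul_zonalKernel hr x y)).congr_fun fun m => ?_
  rw [(hY m).familyKernel_eq_zonalKernel, Complex.ofReal_mul]

theorem exists_continuousLinearEquiv_sphere (hY : ∀ m, IsSphericalHarmonicBasis 3 m (Y m)) {r : ℝ}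
    (hr : 0 < r) [Fact (sphereSobolevMatrix 3 (3 / 2) Y).PosSemidef] :
    ∃ T : RKHS.OfKernel (ballMatrixSphere 3 r) ≃L[ℂ]
      RKHS.OfKernel (sphereSobolevMatrix 3 (3 / 2) Y), ∀ f x, T f x = f x := by
  obtain ⟨δ, hδ, h_lower⟩ := exists_le_kernelCoeff hr
  have h_ball := hasSum_ballKernel hY hr.le
  have h_sobolev := hasSum_sphereSobolevTerm hY
  have h_pos := kernelConst_pos hr
  have h_le (m : ℕ) :
      kernelCoeff r m ≤ kernelConst r * (1 + r / 2) ^ 3 * 2 * sobolevCoeff m := by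
    refine (kernelCoeff_le hr m).trans ?_
    rw [div_eq_mul_one_div]
    gcongr
    exact le_sobolevCoeff m
  have h_ge (m : ℕ) : sobolevCoeff m ≤ 8 / δ * kernelCoeff r m :=
    calc sobolevCoeff m ≤ 8 / (m + 1 : ℝ) ^ 3 := sobolevCoeff_le m
      _ = 8 / δ * (δ / (m + 1 : ℝ) ^ 3) := by field_simp
      _ ≤ 8 / δ * kernelCoeff r m := by
          gcongr
          exact h_lower m
  exact exists_continuousLinearEquiv_of_quadForm_le RKHS.OfKernel.kernel_ofKernel
    RKHS.OfKernel.kernel_ofKernel (by positivity) (by positivity)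
    (quadForm_re_le h_ball h_sobolev h_le) (quadForm_re_le h_sobolev h_ball h_ge)

end SphereSobolev

section FourierL2

open FourierTransform
open scoped ENNReal ContDiff

variable {E : Type*} [NormedAddCommGroup E] [InnerProductSpace ℝ E] [FiniteDimensional ℝ E]
  [MeasurableSpace E] [BorelSpace E] {F : Type*} [NormedAddCommGroup F]

theorem continuous_fourier [NormedSpace ℂ F] {f : E → F} (hf : Integrable f) :
    Continuous (𝓕 f) :=
  VectorFourier.fourierIntegral_continuous Real.continuous_fourierChar (innerSL ℝ).continuous₂ hf

theorem continuous_fourierInv [NormedSpace ℂ F] {f : E → F} (hf : Integrable f) :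
    Continuous (𝓕⁻ f) :=
  VectorFourier.fourierIntegral_continuous Real.continuous_fourierChar
    (-innerSL ℝ).continuous₂ hf

theorem integral_fourier_smul [NormedSpace ℂ F] [CompleteSpace F] {φ : E → ℂ} {f : E → F}
    (hφ : Integrable φ) (hf : Integrable f) : ∫ x, 𝓕 φ x • f x = ∫ x, φ x • 𝓕 f x :=
  (VectorFourier.integral_fourierIntegral_smul_eq_flip Real.continuous_fourierChar
    (innerSL ℝ).continuous₂ hφ hf (L := innerₗ E)).trans (by rw [flip_innerₗ]; rfl)

theorem integral_fourierInv_smul [NormedSpace ℂ F] [CompleteSpace F] {φ : E → ℂ} {f : E → F}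
    (hφ : Integrable φ) (hf : Integrable f) : ∫ x, 𝓕⁻ φ x • f x = ∫ x, φ x • 𝓕⁻ f x := by
  have h_flip : (-innerₗ E).flip = -innerₗ E := by
    ext x y
    simp [real_inner_comm]
  exact (VectorFourier.integral_fourierIntegral_smul_eq_flip Real.continuous_fourierChar
    (-innerSL ℝ).continuous₂ hφ hf (L := -innerₗ E)).trans (by rw [h_flip]; rfl)

theorem coeFn_ae_eq_of_toTemperedDistribution_apply [NormedSpace ℂ F] [CompleteSpace F]
    {p : ℝ≥0∞} [hp : Fact (1 ≤ p)] {u : Lp F p (volume : Measure E)} {g : E → F}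
    (hg : LocallyIntegrable g)
    (h : ∀ φ : 𝓢(E, ℂ), (u : 𝓢'(E, F)) φ = ∫ x, φ x • g x) : u =ᵐ[volume] g := by
  refine ae_eq_of_integral_contDiff_smul_eq ((Lp.memLp u).locallyIntegrable hp.elim) hg
    fun η hη h_supp => ?_
  have h_supp' : HasCompactSupport (Complex.ofRealCLM ∘ η) := h_supp.comp_left rfl
  have h_smooth : ContDiff ℝ ∞ (Complex.ofRealCLM ∘ η) := by fun_prop
  simpa using h (h_supp'.toSchwartzMap h_smooth)

variable [InnerProductSpace ℂ F] [CompleteSpace F]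

theorem coeFn_fourier_toLp {f : E → F} (hf : Integrable f) (hf2 : MemLp f 2) :
    (𝓕 (hf2.toLp f) : Lp F 2 (volume : Measure E)) =ᵐ[volume] 𝓕 f := by
  refine coeFn_ae_eq_of_toTemperedDistribution_apply (continuous_fourier hf).locallyIntegrable
    fun φ => ?_
  rw [← Lp.fourier_toTemperedDistribution_eq, TemperedDistribution.fourier_apply,
    Lp.toTemperedDistribution_apply, ← integral_fourier_smul φ.integrable hf]
  refine integral_congr_ae (hf2.coeFn_toLp.mono fun x hx => ?_)
  simp only [hx, SchwartzMap.fourier_coe]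

theorem coeFn_fourierInv_toLp {f : E → F} (hf : Integrable f) (hf2 : MemLp f 2) :
    (𝓕⁻ (hf2.toLp f) : Lp F 2 (volume : Measure E)) =ᵐ[volume] 𝓕⁻ f := by
  refine coeFn_ae_eq_of_toTemperedDistribution_apply (continuous_fourierInv hf).locallyIntegrable
    fun φ => ?_
  rw [← Lp.fourierInv_toTemperedDistribution_eq, TemperedDistribution.fourierInv_apply,
    Lp.toTemperedDistribution_apply, ← integral_fourierInv_smul φ.integrable hf]
  refine integral_congr_ae (hf2.coeFn_toLp.mono fun x hx => ?_)
  simp only [hx, SchwartzMap.fourierInv_coe]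

end FourierL2

section FourierMultiplier

open FourierTransform
open scoped ENNReal

variable {E : Type*} [NormedAddCommGroup E] [InnerProductSpace ℝ E] [FiniteDimensional ℝ E]
  [MeasurableSpace E] [BorelSpace E] {m : E → ℂ}

theorem memLp_top_of_continuous_of_norm_le (hm : Continuous m) {C : ℝ} (hC : ∀ ξ, ‖m ξ‖ ≤ C) :
    MemLp m ∞ (volume : Measure E) :=
  memLp_top_of_bound hm.aestronglyMeasurable C (ae_of_all _ hC)

/-- Multiplication of square integrable functions by a bounded function. -/
def mulL2 (hm : MemLp m ∞ (volume : Measure E)) :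
    Lp ℂ 2 (volume : Measure E) →L[ℂ] Lp ℂ 2 (volume : Measure E) :=
  (ContinuousLinearMap.mul ℂ ℂ).holderL volume ∞ 2 2 (hm.toLp m)

theorem mulL2_apply (hm : MemLp m ∞ (volume : Measure E)) (f : Lp ℂ 2 (volume : Measure E)) :
    mulL2 hm f = hm.toLp m • f := rfl

theorem coeFn_mulL2 (hm : MemLp m ∞ (volume : Measure E)) (f : Lp ℂ 2 (volume : Measure E)) :
    mulL2 hm f =ᵐ[volume] fun ξ => m ξ * f ξ := by
  rw [mulL2_apply]
  filter_upwards [Lp.coeFn_lpSMul (r := 2) (hm.toLp m) f, hm.coeFn_toLp] with ξ h_smul h_toLp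
  rw [h_smul, Pi.smul_apply', h_toLp, smul_eq_mul]

/-- The Fourier multiplier `f ↦ 𝓕⁻ (m 𝓕 f)` on square integrable functions, for a bounded symbol
`m`. -/
def fourierMultiplierL2 (hm : MemLp m ∞ (volume : Measure E)) :
    Lp ℂ 2 (volume : Measure E) →L[ℂ] Lp ℂ 2 (volume : Measure E) :=
  fourierInvCLM ℂ _ ∘L mulL2 hm ∘L fourierCLM ℂ _

theorem fourierMultiplierL2_apply (hm : MemLp m ∞ (volume : Measure E))
    (f : Lp ℂ 2 (volume : Measure E)) :
    fourierMultiplierL2 hm f = 𝓕⁻ (mulL2 hm (𝓕 f)) := rfl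

theorem toTemperedDistribution_fourierMultiplierL2 (hm : MemLp m ∞ (volume : Measure E))
    (hm' : m.HasTemperateGrowth) (f : Lp ℂ 2 (volume : Measure E)) :
    (fourierMultiplierL2 hm f : 𝓢'(E, ℂ)) =
      TemperedDistribution.fourierMultiplierCLM ℂ m (f : 𝓢'(E, ℂ)) := by
  rw [fourierMultiplierL2_apply, ← Lp.fourierInv_toTemperedDistribution_eq, mulL2_apply,
    Lp.toTemperedDistribution_smul_eq hm', ← Lp.fourier_toTemperedDistribution_eq,
    TemperedDistribution.fourierMultiplierCLM_apply]

end FourierMultiplier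

namespace SobolevSpace

open FourierTransform
open scoped ENNReal

variable {d : ℕ} {s : ℝ}

theorem memLp_top_besselSymbol (hs : 0 ≤ s) : MemLp
    (fun ξ : EuclideanSpace ℝ (Fin d) => (((1 + ‖ξ‖ ^ 2) ^ (-s / 2) : ℝ) : ℂ)) ∞ volume := by
  refine memLp_top_of_continuous_of_norm_le (C := 1) ?_ fun ξ => ?_
  · exact Complex.continuous_ofReal.comp
      (Continuous.rpow_const (by fun_prop) fun ξ => Or.inl (by positivity))
  · rw [Complex.norm_real, Real.norm_of_nonneg (by positivity)]
    exact Real.rpow_le_one_of_one_le_of_nonpos (by simp) (by linarith)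

theorem besselPotential_fourierMultiplierL2 (hs : 0 ≤ s)
    (v : Lp ℂ 2 (volume : Measure (EuclideanSpace ℝ (Fin d)))) :
    TemperedDistribution.besselPotential _ ℂ s
      (fourierMultiplierL2 (memLp_top_besselSymbol hs) v : 𝓢'(EuclideanSpace ℝ (Fin d), ℂ)) =
      v := by
  rw [toTemperedDistribution_fourierMultiplierL2 _ (by fun_prop),
    ← TemperedDistribution.besselPotential_neg_apply_eq_iff]
  rfl

/-- The function in `H^s(ℝ^d)` whose Bessel potential is a given square integrable function. -/
def ofBessel (hs : 0 ≤ s) :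
    Lp ℂ 2 (volume : Measure (EuclideanSpace ℝ (Fin d))) →ₗ[ℂ] SobolevSpace d s :=
  LinearMap.codRestrict (sobolevSubmodule d s)
    (fourierMultiplierL2 (memLp_top_besselSymbol hs)).toLinearMap
    fun v => ⟨v, besselPotential_fourierMultiplierL2 hs v⟩

theorem toL2_ofBessel (hs : 0 ≤ s) (v : Lp ℂ 2 (volume : Measure (EuclideanSpace ℝ (Fin d)))) :
    toL2 (ofBessel hs v) = fourierMultiplierL2 (memLp_top_besselSymbol hs) v := rfl

theorem bessel_ofBessel (hs : 0 ≤ s) (v : Lp ℂ 2 (volume : Measure (EuclideanSpace ℝ (Fin d)))) :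
    bessel (ofBessel hs v) = v := by
  apply toTemperedDistribution_injective
  have h_spec := bessel_spec (ofBessel hs v)
  rw [toL2_ofBessel, besselPotential_fourierMultiplierL2 hs] at h_spec
  exact h_spec.symm

theorem norm_ofBessel (hs : 0 ≤ s) (v : Lp ℂ 2 (volume : Measure (EuclideanSpace ℝ (Fin d)))) :
    ‖ofBessel hs v‖ = ‖v‖ := by
  rw [norm_def, bessel_ofBessel]

/-- The isometry of `L²(ℝ^d)` onto `H^s(ℝ^d)` that inverts the Bessel potential. -/
def ofBesselₗᵢ (hs : 0 ≤ s) :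
    Lp ℂ 2 (volume : Measure (EuclideanSpace ℝ (Fin d))) →ₗᵢ[ℂ] SobolevSpace d s :=
  ⟨ofBessel hs, norm_ofBessel hs⟩

theorem toL2_injective : Function.Injective (toL2 : SobolevSpace d s →ₗ[ℂ] _) :=
  Subtype.val_injective

end SobolevSpace

section BallTransform

open FourierTransform
open scoped Real ENNReal

section General

variable {E : Type*} [NormedAddCommGroup E] [InnerProductSpace ℝ E] [FiniteDimensional ℝ E]
  [MeasurableSpace E] [BorelSpace E]

/-- The indicator function of the closed ball with centre `x` and radius `R`. -/
def ballIndicator (R : ℝ) (x : E) : E → ℂ :=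
  (closedBall x R).indicator fun _ => 1

theorem memLp_ballIndicator (R : ℝ) (x : E) (p : ℝ≥0∞) : MemLp (ballIndicator R x) p :=
  memLp_indicator_const p measurableSet_closedBall 1 (Or.inr measure_closedBall_lt_top.ne)

theorem integrable_ballIndicator (R : ℝ) (x : E) : Integrable (ballIndicator R x) :=
  memLp_one_iff_integrable.mp (memLp_ballIndicator R x 1)

/-- The Fourier transform of the indicator function of the closed ball with centre `0` and
radius `R`. -/
def ballTransform (R : ℝ) : E → ℂ := 𝓕 (ballIndicator R (0 : E))

theorem continuous_ballTransform (R : ℝ) : Continuous (ballTransform R : E → ℂ) :=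
  continuous_fourier (integrable_ballIndicator R 0)

theorem memLp_ballTransform (R : ℝ) : MemLp (ballTransform R : E → ℂ) 2 :=
  (memLp_congr_ae (coeFn_fourier_toLp (integrable_ballIndicator R 0)
    (memLp_ballIndicator R 0 2))).mp (Lp.memLp _)

theorem fourier_ballIndicator (R : ℝ) (x ξ : E) :
    𝓕 (ballIndicator R x) ξ = Real.fourierChar (-inner ℝ x ξ) * ballTransform R ξ := by
  have h_translate : ballIndicator R x = ballIndicator R 0 ∘ fun v => v + -x := by
    ext v
    simp [ballIndicator, Set.indicator, mem_closedBall, dist_eq_norm, sub_eq_add_neg]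
  rw [h_translate]
  refine (congrFun (VectorFourier.fourierIntegral_comp_add_right Real.fourierChar volume (innerₗ E)
    (ballIndicator R 0) (-x)) ξ).trans ?_
  rw [innerₗ_apply_apply, inner_neg_left, Circle.smul_def, smul_eq_mul]
  rfl

theorem norm_ballTransform_le (R : ℝ) (ξ : E) :
    ‖ballTransform R ξ‖ ≤ volume.real (closedBall (0 : E) R) := by
  refine (VectorFourier.norm_fourierIntegral_le_integral_norm Real.fourierChar volume (innerₗ E)
    (ballIndicator R 0) ξ).trans_eq ?_
  simp [ballIndicator, norm_indicator_eq_indicator_norm,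
    integral_indicator measurableSet_closedBall]

end General

/-- The function `t² j₁(t)`, where `j₁` is the spherical Bessel function; it is the radial profile
of the Fourier transform of the indicator function of a ball in `ℝ³`. -/
def ballProfile (t : ℝ) : ℝ := Real.sin t - t * Real.cos t

theorem hasDerivAt_ballProfile (t : ℝ) : HasDerivAt ballProfile (t * Real.sin t) t := by
  refine ((Real.hasDerivAt_sin t).sub
    ((hasDerivAt_id t).mul (Real.hasDerivAt_cos t))).congr_deriv ?_
  simp

theorem abs_ballProfile_le {t : ℝ} (ht : 0 ≤ t) : |ballProfile t| ≤ 1 + t :=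
  calc |Real.sin t - t * Real.cos t| ≤ |Real.sin t| + |t * Real.cos t| := abs_sub _ _
    _ = |Real.sin t| + t * |Real.cos t| := by rw [abs_mul, abs_of_nonneg ht]
    _ ≤ 1 + t := add_le_add (Real.abs_sin_le_one t)
      (mul_le_of_le_one_right ht (Real.abs_cos_le_one t))

theorem exists_ballProfile_eq_zero : ∃ t > 0, ballProfile t = 0 := by
  have hc : ContinuousOn ballProfile (Set.Icc π (2 * π)) := fun t _ =>
    (hasDerivAt_ballProfile t).continuousAt.continuousWithinAt
  obtain ⟨t, ht, ht0⟩ := intermediate_value_Icc' (by linarith [Real.pi_pos]) hc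
    (show (0 : ℝ) ∈ _ by simp [ballProfile, Real.pi_pos.le])
  exact ⟨t, Real.pi_pos.trans_le ht.1, ht0⟩

theorem abs_ballProfile_le_mul_sub {s t : ℝ} (hs : 0 ≤ s) (hst : s ≤ t) (hz : ballProfile s = 0) :
    |ballProfile t| ≤ t * (t - s) := by
  have h_deriv_le : ∀ u ∈ Set.Icc s t, ‖u * Real.sin u‖ ≤ t := fun u hu => by
    rw [norm_mul, Real.norm_of_nonneg (hs.trans hu.1)]
    exact (mul_le_of_le_one_right (hs.trans hu.1) (Real.abs_sin_le_one u)).trans hu.2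
  simpa [hz, abs_of_nonneg (sub_nonneg.mpr hst)] using
    (convex_Icc s t).norm_image_sub_le_of_norm_hasDerivWithin_le
      (fun u _ => (hasDerivAt_ballProfile u).hasDerivWithinAt) h_deriv_le
      (Set.left_mem_Icc.mpr hst) (Set.right_mem_Icc.mpr hst)

theorem integral_sq_mul_sinc {k : ℝ} (hk : k ≠ 0) (R : ℝ) :
    ∫ ρ in (0 : ℝ)..R, ρ ^ 2 * Real.sinc (k * ρ) = ballProfile (k * R) / k ^ 3 := by
  have h_deriv : ∀ ρ : ℝ,
      HasDerivAt (fun ρ => ballProfile (k * ρ) / k ^ 3) (ρ ^ 2 * Real.sinc (k * ρ)) ρ := by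
    intro ρ
    refine (((hasDerivAt_ballProfile (k * ρ)).comp ρ
      ((hasDerivAt_id ρ).const_mul k)).div_const _).congr_deriv ?_
    rcases eq_or_ne ρ 0 with rfl | hρ
    · simp
    · rw [Real.sinc_of_ne_zero (mul_ne_zero hk hρ)]
      field_simp
  rw [intervalIntegral.integral_eq_sub_of_hasDerivAt (fun ρ _ => h_deriv ρ)
    (Continuous.intervalIntegrable (by fun_prop) _ _)]
  simp [ballProfile]

theorem integral_exp_inner_sphere (ζ : E3) :
    ∫ ω : S2, Complex.exp ((inner ℝ (ω : E3) ζ : ℝ) * Complex.I) ∂(sphereMeasure 3) =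
      (Real.sinc ‖ζ‖ : ℝ) := by
  rcases eq_or_ne ζ 0 with rfl | hζ
  · simp
  set k := ‖ζ‖
  have hk : k ≠ 0 := norm_ne_zero_iff.mpr hζ
  let y : S2 := ⟨k⁻¹ • ζ, by simp [norm_smul, k, hζ]⟩
  have h_inner : ∀ ω : S2, inner ℝ (ω : E3) ζ = k * inner ℝ (ω : E3) (y : E3) := fun ω => by
    rw [inner_smul_right, mul_inv_cancel_left₀ hk]
  have h_cont : Continuous fun t : ℝ => Complex.exp ((k * t : ℝ) * Complex.I) := by fun_prop
  simp_rw [h_inner]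
  rw [integral_comp_inner (f := fun t => Complex.exp ((k * t : ℝ) * Complex.I))
    h_cont.aestronglyMeasurable y,
    intervalIntegral.integral_comp_mul_left (fun t : ℝ => Complex.exp (t * Complex.I)) hk,
    mul_neg, mul_one, integral_exp_mul_I_eq_sinc]
  have hk' : (k : ℂ) ≠ 0 := Complex.ofReal_ne_zero.mpr hk
  simp only [Complex.real_smul]
  push_cast
  field_simp

theorem ballIndicator_zero_smul_sphere {ρ : ℝ} (hρ : 0 ≤ ρ) (R : ℝ) (ω : S2) :
    ballIndicator R 0 (ρ • (ω : E3)) = (Set.Iic R).indicator 1 ρ := by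
  have h_norm : ‖ρ • (ω : E3)‖ = ρ := by
    rw [norm_smul, mem_sphere_zero_iff_norm.mp ω.2, mul_one, Real.norm_of_nonneg hρ]
  simp [ballIndicator, Set.indicator, h_norm]

theorem integral_exp_mul_ballIndicator_sphere {ρ : ℝ} (hρ : 0 ≤ ρ) (R : ℝ) (ξ : E3) :
    ∫ ω : S2, Complex.exp ((-2 * π * inner ℝ (ρ • (ω : E3)) ξ : ℝ) * Complex.I) •
      ballIndicator R 0 (ρ • (ω : E3)) ∂(sphereMeasure 3) =
      (Set.Iic R).indicator (fun ρ => ((Real.sinc (2 * π * ‖ξ‖ * ρ) : ℝ) : ℂ)) ρ := by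
  have h_inner : ∀ ω : S2,
      -2 * π * inner ℝ (ρ • (ω : E3)) ξ = inner ℝ (ω : E3) ((-(2 * π * ρ)) • ξ) := fun ω => by
    rw [real_inner_smul_left, real_inner_smul_right]
    ring
  have h_norm : ‖(-(2 * π * ρ)) • ξ‖ = 2 * π * ‖ξ‖ * ρ := by
    rw [norm_smul, norm_neg, Real.norm_of_nonneg (by positivity)]
    ring
  simp_rw [ballIndicator_zero_smul_sphere hρ, h_inner]
  by_cases hR : ρ ∈ Set.Iic R
  · simp only [Set.indicator_of_mem hR, Pi.one_apply, smul_eq_mul, mul_one]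
    rw [integral_exp_inner_sphere, h_norm]
  · simp [Set.indicator_of_notMem hR]

theorem ballTransform_eq {R : ℝ} (hR : 0 ≤ R) {ξ : E3} (hξ : ξ ≠ 0) :
    ballTransform R ξ =
      (sphereArea * (ballProfile (2 * π * ‖ξ‖ * R) / (2 * π * ‖ξ‖) ^ 3) : ℝ) := by
  have hκ : 2 * π * ‖ξ‖ ≠ 0 := by positivity
  have h_int : Integrable fun v : E3 =>
      Complex.exp ((-2 * π * inner ℝ v ξ : ℝ) * Complex.I) • ballIndicator R 0 v := by
    refine ((Real.fourierIntegral_convergent_iff ξ).mpr (integrable_ballIndicator R 0)).congr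
      (ae_of_all _ fun v => ?_)
    simp only [Circle.smul_def, Real.fourierChar_apply, mul_neg, neg_mul]
  have h_radial : ∀ ρ ∈ Set.Ioi (0 : ℝ), (ρ ^ 2 • ∫ ω : S2,
      Complex.exp ((-2 * π * inner ℝ (ρ • (ω : E3)) ξ : ℝ) * Complex.I) •
        ballIndicator R 0 (ρ • (ω : E3)) ∂(sphereMeasure 3)) =
      (Set.Iic R).indicator (fun ρ => ((ρ ^ 2 * Real.sinc (2 * π * ‖ξ‖ * ρ) : ℝ) : ℂ)) ρ := by
    intro ρ hρ
    rw [integral_exp_mul_ballIndicator_sphere (le_of_lt hρ)]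
    by_cases hR' : ρ ∈ Set.Iic R <;> simp [Set.indicator, hR']
  rw [ballTransform, Real.fourier_eq', integral_polar h_int,
    setIntegral_congr_fun measurableSet_Ioi h_radial, setIntegral_indicator measurableSet_Iic,
    Set.Ioi_inter_Iic, ← intervalIntegral.integral_of_le hR, intervalIntegral.integral_ofReal,
    integral_sq_mul_sinc hκ, Complex.real_smul, ← Complex.ofReal_mul]

theorem norm_ballTransform_eq {R : ℝ} (hR : 0 ≤ R) {ξ : E3} (hξ : ξ ≠ 0) :
    ‖ballTransform R ξ‖ =
      sphereArea * (|ballProfile (2 * π * ‖ξ‖ * R)| / (2 * π * ‖ξ‖) ^ 3) := by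
  rw [ballTransform_eq hR hξ, Complex.norm_real, norm_mul, norm_div, Real.norm_eq_abs,
    Real.norm_eq_abs, abs_of_pos sphereArea_pos, Real.norm_of_nonneg (by positivity)]

theorem norm_ballTransform_le_div_sq {R : ℝ} (hR : 0 ≤ R) {ξ : E3} (hξ : 1 ≤ ‖ξ‖) :
    ‖ballTransform R ξ‖ ≤ sphereArea * (1 + R) / ‖ξ‖ ^ 2 := by
  have hξ0 : 0 < ‖ξ‖ := by linarith
  have hA := sphereArea_pos
  rw [norm_ballTransform_eq hR (norm_pos_iff.mp hξ0)]
  set κ := 2 * π * ‖ξ‖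
  have hκ : ‖ξ‖ ≤ κ := le_mul_of_one_le_left hξ0.le (by linarith [Real.pi_gt_three])
  have hκ0 : 0 < κ := hξ0.trans_le hκ
  calc sphereArea * (|ballProfile (κ * R)| / κ ^ 3)
      ≤ sphereArea * ((1 + κ * R) / κ ^ 3) := by gcongr; exact abs_ballProfile_le (by positivity)
    _ ≤ sphereArea * ((1 + R) * κ / κ ^ 3) := by gcongr; nlinarith
    _ = sphereArea * (1 + R) / κ ^ 2 := by field_simp
    _ ≤ sphereArea * (1 + R) / ‖ξ‖ ^ 2 := by gcongr

theorem exists_forall_one_add_sq_mul_norm_ballTransform_le {R : ℝ} (hR : 0 ≤ R) :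
    ∃ C, ∀ ξ : E3, (1 + ‖ξ‖ ^ 2) * ‖ballTransform R ξ‖ ≤ C := by
  have hA := sphereArea_pos
  refine ⟨max (2 * volume.real (closedBall (0 : E3) R)) (2 * (sphereArea * (1 + R))),
    fun ξ => ?_⟩
  rcases le_total ‖ξ‖ 1 with h | h
  · refine le_max_of_le_left (mul_le_mul ?_ (norm_ballTransform_le R ξ) (norm_nonneg _) zero_le_two)
    nlinarith [norm_nonneg ξ]
  · have : 0 < ‖ξ‖ := by linarith
    refine le_max_of_le_right ?_
    calc (1 + ‖ξ‖ ^ 2) * ‖ballTransform R ξ‖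
        ≤ (2 * ‖ξ‖ ^ 2) * (sphereArea * (1 + R) / ‖ξ‖ ^ 2) :=
          mul_le_mul (by nlinarith) (norm_ballTransform_le_div_sq hR h) (norm_nonneg _)
            (by positivity)
      _ = 2 * (sphereArea * (1 + R)) := by field_simp

theorem exists_norm_ballTransform_le_mul_sub {R : ℝ} (hR : 0 < R) :
    ∃ ρ > 0, ∃ M > 0, ∀ ξ : E3, ρ ≤ ‖ξ‖ → ‖ξ‖ ≤ 2 * ρ →
      (1 + ‖ξ‖ ^ 2) * ‖ballTransform R ξ‖ ≤ M * (‖ξ‖ - ρ) := by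
  obtain ⟨t, ht, hz⟩ := exists_ballProfile_eq_zero
  have hA := sphereArea_pos
  set ρ := t / (2 * π * R) with hρ_def
  have hρ : 0 < ρ := by positivity
  have ht_eq : t = 2 * π * ρ * R := by rw [hρ_def]; field_simp
  refine ⟨ρ, hρ, (1 + (2 * ρ) ^ 2) * (sphereArea * ((2 * t) * (2 * π * R) / (2 * π * ρ) ^ 3)),
    by positivity, fun ξ h_lower h_upper => ?_⟩
  have : 0 ≤ ‖ξ‖ - ρ := sub_nonneg.mpr h_lower
  have h_le : t ≤ 2 * π * ‖ξ‖ * R := by rw [ht_eq]; gcongr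
  have h_profile : |ballProfile (2 * π * ‖ξ‖ * R)| ≤ 2 * t * (2 * π * R * (‖ξ‖ - ρ)) := calc
    |ballProfile (2 * π * ‖ξ‖ * R)| ≤ 2 * π * ‖ξ‖ * R * (2 * π * ‖ξ‖ * R - t) :=
        abs_ballProfile_le_mul_sub ht.le h_le hz
    _ = 2 * π * ‖ξ‖ * R * (2 * π * R * (‖ξ‖ - ρ)) := by rw [ht_eq]; ring
    _ ≤ 2 * π * (2 * ρ) * R * (2 * π * R * (‖ξ‖ - ρ)) := by gcongr
    _ = 2 * t * (2 * π * R * (‖ξ‖ - ρ)) := by rw [ht_eq]; ring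
  rw [norm_ballTransform_eq hR.le (norm_pos_iff.mp (hρ.trans_le h_lower))]
  calc (1 + ‖ξ‖ ^ 2) * (sphereArea * (|ballProfile (2 * π * ‖ξ‖ * R)| / (2 * π * ‖ξ‖) ^ 3))
      ≤ (1 + (2 * ρ) ^ 2) *
          (sphereArea * (2 * t * (2 * π * R * (‖ξ‖ - ρ)) / (2 * π * ρ) ^ 3)) := by gcongr
    _ = (1 + (2 * ρ) ^ 2) * (sphereArea * (2 * t * (2 * π * R) / (2 * π * ρ) ^ 3)) * (‖ξ‖ - ρ) := by
        ring

end BallTransform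

section Embedding

open FourierTransform
open scoped ENNReal

section Feature

variable {E : Type*} [NormedAddCommGroup E] [InnerProductSpace ℝ E] [FiniteDimensional ℝ E]
  [MeasurableSpace E] [BorelSpace E]

variable (E) in
/-- The normalization `vol(B_R)^{-1/2}` of the indicator functions of balls of radius `R`. -/
def ballWeight (R : ℝ) : ℝ := √(volume.real (closedBall (0 : E) R))⁻¹

theorem ballWeight_nonneg (R : ℝ) : 0 ≤ ballWeight E R := Real.sqrt_nonneg _

theorem ballWeight_pos {R : ℝ} (hR : 0 < R) : 0 < ballWeight E R :=
  Real.sqrt_pos.mpr (inv_pos.mpr (ENNReal.toReal_pos (measure_closedBall_pos _ _ hR).ne'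
    measure_closedBall_lt_top.ne))

/-- The feature map `x ↦ vol(B_R)^{-1/2} 1_{B_R(x)}` of the ball-discrepancy kernel. -/
def ballFeature (R : ℝ) (x : E) : Lp ℂ 2 (volume : Measure E) :=
  (ballWeight E R : ℂ) • (memLp_ballIndicator R x 2).toLp _

theorem inner_toLp_ballIndicator (R : ℝ) (x y : E) :
    inner ℂ ((memLp_ballIndicator R x 2).toLp _) ((memLp_ballIndicator R y 2).toLp _) =
      (volume.real (closedBall x R ∩ closedBall y R) : ℂ) :=
  L2.inner_indicatorConstLp_one_indicatorConstLp_one measurableSet_closedBall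
    measurableSet_closedBall measure_closedBall_lt_top.ne measure_closedBall_lt_top.ne

theorem ballKernel_eq_volume_real_inter (d : ℕ) (r : ℝ) (x y : EuclideanSpace ℝ (Fin d)) :
    ballKernel d r x y = (volume.real (closedBall (0 : EuclideanSpace ℝ (Fin d)) (r / 2)))⁻¹ *
      volume.real (closedBall x (r / 2) ∩ closedBall y (r / 2)) := by
  simp_rw [ballKernel, dirac_real_closedBall]
  rw [← integral_indicator_one (measurableSet_closedBall.inter measurableSet_closedBall),
    Set.inter_indicator_one]
  rfl

theorem inner_ballFeature (d : ℕ) (r : ℝ) (x y : EuclideanSpace ℝ (Fin d)) :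
    inner ℂ (ballFeature (r / 2) x) (ballFeature (r / 2) y) = (ballKernel d r x y : ℂ) := by
  rw [ballFeature, ballFeature, inner_smul_left, inner_smul_right, inner_toLp_ballIndicator,
    Complex.conj_ofReal, ← mul_assoc, ← Complex.ofReal_mul, ballWeight,
    Real.mul_self_sqrt (inv_nonneg.mpr measureReal_nonneg), ballKernel_eq_volume_real_inter,
    Complex.ofReal_mul]

theorem exists_clm_forall_apply_eq_inner_ballFeature (d : ℕ) (r : ℝ) :
    ∃ V : RKHS.OfKernel (ballMatrix d r) →L[ℂ]
        Lp ℂ 2 (volume : Measure (EuclideanSpace ℝ (Fin d))),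
      ∀ f x, f x = inner ℂ (ballFeature (r / 2) x) (V f) :=
  exists_clm_forall_apply_eq_inner (RKHS.OfKernel.kernel_ofKernel (K := ballMatrix d r)) _
    (inner_ballFeature d r)

theorem coeFn_fourier_ballFeature (R : ℝ) (x : E) :
    (𝓕 (ballFeature R x) : Lp ℂ 2 (volume : Measure E)) =ᵐ[volume]
      fun ξ => ballWeight E R * (Real.fourierChar (-inner ℝ x ξ) * ballTransform R ξ) := by
  rw [ballFeature, fourier_smul]
  filter_upwards [Lp.coeFn_smul (ballWeight E R : ℂ)
    (𝓕 ((memLp_ballIndicator R x 2).toLp _) : Lp ℂ 2 (volume : Measure E)),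
    coeFn_fourier_toLp (integrable_ballIndicator R x) (memLp_ballIndicator R x 2)]
    with ξ h_smul h_fourier
  rw [h_smul, Pi.smul_apply, h_fourier, fourier_ballIndicator, smul_eq_mul]

/-- The inverse Fourier transform of `ballDensity R g` is the function `x ↦ ⟪ballFeature R x, g⟫`
represented by `g`, see `inner_ballFeature_eq_fourierInv`. -/
def ballDensity (R : ℝ) (g : Lp ℂ 2 (volume : Measure E)) (ξ : E) : ℂ :=
  ballWeight E R * (conj (ballTransform R ξ) * (𝓕 g : Lp ℂ 2 (volume : Measure E)) ξ)

theorem integrable_ballDensity (R : ℝ) (g : Lp ℂ 2 (volume : Measure E)) :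
    Integrable (ballDensity R g) :=
  ((memLp_ballTransform R).star.integrable_mul (Lp.memLp _)).const_mul _

theorem inner_ballFeature_eq_fourierInv (R : ℝ) (g : Lp ℂ 2 (volume : Measure E)) (x : E) :
    inner ℂ (ballFeature R x) g = 𝓕⁻ (ballDensity R g) x := by
  rw [← Lp.inner_fourier_eq, L2.inner_def, Real.fourierInv_eq]
  refine integral_congr_ae ?_
  filter_upwards [coeFn_fourier_ballFeature R x] with ξ hξ
  rw [hξ, RCLike.inner_apply, ballDensity, Circle.smul_def, smul_eq_mul]
  simp only [map_mul, Complex.conj_ofReal]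
  rw [← Circle.coe_inv_eq_conj, ← AddChar.map_neg_eq_inv, neg_neg, real_inner_comm]
  ring

theorem continuous_inner_ballFeature (R : ℝ) (g : Lp ℂ 2 (volume : Measure E)) :
    Continuous fun x => inner ℂ (ballFeature R x) g := by
  simp_rw [inner_ballFeature_eq_fourierInv]
  exact continuous_fourierInv (integrable_ballDensity R g)

/-- The Fourier symbol `vol(B_R)^{-1/2} (1 + |ξ|²) conj (𝓕 1_{B_R} (ξ))` of the operator that maps
`g` to `(1 - Δ / (4π²)) ⟪ballFeature R ·, g⟫`. -/
def ballSymbol (R : ℝ) (ξ : E) : ℂ :=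
  ballWeight E R * ((1 + ‖ξ‖ ^ 2 : ℝ) * conj (ballTransform R ξ))

theorem continuous_ballSymbol (R : ℝ) : Continuous (ballSymbol R : E → ℂ) := by
  have h_cont := continuous_ballTransform (E := E) R
  unfold ballSymbol
  fun_prop

theorem norm_ballSymbol (R : ℝ) (ξ : E) :
    ‖ballSymbol R ξ‖ = ballWeight E R * ((1 + ‖ξ‖ ^ 2) * ‖ballTransform R ξ‖) := by
  rw [ballSymbol, norm_mul, norm_mul, RCLike.norm_conj, Complex.norm_real, Complex.norm_real,
    Real.norm_of_nonneg (ballWeight_nonneg R), Real.norm_of_nonneg (by positivity)]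

end Feature

theorem memLp_ballSymbol {R : ℝ} (hR : 0 ≤ R) : MemLp (ballSymbol R : E3 → ℂ) ∞ := by
  obtain ⟨C, hC⟩ := exists_forall_one_add_sq_mul_norm_ballTransform_le hR
  refine memLp_top_of_continuous_of_norm_le (continuous_ballSymbol R) (C := ballWeight E3 R * C)
    fun ξ => ?_
  rw [norm_ballSymbol]
  exact mul_le_mul_of_nonneg_left (hC ξ) (ballWeight_nonneg R)

theorem coeFn_mulL2_ballSymbol {R : ℝ} (hR : 0 ≤ R) (g : Lp ℂ 2 (volume : Measure E3)) :
    mulL2 (SobolevSpace.memLp_top_besselSymbol (d := 3) (s := 2) zero_le_two)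
      (mulL2 (memLp_ballSymbol hR) (𝓕 g)) =ᵐ[volume] ballDensity R g := by
  filter_upwards [coeFn_mulL2 (SobolevSpace.memLp_top_besselSymbol (d := 3) (s := 2) zero_le_two)
    (mulL2 (memLp_ballSymbol hR) (𝓕 g)), coeFn_mulL2 (memLp_ballSymbol hR) (𝓕 g)]
    with ξ h_bessel h_symbol
  have h_rpow : (1 + ‖ξ‖ ^ 2 : ℝ) ^ (-2 / 2 : ℝ) = (1 + ‖ξ‖ ^ 2)⁻¹ := by
    rw [show (-2 / 2 : ℝ) = -1 by norm_num, Real.rpow_neg_one]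
  have h_ne : ((1 + ‖ξ‖ ^ 2 : ℝ) : ℂ) ≠ 0 := Complex.ofReal_ne_zero.mpr (by positivity)
  rw [h_bessel, h_symbol, h_rpow, ballSymbol, ballDensity, Complex.ofReal_inv]
  field_simp

/-- The map that sends a square integrable `g` to the function `x ↦ ⟪ballFeature R x, g⟫`,
as an element of `H²(ℝ³)`. -/
def ballEmbedding {R : ℝ} (hR : 0 ≤ R) : Lp ℂ 2 (volume : Measure E3) →L[ℂ] SobolevSpace 3 2 :=
  (SobolevSpace.ofBesselₗᵢ zero_le_two).toContinuousLinearMap ∘L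
    fourierMultiplierL2 (memLp_ballSymbol hR)

theorem ballEmbedding_apply {R : ℝ} (hR : 0 ≤ R) (g : Lp ℂ 2 (volume : Measure E3)) :
    ballEmbedding hR g =
      SobolevSpace.ofBessel zero_le_two (fourierMultiplierL2 (memLp_ballSymbol hR) g) := rfl

theorem coeFn_toL2_ballEmbedding {R : ℝ} (hR : 0 ≤ R) (g : Lp ℂ 2 (volume : Measure E3)) :
    (ballEmbedding hR g).toL2 =ᵐ[volume] fun x => inner ℂ (ballFeature R x) g := by
  have h_density := coeFn_mulL2_ballSymbol hR g
  have hm : MemLp (ballDensity R g) 2 := (memLp_congr_ae h_density).mp (Lp.memLp _)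
  have h_eq : (ballEmbedding hR g).toL2 = 𝓕⁻ (hm.toLp _) := by
    rw [ballEmbedding_apply, SobolevSpace.toL2_ofBessel, fourierMultiplierL2_apply,
      fourierMultiplierL2_apply, fourier_fourierInv_eq]
    congr 1
    exact Lp.ext (h_density.trans hm.coeFn_toLp.symm)
  simp_rw [h_eq, inner_ballFeature_eq_fourierInv]
  exact coeFn_fourierInv_toLp (integrable_ballDensity R g) hm

theorem exists_injective_clm_sobolevSpace {r : ℝ} (hr : 0 ≤ r) :
    ∃ J : RKHS.OfKernel (ballMatrix 3 r) →L[ℂ] SobolevSpace 3 2,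
      Function.Injective J ∧ ∀ f, (J f).toL2 =ᵐ[volume] (f : E3 → ℂ) := by
  obtain ⟨V, hV⟩ := exists_clm_forall_apply_eq_inner_ballFeature 3 r
  have hR : 0 ≤ r / 2 := by positivity
  have h_ae : ∀ f, (ballEmbedding hR (V f)).toL2 =ᵐ[volume] (f : E3 → ℂ) := fun f => by
    rw [funext (hV f)]
    exact coeFn_toL2_ballEmbedding hR (V f)
  have h_cont : ∀ f : RKHS.OfKernel (ballMatrix 3 r), Continuous (f : E3 → ℂ) := fun f => by
    rw [funext (hV f)]
    exact continuous_inner_ballFeature _ _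
  refine ⟨ballEmbedding hR ∘L V, fun f f' h => RKHS.ext fun x => ?_, h_ae⟩
  have h_eq : ballEmbedding hR (V f) = ballEmbedding hR (V f') := h
  have h_ae_eq := (h_ae f).symm.trans (h_eq ▸ h_ae f')
  exact congrFun (((h_cont f).ae_eq_iff_eq volume (h_cont f')).mp h_ae_eq) x

end Embedding

section Strictness

open FourierTransform
open scoped ENNReal

section Shell

variable {E : Type*} [NormedAddCommGroup E] [NormedSpace ℝ E] [FiniteDimensional ℝ E]
  [MeasurableSpace E] [BorelSpace E] {μ : Measure E} [μ.IsAddHaarMeasure]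
  {F : Type*} [NormedAddCommGroup F] {f : E → F} {ρ ε M : ℝ}

theorem le_measure_real_shell (hρ : 0 ≤ ρ) (hε : 0 ≤ ε) :
    Module.finrank ℝ E * ρ ^ (Module.finrank ℝ E - 1) * ε * μ.real (ball 0 1) ≤
      μ.real (closedBall 0 (ρ + ε) \ closedBall 0 ρ) := by
  rw [measureReal_sdiff (closedBall_subset_closedBall (by linarith)) measurableSet_closedBall
      measure_closedBall_lt_top.ne,
    Measure.addHaar_real_closedBall _ _ (by positivity), Measure.addHaar_real_closedBall _ _ hρ,
    ← sub_mul]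
  gcongr
  linarith [pow_add_mul_le_add_pow hρ (by linarith : 0 ≤ 2 * ρ + ε) (Module.finrank ℝ E)]

theorem measure_real_shell_le (hf : MemLp f 2 μ) (hM : 0 ≤ M) (hε : ε ≤ ρ)
    (h : ∀ᵐ ξ ∂μ, ρ ≤ ‖ξ‖ → ‖ξ‖ ≤ 2 * ρ → 1 ≤ M * (‖ξ‖ - ρ) * ‖f ξ‖) :
    μ.real (closedBall 0 (ρ + ε) \ closedBall 0 ρ) ≤ (M * ε) ^ 2 * ∫ ξ, ‖f ξ‖ ^ 2 ∂μ := by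
  have h_sq : Integrable (fun ξ => (M * ε) ^ 2 * ‖f ξ‖ ^ 2) μ :=
    ((memLp_two_iff_integrable_sq_norm hf.1).mp hf).const_mul _
  set S := closedBall (0 : E) (ρ + ε) \ closedBall 0 ρ
  have hS_meas : MeasurableSet S := measurableSet_closedBall.diff measurableSet_closedBall
  have hS_fin : μ S ≠ ∞ := ((measure_mono Set.sdiff_subset).trans_lt measure_closedBall_lt_top).ne
  calc μ.real S = ∫ _ in S, (1 : ℝ) ∂μ := by simp
    _ ≤ ∫ ξ in S, (M * ε) ^ 2 * ‖f ξ‖ ^ 2 ∂μ := by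
      refine setIntegral_mono_on_ae (integrableOn_const hS_fin) h_sq.integrableOn hS_meas ?_
      filter_upwards [h] with ξ hξ hξS
      have h_upper : ‖ξ‖ ≤ ρ + ε := by simpa using hξS.1
      have h_lower : ρ < ‖ξ‖ := by simpa using hξS.2
      rw [← mul_pow]
      refine one_le_pow₀ ((hξ h_lower.le (by linarith)).trans ?_)
      gcongr
      linarith
    _ ≤ ∫ ξ, (M * ε) ^ 2 * ‖f ξ‖ ^ 2 ∂μ :=
      setIntegral_le_integral h_sq (ae_of_all _ fun ξ => by positivity)
    _ = (M * ε) ^ 2 * ∫ ξ, ‖f ξ‖ ^ 2 ∂μ := integral_const_mul _ _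

/-- The volume of a shell is of first order in its thickness `ε`, while the bound on it by the
integral of `‖f‖²` is of second order. -/
theorem not_forall_ae_one_le_mul_norm [Nontrivial E] (hf : MemLp f 2 μ) (hρ : 0 < ρ)
    (hM : 0 ≤ M) :
    ¬ ∀ᵐ ξ ∂μ, ρ ≤ ‖ξ‖ → ‖ξ‖ ≤ 2 * ρ → 1 ≤ M * (‖ξ‖ - ρ) * ‖f ξ‖ := by
  intro h
  have h_unit : 0 < μ.real (ball 0 1) :=
    ENNReal.toReal_pos (measure_ball_pos _ _ one_pos).ne' measure_ball_lt_top.ne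
  have h_dim : 0 < Module.finrank ℝ E := Module.finrank_pos
  set I := ∫ ξ, ‖f ξ‖ ^ 2 ∂μ
  have : 0 ≤ I := integral_nonneg fun ξ => by positivity
  set a := Module.finrank ℝ E * ρ ^ (Module.finrank ℝ E - 1) * μ.real (ball 0 1)
  have ha : 0 < a := by positivity
  have h_le : ∀ ε, 0 < ε → ε ≤ ρ → a ≤ ε * (M ^ 2 * I) := fun ε hε hερ => by
    refine le_of_mul_le_mul_left ?_ hε
    linarith [(le_measure_real_shell hρ.le hε.le).trans (measure_real_shell_le hf hM hερ h)]
  obtain ⟨ε, hε, hε_lt⟩ := exists_pos_mul_lt ha (M ^ 2 * I)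
  have := h_le (min ρ ε) (lt_min hρ hε) (min_le_left _ _)
  have : min ρ ε * (M ^ 2 * I) ≤ ε * (M ^ 2 * I) := by gcongr; exact min_le_right _ _
  linarith

end Shell

theorem exists_sobolevSpace_forall_not_ae_eq {r : ℝ} (hr : 0 < r) :
    ∃ u : SobolevSpace 3 2, ∀ f : RKHS.OfKernel (ballMatrix 3 r),
      ¬ u.toL2 =ᵐ[volume] (f : E3 → ℂ) := by
  obtain ⟨V, hV⟩ := exists_clm_forall_apply_eq_inner_ballFeature 3 r
  have hR : 0 < r / 2 := half_pos hr
  obtain ⟨ρ, hρ, M, hM, hb⟩ := exists_norm_ballTransform_le_mul_sub hR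
  set a : Lp ℂ 2 (volume : Measure E3) := (memLp_ballIndicator (2 * ρ) 0 2).toLp _
  refine ⟨SobolevSpace.ofBessel zero_le_two (𝓕⁻ a), fun f hf => ?_⟩
  have h_embed : SobolevSpace.ofBessel zero_le_two (𝓕⁻ a) = ballEmbedding hR.le (V f) := by
    refine SobolevSpace.toL2_injective (Lp.ext (hf.trans ?_))
    rw [funext (hV f)]
    exact (coeFn_toL2_ballEmbedding hR.le (V f)).symm
  have h_symbol : a = mulL2 (memLp_ballSymbol hR.le) (𝓕 (V f)) := by
    have h_bessel := congrArg (fun v => 𝓕 v.bessel) h_embed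
    simpa only [ballEmbedding_apply, SobolevSpace.bessel_ofBessel, fourierMultiplierL2_apply,
      fourier_fourierInv_eq] using h_bessel
  refine not_forall_ae_one_le_mul_norm (Lp.memLp (𝓕 (V f))) hρ
    (mul_pos (ballWeight_pos (E := E3) hR) hM).le ?_
  filter_upwards [(memLp_ballIndicator (2 * ρ) 0 2).coeFn_toLp,
    coeFn_mulL2 (memLp_ballSymbol hR.le) (𝓕 (V f))] with ξ h_toLp h_mul h_lower h_upper
  have h_one : ballIndicator (2 * ρ) 0 ξ = 1 := by simp [ballIndicator, h_upper]
  rw [← h_symbol, h_toLp, h_one] at h_mul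
  have h_norm := congrArg norm h_mul
  rw [norm_one, norm_mul, norm_ballSymbol] at h_norm
  rw [h_norm, mul_assoc (ballWeight E3 (r / 2)) M]
  exact mul_le_mul_of_nonneg_right
    (mul_le_mul_of_nonneg_left (hb ξ h_lower h_upper) (ballWeight_nonneg _)) (norm_nonneg _)

end Strictness

end BallDiscrepancy

end

theorem mainTheorem10_general (r : ℝ) (hr : 0 < r) :
    (∃ J : RKHS.OfKernel (BallDiscrepancy.ballMatrix 3 r) →L[ℂ] BallDiscrepancy.SobolevSpace 3 2,
      Function.Injective J ∧
        ∀ f, (J f).toL2 =ᵐ[MeasureTheory.volume] (f : EuclideanSpace ℝ (Fin 3) → ℂ)) ∧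
    (∃ u : BallDiscrepancy.SobolevSpace 3 2,
      ∀ f : RKHS.OfKernel (BallDiscrepancy.ballMatrix 3 r),
        ¬ u.toL2 =ᵐ[MeasureTheory.volume] (f : EuclideanSpace ℝ (Fin 3) → ℂ)) ∧
    (∀ (ι : ℕ → Type*) [∀ m, Fintype (ι m)]
      (Y : ∀ m, ι m → Metric.sphere (0 : EuclideanSpace ℝ (Fin 3)) 1 → ℂ),
      (∀ m, BallDiscrepancy.IsSphericalHarmonicBasis 3 m (Y m)) →
      (∀ x y, Summable (BallDiscrepancy.sphereSobolevTerm 3 (3 / 2) Y x y)) ∧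
      ∃ _ : Fact (BallDiscrepancy.sphereSobolevMatrix 3 (3 / 2) Y).PosSemidef,
        ∃ T : RKHS.OfKernel (BallDiscrepancy.ballMatrixSphere 3 r) ≃L[ℂ]
            RKHS.OfKernel (BallDiscrepancy.sphereSobolevMatrix 3 (3 / 2) Y),
          ∀ f x, T f x = f x) :=
  ⟨BallDiscrepancy.exists_injective_clm_sobolevSpace hr.le,
    BallDiscrepancy.exists_sobolevSpace_forall_not_ae_eq hr, fun _ _ _ hY =>
      ⟨BallDiscrepancy.summable_sphereSobolevTerm hY,
        ⟨BallDiscrepancy.posSemidef_sphereSobolevMatrix hY⟩,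
        have : Fact _ := ⟨BallDiscrepancy.posSemidef_sphereSobolevMatrix hY⟩
        BallDiscrepancy.exists_continuousLinearEquiv_sphere hY hr⟩⟩

theorem mainTheorem10 (r : ℝ) (hr : 1 ≤ r) :
    (∃ J : RKHS.OfKernel (BallDiscrepancy.ballMatrix 3 r) →L[ℂ] BallDiscrepancy.SobolevSpace 3 2,
      Function.Injective J ∧
        ∀ f, (J f).toL2 =ᵐ[MeasureTheory.volume] (f : EuclideanSpace ℝ (Fin 3) → ℂ)) ∧
    (∃ u : BallDiscrepancy.SobolevSpace 3 2,
      ∀ f : RKHS.OfKernel (BallDiscrepancy.ballMatrix 3 r),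
        ¬ u.toL2 =ᵐ[MeasureTheory.volume] (f : EuclideanSpace ℝ (Fin 3) → ℂ)) ∧
    (∀ (ι : ℕ → Type) [∀ m, Fintype (ι m)]
      (Y : ∀ m, ι m → Metric.sphere (0 : EuclideanSpace ℝ (Fin 3)) 1 → ℂ),
      (∀ m, BallDiscrepancy.IsSphericalHarmonicBasis 3 m (Y m)) →
      (∀ x y, Summable (BallDiscrepancy.sphereSobolevTerm 3 (3 / 2) Y x y)) ∧
      ∃ _ : Fact (BallDiscrepancy.sphereSobolevMatrix 3 (3 / 2) Y).PosSemidef,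
        ∃ T : RKHS.OfKernel (BallDiscrepancy.ballMatrixSphere 3 r) ≃L[ℂ]
            RKHS.OfKernel (BallDiscrepancy.sphereSobolevMatrix 3 (3 / 2) Y),
          ∀ f x, T f x = f x) :=
  mainTheorem10_general r (zero_lt_one.trans_le hr)
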